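/- **Setting.** Consider an episodic loop-free Markov decision process with finite state space $\mathcal S=\mathcal S_0\sqcup\dots\sqcup\mathcal S_L$, where $\mathcal S_0=\{s_0\}$ and $\mathcal S_L=\{s_L\}$, finite action space $\mathcal A$, and unknown transition probabilities $P(s'|s,a)$, which are positive only if $s\in\mathcal S_k$ and $s'\in\mathcal S_{k+1}$ for some $k<L$. Write $k(s)$ for the layer of $s$ and $\langle h,\theta\rangle=\sum_{s,a,s'}h(s,a,s')\theta(s,a,s')$. A *flow* is a function $\theta\ge 0$ on $\mathcal S\times\mathcal A\times\mathcal S$, supported on triples from consecutive layers, with $\sum_{s\in\mathcal S_k,a,s'}\theta(s,a,s')=1$ for all $k<L$ and $\sum_{r,a}\theta(r,a,s)=\sum_{a,s'}\theta(s,a,s')$ for all $s$ in the layers $1,\dots,L-1$. Let $\Delta$ be the set of flows with $\theta(s,a,s')=P(s'|s,a)\sum_{s''}\theta(s,a,s'')$ for all $(s,a,s')$ (the occupancy measures of policies under $P$). The losses $f^t:\mathcal S\times\mathcal A\times\mathcal S\to\mathbb R$, $t\ge1$, are an arbitrary fixed sequence. The constraint functions are $g_i^t=g_i(\cdot;\xi_i^t)$,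 $i\in[I]$, with $\xi_i^t\sim\mathcal D_i$ independent over $i$ and $t$ and independent of the Markov transitions; $g_i=\mathbb E[g_i^t]$, and $c\in\mathbb R^I$. For a function $\varphi$ on $\mathcal S\times\mathcal A\times\mathcal S$ let $(\mathrm P_\varphi)$ be the program: minimize $\langle\varphi,\theta\rangle$ over $\theta\in\Delta$ subject to $\langle g_i,\theta\rangle\le c_i$ for all $i\in[I]$. Its dual function is $q_\varphi(\eta)=\min_{\theta\in\Delta}\langle\varphi,\theta\rangle+\sum_i\eta_i(\langle g_i,\theta\rangle-c_i)$, and $\mathcal V^*_\varphi=\arg\max_{\eta\in\mathbb R^I_+}q_\varphi(\eta)$ is its set of Lagrange multipliers. For $\varphi=f^{(t,\tau)}=\frac1\tau\sum_{j=0}^{\tau-1}f^{t+j}$ write $q^{(t,\tau)}$ and $\mathcal V^*_{t,\tau}$. **Algorithm (Upper-Confidence Primal-Dual),** with parameters $V,\alpha>0$, $\lambda\in[0,1)$, $\zeta\in(0,1)$ and horizon $T$. Let $u(s,a,s')=1/(|\mathcal S_k||\mathcal S_{k+1}||\mathcal A|)$ on $\mathcal S_k\times\mathcal A\times\mathcal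 S_{k+1}$ for $k<L$, and $u=0$ elsewhere. Start with $\theta^1=u$, $Q(1)=0$, epoch $\ell(1)=1$ and all counters $0$. In episode $t$ a path is sampled with the policy $\pi_t(a|s)=\sum_{s'}\theta^t(s,a,s')/\sum_{b,s'}\theta^t(s,b,s')$ and the true transitions; afterwards $f^t$ and the $g_i^t$ are revealed. Let $N_\ell(s,a),M_\ell(s,a,s')$ count the occurrences of $(s,a)$, $(s,a,s')$ before epoch $\ell$, and $n_\ell(s,a)$ those of $(s,a)$ within epoch $\ell$ so far; a new epoch starts after an episode at whose end $n_\ell(s,a)\ge\max\{1,N_\ell(s,a)\}$ for some $(s,a)$. Put $\widehat P_\ell(s'|s,a)=M_\ell(s,a,s')/\max\{1,N_\ell(s,a)\}$ and $$\varepsilon_\ell^\zeta(s,a)=\sqrt{\frac{2|\mathcal S_{k(s)+1}|\log[(T+1)|\mathcal S||\mathcal A|/\zeta]}{\max\{1,N_\ell(s,a)\}}},$$ and let $\Delta(\ell,\zeta)$ be the set of flows $\theta$ with $\sum_{s'}\big|\theta(s,a,s')-\widehat P_\ell(s'|s,a)\sum_{s''}\theta(s,a,s'')\big|\le\varepsilon^\zeta_\ell(s,a)\sum_{s''}\theta(s,a,s'')$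 for all $(s,a)$. For $t\ge2$, $$\theta^t\in\arg\min_{\theta\in\Delta(\ell(t),\zeta)}\Big\langle Vf^{t-1}+\sum_iQ_i(t-1)g_i^{t-1},\theta\Big\rangle+\alpha D\big(\theta,(1-\lambda)\theta^{t-1}+\lambda u\big),$$ $$Q_i(t)=\max\{Q_i(t-1)+\langle g_i^{t-1},\theta^t\rangle-c_i,\,0\},$$ where $D(\theta,\theta')=\sum\big[\theta\log(\theta/\theta')-\theta+\theta'\big]$ is the unnormalized Kullback–Leibler divergence. Let $\overline\theta^t\in\Delta$ be the occupancy measure of $\pi_t$ under $P$, let $\overline\theta^*$ be a solution of $(\mathrm P_\varphi)$ for $\varphi=\sum_{t=1}^Tf^t$, and put $$\mathrm{Regret}(T)=\sum_{t=1}^T\langle f^t,\overline\theta^t-\overline\theta^*\rangle,\qquad \mathrm{Violation}(T)=\bigg\|\bigg[\sum_{t=1}^T\big(\langle g_i^t,\overline\theta^t\rangle-c_i\big)\bigg]_{+,\ i\in[I]}\bigg\|_2 .$$ **Theorem.** For all constants $\overline\sigma,\overline\vartheta,B>0$ there is a constant $C>0$, depending only on these, such that the following holds. Let $|\mathcal S|,|\mathcal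 A|>1$ and $T\ge|\mathcal S||\mathcal A|$, and let $\tau$ be $\sqrt T$ or, if this is not an integer, either of the two integers next to it. Assume: 1. (Feasibility) there is $\theta\in\Delta$ with $\langle g_i,\theta\rangle\le c_i$ for all $i\in[I]$; 2. (Boundedness) $\sup|f^t|\le1$ for $1\le t\le T$; $\sum_{i}\sup_{s,a,s'}|g_i^t(s,a,s')|\le1$ almost surely; $\sum_i|c_i|\le L$; 3. (Lagrange multipliers) for all $t,\tau'\ge1$, the program $(\mathrm P_\varphi)$ with $\varphi=f^{(t,\tau')}$ has a solution and $\mathcal V^*_{t,\tau'}$ is non-empty and bounded; and $\|\eta\|_2\le B$ for all $\eta\in\mathcal V^*_{t,\tau}$, $1\le t\le T$; 4. (Uniform error bound) for every $1\le t\le T$ there are $\sigma\ge\overline\sigma$ and $0<\vartheta\le\overline\vartheta$ such that $$q^{(t,\tau)}(\eta^*)-q^{(t,\tau)}(\eta)\ge\sigma\,\mathrm{dist}(\eta,\mathcal V^*_{t,\tau})$$ for all $\eta^*\in\mathcal V^*_{t,\tau}$ and all $\eta\in\mathbb R^I_+$ with $\mathrm{dist}(\eta,\mathcal V^*_{t,\tau})\ge\vartheta$.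 Run the algorithm with $\alpha=LT$, $V=L\sqrt T$, $\lambda=1/T$ and $0<\zeta\le1/(4+8L/\overline\sigma)$. Then, with probability at least $1-4\zeta$, both $$\mathrm{Regret}(T)\quad\text{and}\quad\mathrm{Violation}(T)$$ are at most $$C\,L|\mathcal S|\sqrt{T|\mathcal A|}\,\Big(\log^{3/2}\frac T\zeta+\log\frac{T|\mathcal S||\mathcal A|}\zeta\Big).$$ -/

import Mathlib

open MeasureTheory ProbabilityTheory

noncomputable section

namespace UCPD

/-- Pairing of two functions on state-action-state triples. -/
def pairing {S A : Type*} [Fintype S] [Fintype A] (h θ : S × A × S → ℝ) : ℝ :=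
  ∑ e, h e * θ e

/-- An episodic loop-free MDP with layers `0, …, L`: the first layer is `{init}`, the last one is
`{term}`, and `P s a s'` is the probability of moving from `s` to `s'` under the action `a`.
Transitions go from a layer to the next one only; nothing leaves the terminal state. -/
structure LoopFreeMDP (S A : Type*) [Fintype S] (L : ℕ) where
  layer : S → ℕ
  layer_le : ∀ s, layer s ≤ L
  init : S
  layer_eq_zero_iff : ∀ s, layer s = 0 ↔ s = init
  term : S
  layer_eq_last_iff : ∀ s, layer s = L ↔ s = term
  P : S → A → S → ℝ
  P_nonneg : ∀ s a s', 0 ≤ P s a s'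
  P_sum : ∀ s a, layer s < L → ∑ s', P s a s' = 1
  P_layer : ∀ s a s', layer s' ≠ layer s + 1 → P s a s' = 0

/-- A path of an episode: the states `s_0, …, s_L` and the actions `a_0, …, a_{L-1}`. -/
abbrev Path (S A : Type*) (L : ℕ) : Type _ := (Fin (L + 1) → S) × (Fin L → A)

/-- How often a path takes the action `a` in the state `s`. -/
def visits {S A : Type*} [DecidableEq S] [DecidableEq A] {L : ℕ}
    (p : Path S A L) (s : S) (a : A) : ℕ :=
  (Finset.univ.filter fun k : Fin L => p.1 k.castSucc = s ∧ p.2 k = a).card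

/-- How often a path takes the action `a` in the state `s` and moves on to `s'`. -/
def moves {S A : Type*} [DecidableEq S] [DecidableEq A] {L : ℕ}
    (p : Path S A L) (s : S) (a : A) (s' : S) : ℕ :=
  (Finset.univ.filter fun k : Fin L =>
    p.1 k.castSucc = s ∧ p.2 k = a ∧ p.1 k.succ = s').card

/-- The counters of the algorithm: the index of the epoch, the global counters `N`, `M` (visits
before the current epoch) and the local counters `n`, `m` (visits during the current epoch). -/
structure Counters (S A : Type*) where
  epoch : ℕ
  N : S → A → ℕ
  M : S → A → S → ℕ
  n : S → A → ℕ
  m : S → A → S → ℕ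

namespace Counters

variable {S A : Type*}

/-- The counters at the beginning of the first episode. -/
def initial : Counters S A where
  epoch := 1
  N := fun _ _ => 0
  M := fun _ _ _ => 0
  n := fun _ _ => 0
  m := fun _ _ _ => 0

/-- Adding the path of an episode to the local counters. -/
def record [DecidableEq S] [DecidableEq A] {L : ℕ} (K : Counters S A) (p : Path S A L) :
    Counters S A where
  epoch := K.epoch
  N := K.N
  M := K.M
  n := fun s a => K.n s a + visits p s a
  m := fun s a s' => K.m s a s' + moves p s a s'

/-- Starting a new epoch. -/
def newEpoch (K : Counters S A) : Counters S A where
  epoch := K.epoch + 1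
  N := fun s a => K.N s a + K.n s a
  M := fun s a s' => K.M s a s' + K.m s a s'
  n := fun _ _ => 0
  m := fun _ _ _ => 0

/-- The update at the end of an episode: the path is recorded, and a new epoch is started if
some pair has been visited in this epoch at least `max {1, N s a}` times. -/
def step [Fintype S] [Fintype A] [DecidableEq S] [DecidableEq A] {L : ℕ}
    (K : Counters S A) (p : Path S A L) : Counters S A :=
  if ∃ s a, max 1 (K.N s a) ≤ (K.record p).n s a then (K.record p).newEpoch else K.record p

/-- The counters at the beginning of episode `t` (`t = 1, 2, …`), when the paths of the episodes
`1, 2, …` are `x 1, x 2, …`. -/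
def atEpisode [Fintype S] [Fintype A] [DecidableEq S] [DecidableEq A] {L : ℕ}
    (x : ℕ → Path S A L) : ℕ → Counters S A
  | 0 => initial
  | 1 => initial
  | t + 2 => (atEpisode x (t + 1)).step (x (t + 1))

/-- The empirical transition model of the current epoch. -/
def empirical (K : Counters S A) (s : S) (a : A) (s' : S) : ℝ :=
  (K.M s a s' : ℝ) / (max 1 (K.N s a) : ℕ)

end Counters

/-- The policy retrieved from an occupancy measure. -/
def policyOf {S A : Type*} [Fintype S] [Fintype A] (θ : S × A × S → ℝ) (s : S) (a : A) : ℝ :=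
  (∑ s', θ (s, a, s')) / ∑ b, ∑ s', θ (s, b, s')

/-- The unnormalized Kullback-Leibler divergence. -/
def divergence {S A : Type*} [Fintype S] [Fintype A] (θ θ' : S × A × S → ℝ) : ℝ :=
  ∑ e, (θ e * Real.log (θ e / θ' e) - θ e + θ' e)

/-- The dual multipliers: `Q_i(1) = 0` and
`Q_i(t+1) = max {Q_i(t) + ⟨g_i^t, θ^{t+1}⟩ - c_i, 0}`. -/
def multiplier {S A ι : Type*} [Fintype S] [Fintype A] (g : ℕ → ι → S × A × S → ℝ) (c : ι → ℝ)
    (θ : ℕ → S × A × S → ℝ) : ℕ → ι → ℝ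
  | 0 => fun _ => 0
  | 1 => fun _ => 0
  | t + 2 => fun i =>
      max (multiplier g c θ (t + 1) i + pairing (g (t + 1) i) (θ (t + 2)) - c i) 0

/-- The averaged loss `f^{(t,τ)}`. -/
def avgLoss {S A : Type*} (f : ℕ → S × A × S → ℝ) (t τ : ℕ) : S × A × S → ℝ :=
  fun e => (1 / (τ : ℝ)) * ∑ j ∈ Finset.range τ, f (t + j) e

/-- The expected constraint functions `g_i = 𝔼 g_i(·; ξ_i)`, `ξ_i ∼ 𝒟_i`. -/
def meanConstraint {S A ι : Type*} {Ξ : ι → Type*} [∀ i, MeasurableSpace (Ξ i)]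
    (G : (i : ι) → S × A × S → Ξ i → ℝ) (D : (i : ι) → Measure (Ξ i)) (i : ι) :
    S × A × S → ℝ :=
  fun e => ∫ x, G i e x ∂(D i)

namespace LoopFreeMDP

variable {S A : Type*} [Fintype S] [Fintype A] {L : ℕ}

/-- The number of states in layer `k`. -/
def layerCard (M : LoopFreeMDP S A L) (k : ℕ) : ℕ :=
  (Finset.univ.filter fun s => M.layer s = k).card

/-- The layerwise uniform measure on the triples from consecutive layers. -/
def uniform (M : LoopFreeMDP S A L) : S × A × S → ℝ := fun e =>
  if M.layer e.2.2 = M.layer e.1 + 1 then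
    1 / ((M.layerCard (M.layer e.1) : ℝ) * M.layerCard (M.layer e.1 + 1) * Fintype.card A)
  else 0

/-- Nonnegative measures on the triples from consecutive layers that have mass one in each layer
and satisfy the flow condition at each state of the layers `1, …, L-1`. -/
structure IsFlow (M : LoopFreeMDP S A L) (θ : S × A × S → ℝ) : Prop where
  support : ∀ s a s', M.layer s' ≠ M.layer s + 1 → θ (s, a, s') = 0
  nonneg : ∀ e, 0 ≤ θ e
  mass : ∀ k < L, ∑ s with M.layer s = k, ∑ a, ∑ s', θ (s, a, s') = 1
  flow : ∀ s, 0 < M.layer s → M.layer s < L →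
    ∑ r, ∑ a, θ (r, a, s) = ∑ a, ∑ s', θ (s, a, s')

/-- The set `Δ` of occupancy measures of the true model. The condition
`θ(s,a,s') / ∑_{s''} θ(s,a,s'') = P(s'|s,a)` is cleared of its denominator, so that it is void
at pairs `(s,a)` of mass zero. -/
def occupancySet (M : LoopFreeMDP S A L) : Set (S × A × S → ℝ) :=
  {θ | M.IsFlow θ ∧ ∀ s a s', θ (s, a, s') = M.P s a s' * ∑ s'', θ (s, a, s'')}

/-- The radius `ε` of the confidence set. -/
def radius (M : LoopFreeMDP S A L) (T : ℕ) (ζ : ℝ) (K : Counters S A) (s : S) (a : A) : ℝ :=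
  √(2 * M.layerCard (M.layer s + 1) *
      Real.log (((T : ℝ) + 1) * Fintype.card S * Fintype.card A / ζ) /
    (max 1 (K.N s a) : ℕ))

/-- The optimistic set `Δ(ℓ, ζ)`, where `K` holds the counters of epoch `ℓ`. The condition
`‖θ(s,a,·) / ∑_{s'} θ(s,a,s') - P̂(·|s,a)‖₁ ≤ ε(s,a)` is cleared of its denominator. -/
def optimisticSet (M : LoopFreeMDP S A L) (T : ℕ) (ζ : ℝ) (K : Counters S A) :
    Set (S × A × S → ℝ) :=
  {θ | M.IsFlow θ ∧ ∀ s a,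
    ∑ s', |θ (s, a, s') - K.empirical s a s' * ∑ s'', θ (s, a, s'')|
      ≤ M.radius T ζ K s a * ∑ s'', θ (s, a, s'')}

/-- The mixture `θ̃ = (1 - λ) θ + λ · uniform`. -/
def mix (M : LoopFreeMDP S A L) (lam : ℝ) (θ : S × A × S → ℝ) : S × A × S → ℝ :=
  fun e => (1 - lam) * θ e + lam * M.uniform e

/-- The distribution of the state in layer `k` under the policy `π` and the true transitions. -/
def stateDist [DecidableEq S] (M : LoopFreeMDP S A L) (π : S → A → ℝ) : ℕ → S → ℝ
  | 0 => fun s => if s = M.init then 1 else 0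
  | k + 1 => fun s' => ∑ s, ∑ a, M.stateDist π k s * π s a * M.P s a s'

/-- The occupancy measure of the policy `π` under the true transitions. -/
def occupancy [DecidableEq S] (M : LoopFreeMDP S A L) (π : S → A → ℝ) : S × A × S → ℝ :=
  fun e => M.stateDist π (M.layer e.1) e.1 * π e.1 e.2.1 * M.P e.1 e.2.1 e.2.2

/-- The probability of a path under the policy `π` and the true transitions. -/
def pathProb [DecidableEq S] (M : LoopFreeMDP S A L) (π : S → A → ℝ) (p : Path S A L) : ℝ :=
  (if p.1 0 = M.init then 1 else 0) *
    ∏ k : Fin L, π (p.1 k.castSucc) (p.2 k) * M.P (p.1 k.castSucc) (p.2 k) (p.1 k.succ)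

variable {ι : Type*}

/-- The feasible set `{θ ∈ Δ : ⟨g_i, θ⟩ ≤ c_i for all i}`. -/
def feasibleSet (M : LoopFreeMDP S A L) (g : ι → S × A × S → ℝ) (c : ι → ℝ) :
    Set (S × A × S → ℝ) :=
  {θ | θ ∈ M.occupancySet ∧ ∀ i, pairing (g i) θ ≤ c i}

/-- The solutions of: minimize `⟨φ, θ⟩` over the feasible set. -/
def solutionSet (M : LoopFreeMDP S A L) (g : ι → S × A × S → ℝ) (c : ι → ℝ)
    (φ : S × A × S → ℝ) : Set (S × A × S → ℝ) :=
  {θ | θ ∈ M.feasibleSet g c ∧ ∀ θ' ∈ M.feasibleSet g c, pairing φ θ ≤ pairing φ θ'}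

variable [Fintype ι]

/-- The Lagrangian dual function
`q(η) = min_{θ ∈ Δ} ⟨φ, θ⟩ + ∑_i η_i (⟨g_i, θ⟩ - c_i)`. -/
def dualFunction (M : LoopFreeMDP S A L) (g : ι → S × A × S → ℝ) (c : ι → ℝ)
    (φ : S × A × S → ℝ) (η : EuclideanSpace ℝ ι) : ℝ :=
  sInf ((fun θ => pairing φ θ + ∑ i, η i * (pairing (g i) θ - c i)) '' M.occupancySet)

/-- The set `𝒱*` of Lagrange multipliers: the maximizers of `q` over the nonnegative orthant. -/
def multiplierSet (M : LoopFreeMDP S A L) (g : ι → S × A × S → ℝ) (c : ι → ℝ)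
    (φ : S × A × S → ℝ) : Set (EuclideanSpace ℝ ι) :=
  {η | (∀ i, 0 ≤ η i) ∧ ∀ η' : EuclideanSpace ℝ ι, (∀ i, 0 ≤ η' i) →
    M.dualFunction g c φ η' ≤ M.dualFunction g c φ η}

/-- The error bound for the dual function with the constants `σ` and `ϑ`. -/
def ErrorBound (M : LoopFreeMDP S A L) (g : ι → S × A × S → ℝ) (c : ι → ℝ)
    (φ : S × A × S → ℝ) (σ ϑ : ℝ) : Prop :=
  ∀ η : EuclideanSpace ℝ ι, (∀ i, 0 ≤ η i) →
    ϑ ≤ Metric.infDist η (M.multiplierSet g c φ) →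
    ∀ ηstar ∈ M.multiplierSet g c φ,
      σ * Metric.infDist η (M.multiplierSet g c φ)
        ≤ M.dualFunction g c φ ηstar - M.dualFunction g c φ η

/-- The objective of the optimistic regularized linear program. -/
def objective (M : LoopFreeMDP S A L) (V α lam : ℝ) (f : S × A × S → ℝ)
    (g : ι → S × A × S → ℝ) (Q : ι → ℝ) (θprev θ : S × A × S → ℝ) : ℝ :=
  pairing (fun e => V * f e + ∑ i, Q i * g i e) θ + α * divergence θ (M.mix lam θprev)

/-- `θ 1, θ 2, …` are the occupancy measures computed by the algorithm when the losses are `f`,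
the observed constraint functions are `g` and the sampled paths are `x`. -/
structure IsUCPDSequence [DecidableEq S] [DecidableEq A] (M : LoopFreeMDP S A L) (T : ℕ)
    (V α lam ζ : ℝ) (f : ℕ → S × A × S → ℝ) (g : ℕ → ι → S × A × S → ℝ) (c : ι → ℝ)
    (x : ℕ → Path S A L) (θ : ℕ → S × A × S → ℝ) : Prop where
  first : θ 1 = M.uniform
  mem : ∀ t, 1 ≤ t → θ (t + 1) ∈ M.optimisticSet T ζ (Counters.atEpisode x (t + 1))
  min : ∀ t, 1 ≤ t → ∀ θ' ∈ M.optimisticSet T ζ (Counters.atEpisode x (t + 1)),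
    M.objective V α lam (f t) (g t) (multiplier g c θ t) (θ t) (θ (t + 1))
      ≤ M.objective V α lam (f t) (g t) (multiplier g c θ t) (θ t) θ'

/-- A run of the algorithm on a probability space: `X t` is the path of episode `t`, `ξ t` holds
the samples `ξ_i^t` behind the constraint functions `g_i^t = g_i(·; ξ_i^t)`, `θ t` is the occupancy
measure computed by the algorithm, and `𝓕 t` contains the history up to episode `t`. Given the past,
the path of an episode follows the policy retrieved from `θ` and the true transitions, and the
samples `ξ_i` are distributed according to `𝒟_i`, independent of each other and of the path. -/
structure IsUCPDRun [DecidableEq S] [DecidableEq A] {Ξ : ι → Type*} [∀ i, MeasurableSpace (Ξ i)]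
    {Ω : Type*} [mΩ : MeasurableSpace Ω]
    (M : LoopFreeMDP S A L) (T : ℕ) (V α lam ζ : ℝ) (f : ℕ → S × A × S → ℝ)
    (G : (i : ι) → S × A × S → Ξ i → ℝ) (D : (i : ι) → Measure (Ξ i)) (c : ι → ℝ)
    (μ : Measure Ω) (𝓕 : Filtration ℕ mΩ) (X : ℕ → Ω → Path S A L)
    (ξ : ℕ → Ω → (i : ι) → Ξ i) (θ : ℕ → Ω → S × A × S → ℝ) : Prop where
  measurable_path : ∀ t, 1 ≤ t → ∀ p, MeasurableSet[𝓕 t] {ω | X t ω = p}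
  measurable_noise : ∀ t, 1 ≤ t → Measurable[𝓕 t] (ξ t)
  measurable_occ : ∀ t, Measurable[𝓕 t] (θ (t + 1))
  algorithm : ∀ᵐ ω ∂μ, M.IsUCPDSequence T V α lam ζ f (fun t i e => G i e (ξ t ω i)) c
    (fun t => X t ω) (fun t => θ t ω)
  law : ∀ t p (E : Set ((i : ι) → Ξ i)), MeasurableSet E →
    μ[Set.indicator {ω | X (t + 1) ω = p ∧ ξ (t + 1) ω ∈ E} (fun _ => (1 : ℝ)) | 𝓕 t]
      =ᵐ[μ] fun ω => M.pathProb (policyOf (θ (t + 1) ω)) p * (Measure.pi D).real E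

end LoopFreeMDP

/-- `Regret(T)`, where `θbar t` is the true occupancy measure of episode `t`. -/
def regret {S A : Type*} [Fintype S] [Fintype A] (T : ℕ) (f : ℕ → S × A × S → ℝ)
    (θbar : ℕ → S × A × S → ℝ) (θstar : S × A × S → ℝ) : ℝ :=
  ∑ t ∈ Finset.Icc 1 T, pairing (f t) (θbar t - θstar)

/-- `Violation(T)`, where `θbar t` is the true occupancy measure of episode `t`. -/
def violation {S A ι : Type*} [Fintype S] [Fintype A] [Fintype ι] (T : ℕ)
    (g : ℕ → ι → S × A × S → ℝ) (c : ι → ℝ) (θbar : ℕ → S × A × S → ℝ) : ℝ :=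
  ‖(WithLp.toLp 2 fun i => max (∑ t ∈ Finset.Icc 1 T, (pairing (g t i) (θbar t) - c i)) 0 :
    EuclideanSpace ℝ ι)‖

end UCPD

end

/-!
The proof separates what happens along a single path from what happens with high probability.

**Along a path.** Let `Q(t)` be the multipliers and `Z(t) = ‖Q(t)‖`. Since `θ^{t+1}` minimizes a
linear function plus `α D(·, θ̃^t)` over a convex set, it can be compared with any point `z` of
that set, with `α (D(z, θ̃^t) - D(z, θ̃^{t+1}))` as a telescoping remainder (`mirror_step`; only
convexity is used, no differentiability at the boundary). Combined with the update of `Q`, this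
gives the drift inequality `drift_step`: the weighted regret of an episode against `z`, plus half
the increase of `Z²`, is at most the pairing of `Q(t)` with the constraint values at `z`, plus
`O(L²)`. The true occupancy measures may be used as `z` as long as the true model lies in the
confidence sets.

*The multipliers.* Over a window of `τ` episodes starting at `w`, take for `z` a near-minimizer of
the Lagrangian of the window at `Q(w) / V`. By the error bound its value lies below the optimum by
at least `σ (Z(w) / V - B)`, up to a constant, as soon as `Z(w)` is of order `V`; so `Z` decreases
by `σ τ / 2` up to the noise in the observed constraint functions (`vecNorm_window_le`). Chaining
windows backwards until `Z` is small shows that `Z` stays of order `L² √T log (T / ζ)` provided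
that the sums of the noise over chains of windows exceed their linear allowance by little
(`vecNorm_multiplier_le`).

*Regret and violation.* Summing the drift inequality with `z` the reference point bounds the
regret of the optimistic measures `θ^t` (`regret_le`). The violation is bounded by `Z(T+1)` plus
the movement of `θ^t`, which is small inside an epoch and bounded at the few epoch changes
(`violation_le`). Both are passed on to the true occupancy measures by `l1Norm_sub_occupancy_le`:
the distance of `θ^t` from the occupancy measure of its policy is at most `2 L` times the expected
confidence width collected in an episode.

**With high probability.** Four events of probability at most `ζ` are excluded: the true model
leaves a confidence set (`measure_not_confidence_le`, an exponential supermartingale whose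
compensator counts visits); the expected widths exceed the widths along the sampled paths by much
(`measure_expectedWidth_le`); a sum of the noise over a chain of windows exceeds its allowance
(`measure_noise_le`); and the martingale comparing the multipliers with the reference point is
large while the multipliers are not (`measure_truncated_noise_le`). The near-minimizers have to be
chosen measurably in `Q(w)` for the noise to be a martingale difference
(`exists_measurable_choice`). All four rest on a product bound for nonnegative variables of
conditional mean at most one (`measure_le_prod`), directly or through Azuma's inequality (`azuma`).
-/

noncomputable section

set_option linter.unusedSectionVars false

namespace UCPD

/-! ### The pairing and the `ℓ¹` norm -/

section

/-- The `ℓ¹` norm of a function on state-action-state triples. -/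
def l1Norm {S A : Type*} [Fintype S] [Fintype A] (h : S × A × S → ℝ) : ℝ := ∑ e, |h e|

section Pairing

variable {S A : Type*} [Fintype S] [Fintype A]

lemma pairing_sub_right (h θ θ' : S × A × S → ℝ) :
    pairing h (θ - θ') = pairing h θ - pairing h θ' := by
  simp [pairing, mul_sub, Finset.sum_sub_distrib]

lemma l1Norm_nonneg (h : S × A × S → ℝ) : 0 ≤ l1Norm h := Finset.sum_nonneg fun _ _ => abs_nonneg _

lemma l1Norm_add_le (h h' : S × A × S → ℝ) : l1Norm (h + h') ≤ l1Norm h + l1Norm h' := by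
  simp only [l1Norm, ← Finset.sum_add_distrib]
  exact Finset.sum_le_sum fun e _ => abs_add_le _ _

lemma l1Norm_sub_comm (h h' : S × A × S → ℝ) : l1Norm (h - h') = l1Norm (h' - h) :=
  Finset.sum_congr rfl fun _ _ => abs_sub_comm _ _

lemma l1Norm_sub_le (h h' h'' : S × A × S → ℝ) :
    l1Norm (h - h'') ≤ l1Norm (h - h') + l1Norm (h' - h'') := by
  simpa using l1Norm_add_le (h - h') (h' - h'')

lemma abs_pairing_le {h θ : S × A × S → ℝ} {c : ℝ} (hc : ∀ e, |h e| ≤ c) :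
    |pairing h θ| ≤ c * l1Norm θ := by
  rw [pairing, l1Norm, Finset.mul_sum]
  refine (Finset.abs_sum_le_sum_abs _ _).trans (Finset.sum_le_sum fun e _ => ?_)
  rw [abs_mul]
  exact mul_le_mul_of_nonneg_right (hc e) (abs_nonneg _)

/-- If the sup norms of the functions `g i` sum up to at most one, then the pairings of all of them
with `θ` sum up to at most the `ℓ¹` norm of `θ`. -/
lemma sum_abs_pairing_le {ι : Type*} [Fintype ι] {g : ι → S × A × S → ℝ} (θ : S × A × S → ℝ)
    (hg : ∑ i, ⨆ e, |g i e| ≤ 1) : ∑ i, |pairing (g i) θ| ≤ l1Norm θ := by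
  calc ∑ i, |pairing (g i) θ| ≤ ∑ i, (⨆ e, |g i e|) * l1Norm θ :=
        Finset.sum_le_sum fun i _ => abs_pairing_le fun e =>
          le_ciSup (Set.finite_range fun e => |g i e|).bddAbove e
    _ = (∑ i, ⨆ e, |g i e|) * l1Norm θ := by rw [Finset.sum_mul]
    _ ≤ 1 * l1Norm θ := mul_le_mul_of_nonneg_right hg (l1Norm_nonneg _)
    _ = l1Norm θ := one_mul _

lemma abs_le_one_of_sum_iSup_le {ι : Type*} [Fintype ι] {g : ι → S × A × S → ℝ}
    (hg : ∑ i, ⨆ e, |g i e| ≤ 1) (i : ι) (e : S × A × S) : |g i e| ≤ 1 :=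
  (le_ciSup (Set.finite_range fun e => |g i e|).bddAbove e).trans
    ((Finset.single_le_sum (f := fun i => ⨆ e, |g i e|)
      (fun _ _ => Real.iSup_nonneg fun _ => abs_nonneg _) (Finset.mem_univ i)).trans hg)

lemma sum_triple {E : Type*} [AddCommMonoid E] (F : S × A × S → E) :
    ∑ e, F e = ∑ s, ∑ a, ∑ s', F (s, a, s') := by
  rw [Fintype.sum_prod_type]
  simp_rw [Fintype.sum_prod_type]

end Pairing

namespace LoopFreeMDP

variable {S A : Type*} [Fintype S] [Fintype A] {L : ℕ}

/-! ### Layers and flows -/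

lemma layer_init (M : LoopFreeMDP S A L) : M.layer M.init = 0 := (M.layer_eq_zero_iff _).2 rfl

lemma layer_lt_iff (M : LoopFreeMDP S A L) (s : S) : M.layer s < L ↔ s ≠ M.term := by
  rw [ne_eq, ← M.layer_eq_last_iff, lt_iff_le_and_ne]
  exact ⟨fun h => h.2, fun h => ⟨M.layer_le s, h⟩⟩

lemma length_pos (M : LoopFreeMDP S A L) (hS : 1 < Fintype.card S) : 0 < L := by
  by_contra h
  obtain rfl : L = 0 := by omega
  obtain ⟨s, s', hne⟩ := Fintype.one_lt_card_iff.1 hS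
  have hs : ∀ r : S, r = M.init := fun r =>
    (M.layer_eq_zero_iff r).1 (Nat.le_zero.1 (M.layer_le r))
  exact hne ((hs s).trans (hs s').symm)

/-- Every layer has a state, since the transition probabilities at a state sum up to one. -/
lemma exists_layer_eq [Nonempty A] (M : LoopFreeMDP S A L) :
    ∀ k ≤ L, ∃ s, M.layer s = k := by
  intro k
  induction k with
  | zero => exact fun _ => ⟨M.init, M.layer_init⟩
  | succ k ih =>
    intro hk
    obtain ⟨s, hs⟩ := ih (by omega)
    obtain ⟨a⟩ := ‹Nonempty A›
    have h1 := M.P_sum s a (by omega)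
    obtain ⟨s', -, hs'⟩ := Finset.exists_ne_zero_of_sum_ne_zero (h1 ▸ one_ne_zero :
      ∑ s', M.P s a s' ≠ 0)
    refine ⟨s', ?_⟩
    by_contra h
    exact hs' (M.P_layer s a s' (by omega))

lemma layerCard_pos [Nonempty A] (M : LoopFreeMDP S A L) {k : ℕ} (hk : k ≤ L) :
    0 < M.layerCard k := by
  obtain ⟨s, hs⟩ := M.exists_layer_eq k hk
  exact Finset.card_pos.2 ⟨s, by simp [hs]⟩

lemma layerCard_le (M : LoopFreeMDP S A L) (k : ℕ) : M.layerCard k ≤ Fintype.card S :=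
  Finset.card_filter_le _ _

lemma sum_layerCard (M : LoopFreeMDP S A L) :
    ∑ k ∈ Finset.range (L + 1), M.layerCard k = Fintype.card S := by
  rw [← Finset.card_univ, Finset.card_eq_sum_card_fiberwise (f := M.layer)
    (t := Finset.range (L + 1))]
  · rfl
  · intro s _
    simpa [Nat.lt_succ_iff] using M.layer_le s

lemma succ_length_le_card [Nonempty A] (M : LoopFreeMDP S A L) : L + 1 ≤ Fintype.card S := by
  rw [← M.sum_layerCard]
  calc L + 1 = ∑ k ∈ Finset.range (L + 1), 1 := by simp
    _ ≤ _ := Finset.sum_le_sum fun k hk =>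
      M.layerCard_pos (Nat.lt_succ_iff.1 (Finset.mem_range.1 hk))

/-- A sum over the nonterminal states, layer by layer. -/
lemma sum_eq_sum_layers (M : LoopFreeMDP S A L) (F : S → ℝ) (h : F M.term = 0) :
    ∑ s, F s = ∑ k ∈ Finset.range L, ∑ s with M.layer s = k, F s := by
  rw [← Finset.sum_fiberwise_of_maps_to (s := Finset.univ) (g := M.layer)
    (t := Finset.range (L + 1)) (by intro s _; simpa [Nat.lt_succ_iff] using M.layer_le s),
    Finset.sum_range_succ, add_eq_left]
  refine Finset.sum_eq_zero fun s hs => ?_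
  rw [(M.layer_eq_last_iff s).1 (Finset.mem_filter.1 hs).2, h]

variable {M : LoopFreeMDP S A L} {θ θ' : S × A × S → ℝ}

lemma IsFlow.eq_zero_of_term (h : M.IsFlow θ) (a : A) (s' : S) : θ (M.term, a, s') = 0 := by
  refine h.support _ _ _ ?_
  have := M.layer_le s'
  have := (M.layer_eq_last_iff M.term).2 rfl
  omega

lemma IsFlow.sum_eq (h : M.IsFlow θ) : ∑ e, θ e = L := by
  rw [sum_triple, M.sum_eq_sum_layers]
  · rw [Finset.sum_congr rfl fun k hk => h.mass k (Finset.mem_range.1 hk)]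
    simp
  · simp [h.eq_zero_of_term]

lemma IsFlow.l1Norm_eq (h : M.IsFlow θ) : l1Norm θ = L := by
  rw [← h.sum_eq]
  exact Finset.sum_congr rfl fun e _ => abs_of_nonneg (h.nonneg e)

lemma IsFlow.le_one (h : M.IsFlow θ) (e : S × A × S) : θ e ≤ 1 := by
  obtain ⟨s, a, s'⟩ := e
  by_cases hs : M.layer s < L
  · calc θ (s, a, s') ≤ ∑ r', θ (s, a, r') :=
          Finset.single_le_sum (fun r _ => h.nonneg (s, a, r)) (Finset.mem_univ s')
      _ ≤ ∑ b, ∑ r', θ (s, b, r') :=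
          Finset.single_le_sum (f := fun b => ∑ r', θ (s, b, r'))
            (fun b _ => Finset.sum_nonneg fun r _ => h.nonneg (s, b, r)) (Finset.mem_univ a)
      _ ≤ ∑ r with M.layer r = M.layer s, ∑ b, ∑ r', θ (r, b, r') :=
          Finset.single_le_sum (f := fun r => ∑ b, ∑ r', θ (r, b, r'))
            (fun r _ => Finset.sum_nonneg fun b _ => Finset.sum_nonneg fun r' _ =>
              h.nonneg (r, b, r')) (by simp)
      _ = 1 := h.mass _ hs
  · rw [M.layer_lt_iff, not_not] at hs
    rw [hs, h.eq_zero_of_term]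
    exact zero_le_one

lemma IsFlow.l1Norm_sub_le (h : M.IsFlow θ) (h' : M.IsFlow θ') : l1Norm (θ - θ') ≤ 2 * L := by
  calc l1Norm (θ - θ') ≤ l1Norm θ + l1Norm θ' := by
        simp only [l1Norm, ← Finset.sum_add_distrib]
        exact Finset.sum_le_sum fun e _ => abs_sub _ _
    _ = 2 * L := by rw [h.l1Norm_eq, h'.l1Norm_eq]; ring

lemma IsFlow.convexComb (h : M.IsFlow θ) (h' : M.IsFlow θ') {p q : ℝ} (hp : 0 ≤ p) (hq : 0 ≤ q)
    (hpq : p + q = 1) : M.IsFlow (fun e => p * θ e + q * θ' e) where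
  support s a s' hs := by simp [h.support s a s' hs, h'.support s a s' hs]
  nonneg e := add_nonneg (mul_nonneg hp (h.nonneg e)) (mul_nonneg hq (h'.nonneg e))
  mass k hk := by
    simp only [Finset.sum_add_distrib, ← Finset.mul_sum]
    rw [h.mass k hk, h'.mass k hk, mul_one, mul_one, hpq]
  flow s hs hs' := by
    simp only [Finset.sum_add_distrib, ← Finset.mul_sum]
    rw [h.flow s hs hs', h'.flow s hs hs']

lemma sum_layer_const (M : LoopFreeMDP S A L) (k : ℕ) (x : ℝ) :
    ∑ s : S, (if M.layer s = k then x else 0) = M.layerCard k * x := by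
  rw [← Finset.sum_filter, Finset.sum_const, nsmul_eq_mul]
  rfl

lemma uniform_out [Nonempty A] (M : LoopFreeMDP S A L) {s : S} (hs : M.layer s < L) :
    ∑ a, ∑ s', M.uniform (s, a, s') = 1 / M.layerCard (M.layer s) := by
  have h1 : (M.layerCard (M.layer s) : ℝ) ≠ 0 := by
    exact_mod_cast (M.layerCard_pos hs.le).ne'
  have h2 : (M.layerCard (M.layer s + 1) : ℝ) ≠ 0 := by
    exact_mod_cast (M.layerCard_pos hs).ne'
  have h3 : (Fintype.card A : ℝ) ≠ 0 := by exact_mod_cast Fintype.card_ne_zero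
  simp only [uniform, M.sum_layer_const, Finset.sum_const, nsmul_eq_mul, Finset.card_univ]
  field_simp

lemma isFlow_uniform [Nonempty A] (M : LoopFreeMDP S A L) : M.IsFlow M.uniform where
  support s a s' hs := by simp [uniform, hs]
  nonneg e := by
    unfold uniform
    split_ifs <;> positivity
  mass k hk := by
    rw [Finset.sum_congr rfl fun s hs => M.uniform_out (by
      rw [(Finset.mem_filter.1 hs).2]; exact hk)]
    have h1 : (M.layerCard k : ℝ) ≠ 0 := by exact_mod_cast (M.layerCard_pos hk.le).ne'
    rw [Finset.sum_congr rfl fun s hs => by rw [(Finset.mem_filter.1 hs).2], Finset.sum_const,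
      nsmul_eq_mul]
    exact mul_one_div_cancel h1
  flow s hs hs' := by
    rw [M.uniform_out hs']
    obtain ⟨k, hk⟩ : ∃ k, M.layer s = k + 1 := ⟨M.layer s - 1, by omega⟩
    have h1 : (M.layerCard k : ℝ) ≠ 0 := by exact_mod_cast (M.layerCard_pos (by omega)).ne'
    have h2 : (M.layerCard (k + 1) : ℝ) ≠ 0 := by
      exact_mod_cast (M.layerCard_pos (by omega)).ne'
    have h3 : (Fintype.card A : ℝ) ≠ 0 := by exact_mod_cast Fintype.card_ne_zero
    have : ∀ r : S, ∑ a : A, M.uniform (r, a, s) = if M.layer r = k then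
        Fintype.card A * (1 / ((M.layerCard k : ℝ) * M.layerCard (k + 1) * Fintype.card A))
        else 0 := by
      intro r
      by_cases hr : M.layer r = k
      · simp [uniform, hr, hk, nsmul_eq_mul]
      · rw [if_neg hr]
        refine Finset.sum_eq_zero fun a _ => ?_
        simp only [uniform]
        exact if_neg (by omega)
    rw [Finset.sum_congr rfl fun r _ => this r, M.sum_layer_const, hk]
    field_simp

lemma le_uniform [Nonempty A] (M : LoopFreeMDP S A L) {e : S × A × S}
    (he : M.layer e.2.2 = M.layer e.1 + 1) :
    1 / ((Fintype.card S : ℝ) ^ 2 * Fintype.card A) ≤ M.uniform e := by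
  have hL := M.layer_le e.2.2
  have h1 : 0 < M.layerCard (M.layer e.1) := M.layerCard_pos (by omega)
  have h2 : 0 < M.layerCard (M.layer e.1 + 1) := M.layerCard_pos (by omega)
  have h3 : 0 < Fintype.card A := Fintype.card_pos
  rw [uniform, if_pos he, sq]
  have h4 : (M.layerCard (M.layer e.1) : ℝ) ≤ Fintype.card S := by exact_mod_cast M.layerCard_le _
  have h5 : (M.layerCard (M.layer e.1 + 1) : ℝ) ≤ Fintype.card S := by
    exact_mod_cast M.layerCard_le _
  refine one_div_le_one_div_of_le (by positivity) ?_
  gcongr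

lemma uniform_pos [Nonempty A] (M : LoopFreeMDP S A L) {e : S × A × S}
    (he : M.layer e.2.2 = M.layer e.1 + 1) : 0 < M.uniform e := by
  have : Nonempty S := ⟨e.1⟩
  exact lt_of_lt_of_le (by positivity) (M.le_uniform he)

lemma IsFlow.mix [Nonempty A] (h : M.IsFlow θ) {lam : ℝ} (h0 : 0 ≤ lam) (h1 : lam ≤ 1) :
    M.IsFlow (M.mix lam θ) :=
  h.convexComb M.isFlow_uniform (by linarith) h0 (by ring)

/-- Mixing with the uniform measure moves a flow by at most `2 λ L`. -/
lemma IsFlow.l1Norm_mix_sub_le [Nonempty A] (h : M.IsFlow θ) {lam : ℝ} (h0 : 0 ≤ lam) :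
    l1Norm (M.mix lam θ - θ) ≤ lam * (2 * L) := by
  have : l1Norm (M.mix lam θ - θ) = lam * l1Norm (M.uniform - θ) := by
    simp only [l1Norm, Finset.mul_sum]
    refine Finset.sum_congr rfl fun e _ => ?_
    rw [← abs_of_nonneg h0, ← abs_mul, abs_of_nonneg h0]
    congr 1
    simp only [LoopFreeMDP.mix, Pi.sub_apply]
    ring
  rw [this]
  exact mul_le_mul_of_nonneg_left (M.isFlow_uniform.l1Norm_sub_le h) h0

/-- The optimistic sets are convex. -/
lemma optimisticSet_convexComb {T : ℕ} {ζ : ℝ} {K : Counters S A}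
    (h : θ ∈ M.optimisticSet T ζ K) (h' : θ' ∈ M.optimisticSet T ζ K) {p q : ℝ} (hp : 0 ≤ p)
    (hq : 0 ≤ q) (hpq : p + q = 1) : (fun e => p * θ e + q * θ' e) ∈ M.optimisticSet T ζ K := by
  refine ⟨h.1.convexComb h'.1 hp hq hpq, fun s a => ?_⟩
  have e1 := mul_le_mul_of_nonneg_left (h.2 s a) hp
  have e2 := mul_le_mul_of_nonneg_left (h'.2 s a) hq
  simp only [Finset.sum_add_distrib, ← Finset.mul_sum]
  calc _ ≤ ∑ s', (p * |θ (s, a, s') - K.empirical s a s' * ∑ s'', θ (s, a, s'')|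
        + q * |θ' (s, a, s') - K.empirical s a s' * ∑ s'', θ' (s, a, s'')|) := by
        refine Finset.sum_le_sum fun s' _ => ?_
        rw [← abs_of_nonneg hp, ← abs_of_nonneg hq, ← abs_mul, ← abs_mul, abs_of_nonneg hp,
          abs_of_nonneg hq]
        refine le_trans (le_of_eq ?_) (abs_add_le _ _)
        congr 1
        ring
    _ ≤ _ := by
        rw [Finset.sum_add_distrib, ← Finset.mul_sum, ← Finset.mul_sum]
        linarith

/-- If the transition probabilities are within the confidence radii, then the true occupancy
measures belong to the optimistic set. -/
lemma occupancySet_subset_optimisticSet {T : ℕ} {ζ : ℝ} {K : Counters S A}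
    (hK : ∀ s a, M.layer s < L → ∑ s', |M.P s a s' - K.empirical s a s'| ≤ M.radius T ζ K s a) :
    M.occupancySet ⊆ M.optimisticSet T ζ K := by
  intro θ h
  refine ⟨h.1, fun s a => ?_⟩
  have h0 : 0 ≤ ∑ s'', θ (s, a, s'') := Finset.sum_nonneg fun r _ => h.1.nonneg _
  by_cases hs : M.layer s < L
  · refine le_trans (le_of_eq ?_) (mul_le_mul_of_nonneg_right (hK s a hs) h0)
    rw [Finset.sum_mul]
    refine Finset.sum_congr rfl fun s' _ => ?_
    rw [h.2 s a s', ← sub_mul, abs_mul, abs_of_nonneg h0]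
  · rw [M.layer_lt_iff, not_not] at hs
    subst hs
    simp [h.1.eq_zero_of_term]

end LoopFreeMDP

end

/-! ### Kullback-Leibler divergence and the mirror descent step -/

section

/-- The contribution `x log (x / r) - x + r` of one coordinate to the divergence. -/
def klTerm (x r : ℝ) : ℝ := x * Real.log (x / r) - x + r

/-- The Kullback-Leibler divergence dominates the squared Hellinger distance. -/
lemma sq_sqrt_sub_sqrt_le_klTerm {x r : ℝ} (hx : 0 ≤ x) (hr : 0 < r) :
    (√x - √r) ^ 2 ≤ klTerm x r := by
  rcases hx.eq_or_lt with rfl | hx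
  · simp [klTerm, Real.sq_sqrt hr.le]
  have h1 : Real.log (x / r) = -(2 * Real.log (√r / √x)) := by
    rw [Real.log_div (Real.sqrt_pos.2 hr).ne' (Real.sqrt_pos.2 hx).ne', Real.log_div hx.ne' hr.ne',
      Real.log_sqrt hr.le, Real.log_sqrt hx.le]
    ring
  have h2 := Real.log_le_sub_one_of_pos (show 0 < √r / √x by positivity)
  have h3 : x * (√r / √x) = √x * √r := by
    have : √x ≠ 0 := by positivity
    field_simp
    rw [Real.sq_sqrt hx.le]
  rw [klTerm, h1, sub_sq, Real.sq_sqrt hx.le, Real.sq_sqrt hr.le]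
  nlinarith [mul_le_mul_of_nonneg_left h2 hx.le]

lemma klTerm_nonneg {x r : ℝ} (hx : 0 ≤ x) (hr : 0 ≤ r) (h : r = 0 → x = 0) : 0 ≤ klTerm x r := by
  rcases hr.eq_or_lt with rfl | hr
  · simp [klTerm, h rfl]
  · exact (sq_nonneg _).trans (sq_sqrt_sub_sqrt_le_klTerm hx hr)

/-- The compensation identity: the convexity defect of `klTerm · r` at a convex combination. -/
lemma klTerm_convexComb {y z r p q : ℝ} (hy : 0 ≤ y) (hz : 0 ≤ z) (hr : 0 < r) (hp : 0 < p)
    (hq : 0 < q) (hpq : p + q = 1) :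
    p * klTerm y r + q * klTerm z r = klTerm (p * y + q * z) r
      + p * klTerm y (p * y + q * z) + q * klTerm z (p * y + q * z) := by
  have key : ∀ v w : ℝ, 0 ≤ v → 0 < w → v * Real.log (v / r)
      = v * Real.log (v / w) + v * Real.log (w / r) := by
    intro v w hv hw
    rcases hv.eq_or_lt with rfl | hv
    · simp
    rw [Real.log_div hv.ne' hr.ne', Real.log_div hv.ne' hw.ne', Real.log_div hw.ne' hr.ne']
    ring
  obtain rfl : q = 1 - p := by linarith
  rcases (add_nonneg (mul_nonneg hp.le hy) (mul_nonneg hq.le hz)).eq_or_lt with h0 | h0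
  · have e1 : y = 0 := by nlinarith [mul_nonneg hp.le hy, mul_nonneg hq.le hz]
    have e2 : z = 0 := by nlinarith [mul_nonneg hp.le hy, mul_nonneg hq.le hz]
    subst e1 e2
    simp [klTerm]
    ring
  · have e1 := key y _ hy h0
    have e2 := key z _ hz h0
    simp only [klTerm]
    rw [e1, e2]
    ring

variable {S A : Type*} [Fintype S] [Fintype A] {L : ℕ}

lemma divergence_eq_sum (θ θ' : S × A × S → ℝ) :
    divergence θ θ' = ∑ e, klTerm (θ e) (θ' e) := rfl

namespace LoopFreeMDP

variable {M : LoopFreeMDP S A L} {θ θ' y z r : S × A × S → ℝ}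

lemma mix_pos [Nonempty A] (hθ : M.IsFlow θ) {lam : ℝ} (h0 : 0 < lam) (h1 : lam ≤ 1)
    {e : S × A × S} (he : M.layer e.2.2 = M.layer e.1 + 1) : 0 < M.mix lam θ e :=
  add_pos_of_nonneg_of_pos (mul_nonneg (by linarith) (hθ.nonneg e))
    (mul_pos h0 (M.uniform_pos he))

/-- A weak form of Pinsker's inequality for flows. -/
lemma l1Norm_sub_sq_le_divergence (hy : M.IsFlow y) (hr : M.IsFlow r)
    (hpos : ∀ e : S × A × S, M.layer e.2.2 = M.layer e.1 + 1 → 0 < r e) :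
    l1Norm (y - r) ^ 2 ≤ 4 * L * divergence y r := by
  have h1 : l1Norm (y - r) = ∑ e, |√(y e) - √(r e)| * (√(y e) + √(r e)) := by
    refine Finset.sum_congr rfl fun e _ => ?_
    rw [← abs_of_nonneg (show 0 ≤ √(y e) + √(r e) by positivity), ← abs_mul,
      Pi.sub_apply]
    congr 1
    nlinarith [Real.sq_sqrt (hy.nonneg e), Real.sq_sqrt (hr.nonneg e)]
  have h2 : ∑ e, |√(y e) - √(r e)| ^ 2 ≤ divergence y r := by
    refine Finset.sum_le_sum fun e _ => ?_
    rw [sq_abs]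
    by_cases he : M.layer e.2.2 = M.layer e.1 + 1
    · exact sq_sqrt_sub_sqrt_le_klTerm (hy.nonneg e) (hpos e he)
    · obtain ⟨s, a, s'⟩ := e
      simp [hy.support s a s' he, hr.support s a s' he]
  have h3 : ∑ e, (√(y e) + √(r e)) ^ 2 ≤ 4 * L := by
    calc ∑ e, (√(y e) + √(r e)) ^ 2 ≤ ∑ e, (2 * y e + 2 * r e) := by
          refine Finset.sum_le_sum fun e _ => ?_
          nlinarith [Real.sq_sqrt (hy.nonneg e), Real.sq_sqrt (hr.nonneg e),
            sq_nonneg (√(y e) - √(r e))]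
      _ = 4 * L := by
          rw [Finset.sum_add_distrib, ← Finset.mul_sum, ← Finset.mul_sum, hy.sum_eq, hr.sum_eq]
          ring
  rw [h1]
  refine (Finset.sum_mul_sq_le_sq_mul_sq _ _ _).trans ?_
  rw [mul_comm]
  exact mul_le_mul h3 h2 (Finset.sum_nonneg fun _ _ => sq_nonneg _) (by positivity)

lemma divergence_nonneg (hy : M.IsFlow y) (hr : M.IsFlow r)
    (hpos : ∀ e : S × A × S, M.layer e.2.2 = M.layer e.1 + 1 → 0 < r e) :
    0 ≤ divergence y r := by
  refine Finset.sum_nonneg fun e _ => klTerm_nonneg (hy.nonneg e) (hr.nonneg e) fun h0 => ?_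
  obtain ⟨s, a, s'⟩ := e
  refine hy.support s a s' fun he => ?_
  exact (hpos (s, a, s') he).ne' h0

/-- The divergence of flows only involves the logarithms of the ratios. -/
lemma divergence_eq_sum_log (hy : M.IsFlow y) (hr : M.IsFlow r) :
    divergence y r = ∑ e, y e * Real.log (y e / r e) := by
  simp only [divergence, Finset.sum_add_distrib, Finset.sum_sub_distrib, hy.sum_eq, hr.sum_eq]
  ring

/-- The mirror descent step: a minimizer `y` of a linear function plus a divergence over a convex
set of flows satisfies the three-point inequality, with `y` replaced by its mixture in the last
divergence. The minimizer may have zeros, so that no derivative is taken there: `y` is compared with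
a convex combination of `y` and `z` that is dominated by a multiple of the mixture. -/
lemma mirror_step [Nonempty A] {K : Set (S × A × S → ℝ)} (hK : ∀ θ ∈ K, M.IsFlow θ)
    (hconv : ∀ θ ∈ K, ∀ θ' ∈ K, ∀ p q : ℝ, 0 ≤ p → 0 ≤ q → p + q = 1 →
      (fun e => p * θ e + q * θ' e) ∈ K)
    {h : S × A × S → ℝ} {α lam : ℝ} (hα : 0 ≤ α) (h0 : 0 < lam) (h1 : lam < 1)
    (hr : M.IsFlow r) (hpos : ∀ e : S × A × S, M.layer e.2.2 = M.layer e.1 + 1 → 0 < r e)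
    (hy : y ∈ K) (hmin : ∀ θ ∈ K, pairing h y + α * divergence y r ≤
      pairing h θ + α * divergence θ r) (hz : z ∈ K) :
    pairing h y + α * divergence y r + α * divergence z (M.mix lam y)
      ≤ pairing h z + α * divergence z r - α * (L * Real.log (1 - lam)) := by
  rcases isEmpty_or_nonempty S with hS | hS
  · have hL : (L : ℝ) = 0 := by rw [← hr.sum_eq, Finset.sum_of_isEmpty]
    simp [pairing, divergence, hL]
  have hyF := hK y hy
  have hzF := hK z hz
  set N : ℝ := (Fintype.card S : ℝ) ^ 2 * Fintype.card A with hN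
  have hNone : 1 ≤ N := by
    have : 1 ≤ Fintype.card S ^ 2 * Fintype.card A :=
      Nat.one_le_iff_ne_zero.2 (by simp [Fintype.card_ne_zero])
    rw [hN]
    exact_mod_cast this
  have hNpos : 0 < N := by linarith
  set q : ℝ := lam / N with hq
  have hq0 : 0 < q := by positivity
  have hq1 : q < 1 := (div_le_self h0.le hNone).trans_lt h1
  set w : S × A × S → ℝ := fun e => (1 - q) * y e + q * z e with hw
  have hwK : w ∈ K := hconv y hy z hz (1 - q) q (by linarith) hq0.le (by ring)
  have hwF := hK w hwK
  -- the compensation identity, summed over the coordinates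
  have hcomp : (1 - q) * divergence y r + q * divergence z r
      = divergence w r + (1 - q) * divergence y w + q * divergence z w := by
    simp only [divergence_eq_sum, Finset.mul_sum, ← Finset.sum_add_distrib]
    refine Finset.sum_congr rfl fun e _ => ?_
    by_cases he : M.layer e.2.2 = M.layer e.1 + 1
    · exact klTerm_convexComb (hyF.nonneg e) (hzF.nonneg e) (hpos e he) (by linarith) hq0 (by ring)
    · obtain ⟨s, a, s'⟩ := e
      simp [hw, klTerm, hyF.support s a s' he, hzF.support s a s' he, hr.support s a s' he]
  have hlin : pairing h w = (1 - q) * pairing h y + q * pairing h z := by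
    simp only [pairing, hw, Finset.mul_sum, ← Finset.sum_add_distrib]
    exact Finset.sum_congr rfl fun e _ => by ring
  have hyw : 0 ≤ divergence y w := by
    refine Finset.sum_nonneg fun e _ => klTerm_nonneg (hyF.nonneg e) (hwF.nonneg e) fun hwe => ?_
    have e1 := mul_nonneg (sub_nonneg.2 hq1.le) (hyF.nonneg e)
    have e2 := mul_nonneg hq0.le (hzF.nonneg e)
    have e3 : (1 - q) * y e = 0 := by simp only [hw] at hwe; linarith
    exact (mul_eq_zero.1 e3).resolve_left (by linarith)
  have hmain : pairing h y + α * divergence y r + α * divergence z w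
      ≤ pairing h z + α * divergence z r := by
    have e1 := hmin w hwK
    have e2 : divergence w r = (1 - q) * divergence y r + q * divergence z r
      - (1 - q) * divergence y w - q * divergence z w := by linarith
    rw [hlin, e2] at e1
    have e3 : 0 ≤ α * ((1 - q) * divergence y w) :=
      mul_nonneg hα (mul_nonneg (by linarith) hyw)
    have e4 : q * (pairing h y + α * divergence y r + α * divergence z w)
        ≤ q * (pairing h z + α * divergence z r) := by nlinarith
    exact le_of_mul_le_mul_left e4 hq0
  have hmix : divergence z (M.mix lam y) ≤ divergence z w - L * Real.log (1 - lam) := by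
    rw [divergence_eq_sum_log hzF (hyF.mix h0.le h1.le), divergence_eq_sum_log hzF hwF,
      ← hzF.sum_eq, Finset.sum_mul, ← Finset.sum_sub_distrib]
    refine Finset.sum_le_sum fun e _ => ?_
    rcases (hzF.nonneg e).eq_or_lt with hz0 | hz0
    · simp [← hz0]
    have he : M.layer e.2.2 = M.layer e.1 + 1 := by
      by_contra he
      obtain ⟨s, a, s'⟩ := e
      exact hz0.ne' (hzF.support s a s' he)
    have hwpos : 0 < w e := add_pos_of_nonneg_of_pos
      (mul_nonneg (by linarith) (hyF.nonneg e)) (mul_pos hq0 hz0)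
    have hmpos : 0 < M.mix lam y e := mix_pos hyF h0 h1.le he
    have hdom : (1 - lam) * w e ≤ M.mix lam y e := by
      have e1 : q * z e ≤ lam * M.uniform e := by
        calc q * z e ≤ q * 1 := mul_le_mul_of_nonneg_left (hzF.le_one e) hq0.le
          _ = lam * (1 / N) := by rw [hq]; ring
          _ ≤ lam * M.uniform e := mul_le_mul_of_nonneg_left (M.le_uniform he) h0.le
      have e2 := hyF.nonneg e
      have e3 : 0 ≤ lam * (q * z e) := by positivity
      have e4 : 0 ≤ (1 - lam) * (q * y e) :=
        mul_nonneg (by linarith) (mul_nonneg hq0.le e2)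
      simp only [hw, LoopFreeMDP.mix]
      nlinarith
    have e5 := Real.log_le_log (mul_pos (by linarith) hwpos) hdom
    rw [Real.log_mul (by linarith) hwpos.ne'] at e5
    rw [Real.log_div hz0.ne' hmpos.ne', Real.log_div hz0.ne' hwpos.ne', ← mul_sub]
    exact mul_le_mul_of_nonneg_left (by linarith) hz0.le
  nlinarith [mul_le_mul_of_nonneg_left hmix hα]

/-- Thanks to the uniform part, the divergence from a mixture is at most logarithmic. -/
lemma divergence_mix_le [Nonempty A] (hz : M.IsFlow z) (hθ : M.IsFlow θ) {lam : ℝ} (h0 : 0 < lam)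
    (h1 : lam ≤ 1) : divergence z (M.mix lam θ)
      ≤ L * Real.log ((Fintype.card S : ℝ) ^ 2 * Fintype.card A / lam) := by
  rw [divergence_eq_sum_log hz (hθ.mix h0.le h1), ← hz.sum_eq, Finset.sum_mul]
  refine Finset.sum_le_sum fun e _ => ?_
  rcases (hz.nonneg e).eq_or_lt with hz0 | hz0
  · simp [← hz0]
  have he : M.layer e.2.2 = M.layer e.1 + 1 := by
    by_contra he
    obtain ⟨s, a, s'⟩ := e
    exact hz0.ne' (hz.support s a s' he)
  have : Nonempty S := ⟨e.1⟩
  set N : ℝ := (Fintype.card S : ℝ) ^ 2 * Fintype.card A with hN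
  have hNpos : 0 < N := by positivity
  have hge : lam / N ≤ M.mix lam θ e := by
    have e1 := mul_le_mul_of_nonneg_left (M.le_uniform he) h0.le
    have e2 : 0 ≤ (1 - lam) * θ e := mul_nonneg (by linarith) (hθ.nonneg e)
    simp only [LoopFreeMDP.mix]
    rw [← hN] at e1
    calc lam / N = lam * (1 / N) := by ring
      _ ≤ _ := by linarith
  refine mul_le_mul_of_nonneg_left (Real.log_le_log (div_pos hz0 (mix_pos hθ h0 h1 he)) ?_) hz0.le
  rw [div_le_div_iff₀ (mix_pos hθ h0 h1 he) h0]
  have e3 := hz.le_one e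
  have e4 : N * (lam / N) = lam := by field_simp
  nlinarith [mul_le_mul_of_nonneg_left hge hNpos.le]

/-- A flow is close to its own mixture. -/
lemma divergence_mix_self_le [Nonempty A] (hθ : M.IsFlow θ) {lam : ℝ} (h0 : 0 < lam)
    (h1 : lam < 1) : divergence θ (M.mix lam θ) ≤ -(L * Real.log (1 - lam)) := by
  rw [divergence_eq_sum_log hθ (hθ.mix h0.le h1.le), ← hθ.sum_eq, Finset.sum_mul,
    ← Finset.sum_neg_distrib]
  refine Finset.sum_le_sum fun e _ => ?_
  rcases (hθ.nonneg e).eq_or_lt with hz0 | hz0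
  · simp [← hz0]
  have hdom : (1 - lam) * θ e ≤ M.mix lam θ e :=
    le_add_of_nonneg_right (mul_nonneg h0.le (M.isFlow_uniform.nonneg e))
  have hp : 0 < (1 - lam) * θ e := mul_pos (by linarith) hz0
  have e5 := Real.log_le_log hp hdom
  rw [Real.log_mul (by linarith) hz0.ne'] at e5
  rw [Real.log_div hz0.ne' (hp.trans_le hdom).ne', ← mul_neg]
  exact mul_le_mul_of_nonneg_left (by linarith) hz0.le

end LoopFreeMDP

end

/-! ### Counters and epochs -/

section

variable {S A : Type*} [DecidableEq S] [DecidableEq A] {L : ℕ}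

/-- The number of visits to `(s, a)` in the episodes `1, …, t - 1`. -/
def totalVisits (x : ℕ → Path S A L) (t : ℕ) (s : S) (a : A) : ℕ :=
  ∑ j ∈ Finset.Ico 1 t, visits (x j) s a

/-- The number of moves from `s` to `s'` under `a` in the episodes `1, …, t - 1`. -/
def totalMoves (x : ℕ → Path S A L) (t : ℕ) (s : S) (a : A) (s' : S) : ℕ :=
  ∑ j ∈ Finset.Ico 1 t, moves (x j) s a s'

lemma totalVisits_succ (x : ℕ → Path S A L) {t : ℕ} (ht : 1 ≤ t) (s : S) (a : A) :
    totalVisits x (t + 1) s a = totalVisits x t s a + visits (x t) s a :=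
  Finset.sum_Ico_succ_top ht _

lemma totalMoves_succ (x : ℕ → Path S A L) {t : ℕ} (ht : 1 ≤ t) (s : S) (a : A) (s' : S) :
    totalMoves x (t + 1) s a s' = totalMoves x t s a s' + moves (x t) s a s' :=
  Finset.sum_Ico_succ_top ht _

namespace Counters

variable [Fintype S] [Fintype A]

lemma atEpisode_succ (x : ℕ → Path S A L) {t : ℕ} (ht : 1 ≤ t) :
    atEpisode x (t + 1) = (atEpisode x t).step (x t) := by
  obtain ⟨t, rfl⟩ : ∃ k, t = k + 1 := ⟨t - 1, by omega⟩
  rfl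

lemma step_N_add_n (K : Counters S A) (p : Path S A L) (s : S) (a : A) :
    (K.step p).N s a + (K.step p).n s a = K.N s a + K.n s a + visits p s a := by
  unfold step
  split_ifs <;> simp [newEpoch, record, add_assoc]

lemma step_M_add_m (K : Counters S A) (p : Path S A L) (s : S) (a : A) (s' : S) :
    (K.step p).M s a s' + (K.step p).m s a s' = K.M s a s' + K.m s a s' + moves p s a s' := by
  unfold step
  split_ifs <;> simp [newEpoch, record, add_assoc]

lemma N_add_n_eq (x : ℕ → Path S A L) {t : ℕ} (ht : 1 ≤ t) (s : S) (a : A) :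
    (atEpisode x t).N s a + (atEpisode x t).n s a = totalVisits x t s a := by
  induction t, ht using Nat.le_induction with
  | base => simp [atEpisode, initial, totalVisits]
  | succ t ht ih => rw [atEpisode_succ x ht, step_N_add_n, ih, totalVisits_succ x ht]

lemma M_add_m_eq (x : ℕ → Path S A L) {t : ℕ} (ht : 1 ≤ t) (s : S) (a : A) (s' : S) :
    (atEpisode x t).M s a s' + (atEpisode x t).m s a s' = totalMoves x t s a s' := by
  induction t, ht using Nat.le_induction with
  | base => simp [atEpisode, initial, totalMoves]
  | succ t ht ih => rw [atEpisode_succ x ht, step_M_add_m, ih, totalMoves_succ x ht]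

/-- The global counters of an epoch are the total counts at the beginning of some episode. -/
lemma exists_eq_total (x : ℕ → Path S A L) {t : ℕ} (ht : 1 ≤ t) :
    ∃ t', 1 ≤ t' ∧ t' ≤ t ∧ (atEpisode x t).N = totalVisits x t' ∧
      (atEpisode x t).M = totalMoves x t' := by
  induction t, ht using Nat.le_induction with
  | base =>
    refine ⟨1, le_rfl, le_rfl, ?_, ?_⟩
    · ext; simp [atEpisode, initial, totalVisits]
    · ext; simp [atEpisode, initial, totalMoves]
  | succ t ht ih =>
    obtain ⟨t', h1, h2, h3, h4⟩ := ih
    by_cases h : ∃ s a, max 1 ((atEpisode x t).N s a) ≤ ((atEpisode x t).record (x t)).n s a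
    · refine ⟨t + 1, by omega, le_rfl, ?_, ?_⟩
      · ext s a
        rw [← N_add_n_eq x (by omega), atEpisode_succ x ht, step, if_pos h]
        rfl
      · ext s a s'
        rw [← M_add_m_eq x (by omega), atEpisode_succ x ht, step, if_pos h]
        rfl
    · refine ⟨t', h1, by omega, ?_, ?_⟩
      · rw [← h3, atEpisode_succ x ht, step, if_neg h]
        rfl
      · rw [← h4, atEpisode_succ x ht, step, if_neg h]
        rfl

/-- At the beginning of an episode the visits within the epoch have not reached the threshold. -/
lemma n_lt (x : ℕ → Path S A L) {t : ℕ} (ht : 1 ≤ t) (s : S) (a : A) :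
    (atEpisode x t).n s a < max 1 ((atEpisode x t).N s a) := by
  induction t, ht using Nat.le_induction with
  | base => simp [atEpisode, initial]
  | succ t ht ih =>
    rw [atEpisode_succ x ht]
    unfold step
    split_ifs with h
    · exact lt_of_lt_of_le one_pos (le_max_left _ _)
    · push Not at h
      exact h s a

/-- Within an epoch the visits at most double. -/
lemma totalVisits_add_one_le (x : ℕ → Path S A L) {t : ℕ} (ht : 1 ≤ t) (s : S) (a : A) :
    totalVisits x t s a + 1 ≤ 2 * max 1 ((atEpisode x t).N s a) := by
  have h1 := N_add_n_eq x ht s a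
  have h2 := n_lt x ht s a
  have h3 := le_max_right 1 ((atEpisode x t).N s a)
  omega

/-- The sum of the widths `1 / √N` along the visits to a pair, where `N` is only updated at the
beginning of an epoch. -/
lemma sum_visits_div_sqrt_le (x : ℕ → Path S A L) (s : S) (a : A) (T : ℕ)
    (hx : ∀ t, 1 ≤ t → t ≤ T → visits (x t) s a ≤ 1) :
    ∑ t ∈ Finset.Icc 1 T, (visits (x t) s a : ℝ) * (1 / √((max 1 ((atEpisode x t).N s a) : ℕ) : ℝ))
      ≤ 2 * √2 * √(totalVisits x (T + 1) s a) := by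
  induction T with
  | zero => simp [totalVisits]
  | succ T ih =>
    rw [Finset.sum_Icc_succ_top (by omega), totalVisits_succ x (by omega)]
    have h1 := ih fun t ht ht' => hx t ht (by omega)
    have h2 := hx (T + 1) (by omega) le_rfl
    set c := totalVisits x (T + 1) s a with hc
    have h3 : c + 1 ≤ 2 * max 1 ((atEpisode x (T + 1)).N s a) :=
      totalVisits_add_one_le x (by omega) s a
    set N := max 1 ((atEpisode x (T + 1)).N s a) with hN
    have hNpos : (0 : ℝ) < N := by
      have : 0 < N := lt_of_lt_of_le one_pos (le_max_left _ _)
      exact_mod_cast this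
    obtain h0 | h0 : visits (x (T + 1)) s a = 0 ∨ visits (x (T + 1)) s a = 1 := by omega
    · simpa [h0] using h1
    · rw [h0]
      have h4 : (c : ℝ) + 1 ≤ 2 * N := by exact_mod_cast h3
      have h5 : √((c : ℝ) + 1) ≤ √2 * √N := by
        rw [← Real.sqrt_mul (by norm_num)]
        exact Real.sqrt_le_sqrt h4
      have hN' : 0 < √(N : ℝ) := Real.sqrt_pos.2 hNpos
      have h6 : √((c : ℝ) + 1) * (√((c : ℝ) + 1) - √c) * 2 ≥ 1 := by
        have e1 := Real.sq_sqrt (show (0 : ℝ) ≤ c by positivity)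
        have e2 := Real.sq_sqrt (show (0 : ℝ) ≤ (c : ℝ) + 1 by positivity)
        nlinarith [sq_nonneg (√((c : ℝ) + 1) - √c)]
      have h7 : √(c : ℝ) ≤ √((c : ℝ) + 1) := Real.sqrt_le_sqrt (by linarith)
      have h8 : (1 : ℝ) / √N ≤ 2 * √2 * (√((c : ℝ) + 1) - √c) := by
        rw [div_le_iff₀ hN']
        have := mul_le_mul_of_nonneg_right h5 (sub_nonneg.2 h7)
        nlinarith
      rw [Nat.cast_add, Nat.cast_one]
      linarith

/-- The potential that counts the epochs. -/
def potential (K : Counters S A) : ℕ := ∑ s, ∑ a, Nat.size (K.N s a)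

lemma succ_size_le {N N' : ℕ} (h : N + max 1 N ≤ N') : Nat.size N + 1 ≤ Nat.size N' := by
  rw [Nat.succ_le_iff, Nat.lt_size]
  rcases Nat.eq_zero_or_pos N with rfl | hN
  · simp at h ⊢
    omega
  · have h1 : 0 < Nat.size N := Nat.size_pos.2 hN
    have h2 : 2 ^ (Nat.size N - 1) ≤ N := Nat.lt_size.1 (by omega)
    have h3 : 2 ^ Nat.size N = 2 * 2 ^ (Nat.size N - 1) := by
      rw [← pow_succ']
      congr 1
      omega
    have := le_max_right 1 N
    omega

/-- Either the epoch continues, or the potential goes up. -/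
lemma same_or_potential (x : ℕ → Path S A L) {t : ℕ} (ht : 1 ≤ t) :
    ((atEpisode x (t + 1)).N = (atEpisode x t).N ∧ (atEpisode x (t + 1)).M = (atEpisode x t).M) ∨
      potential (atEpisode x t) + 1 ≤ potential (atEpisode x (t + 1)) := by
  rw [atEpisode_succ x ht]
  set K := atEpisode x t
  by_cases h : ∃ s a, max 1 (K.N s a) ≤ (K.record (x t)).n s a
  · right
    rw [step, if_pos h, Nat.succ_le_iff]
    obtain ⟨s, a, hsa⟩ := h
    have hmono : ∀ s a, Nat.size (K.N s a) ≤ Nat.size ((K.record (x t)).newEpoch.N s a) :=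
      fun s a => Nat.size_le_size (Nat.le_add_right _ _)
    refine Finset.sum_lt_sum (fun s _ => Finset.sum_le_sum fun a _ => hmono s a)
      ⟨s, Finset.mem_univ s, Finset.sum_lt_sum (fun a _ => hmono s a) ⟨a, Finset.mem_univ a, ?_⟩⟩
    exact succ_size_le (Nat.add_le_add_left hsa _)
  · left
    rw [step, if_neg h]
    exact ⟨rfl, rfl⟩

/-- A sum over the episodes whose terms are at most `b` unless a new epoch starts: there are at most
`|S| |A| size(T)` new epochs. -/
lemma sum_le_of_same_epoch (x : ℕ → Path S A L) (T : ℕ)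
    (hx : ∀ t s a, 1 ≤ t → t ≤ T → visits (x t) s a ≤ 1) (d : ℕ → ℝ) {b D : ℝ}
    (hb : 0 ≤ b) (hD : 0 ≤ D) (hdD : ∀ t, 1 ≤ t → t ≤ T → d t ≤ D)
    (hdb : ∀ t, 1 ≤ t → t ≤ T → (atEpisode x (t + 1)).N = (atEpisode x t).N →
      (atEpisode x (t + 1)).M = (atEpisode x t).M → d t ≤ b) :
    ∑ t ∈ Finset.Icc 1 T, d t
      ≤ T * b + (Fintype.card S * Fintype.card A * Nat.size T : ℕ) * D := by
  have h1 : ∀ n ≤ T, ∑ t ∈ Finset.Icc 1 n, d t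
      ≤ n * b + (potential (atEpisode x (n + 1)) : ℕ) * D := by
    intro n
    induction n with
    | zero =>
      intro _
      simp only [zero_add]
      simp
      positivity
    | succ n ih =>
      intro hn
      rw [Finset.sum_Icc_succ_top (by omega)]
      have ih := ih (by omega)
      rcases same_or_potential x (t := n + 1) (by omega) with h | h
      · have e1 := hdb (n + 1) (by omega) hn h.1 h.2
        have e2 : potential (atEpisode x (n + 1 + 1)) = potential (atEpisode x (n + 1)) := by
          simp only [potential, h.1]
        rw [e2]
        push_cast
        linarith
      · have e1 := hdD (n + 1) (by omega) hn
        have e2 : ((potential (atEpisode x (n + 1)) : ℝ) + 1) * D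
            ≤ (potential (atEpisode x (n + 1 + 1))) * D :=
          mul_le_mul_of_nonneg_right (by exact_mod_cast h) hD
        push_cast
        nlinarith
  refine (h1 T le_rfl).trans ?_
  have h2 : potential (atEpisode x (T + 1)) ≤ Fintype.card S * Fintype.card A * Nat.size T := by
    have h3 : ∀ s a, Nat.size ((atEpisode x (T + 1)).N s a) ≤ Nat.size T := by
      intro s a
      refine Nat.size_le_size ?_
      have e1 := N_add_n_eq x (t := T + 1) (by omega) s a
      have e2 : totalVisits x (T + 1) s a ≤ T := by
        calc totalVisits x (T + 1) s a ≤ ∑ j ∈ Finset.Ico 1 (T + 1), 1 :=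
              Finset.sum_le_sum fun j hj => by
                rw [Finset.mem_Ico] at hj
                exact hx j s a hj.1 (by omega)
          _ = T := by simp
      omega
    calc potential (atEpisode x (T + 1)) ≤ ∑ _s : S, ∑ _a : A, Nat.size T :=
          Finset.sum_le_sum fun s _ => Finset.sum_le_sum fun a _ => h3 s a
      _ = _ := by simp [mul_assoc]
  have h4 : (potential (atEpisode x (T + 1)) : ℝ)
      ≤ ((Fintype.card S * Fintype.card A * Nat.size T : ℕ) : ℝ) := by exact_mod_cast h2
  have := mul_le_mul_of_nonneg_right h4 hD
  linarith

/-- The counters at the beginning of an episode only depend on the previous paths. -/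
lemma atEpisode_congr {x y : ℕ → Path S A L} {t : ℕ} (h : ∀ j, 1 ≤ j → j < t → x j = y j) :
    atEpisode x t = atEpisode y t := by
  rcases Nat.eq_zero_or_pos t with rfl | ht
  · rfl
  induction t, ht using Nat.le_induction with
  | base => rfl
  | succ t ht ih =>
    have ht' : 1 ≤ t := ht
    rw [atEpisode_succ x ht', atEpisode_succ y ht', ih fun j hj hj' => h j hj (by omega),
      h t ht' (by omega)]

end Counters

namespace LoopFreeMDP

variable [Fintype S] [Fintype A]

lemma optimisticSet_congr (M : LoopFreeMDP S A L) (T : ℕ) (ζ : ℝ) {K K' : Counters S A}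
    (hN : K.N = K'.N) (hM : K.M = K'.M) : M.optimisticSet T ζ K = M.optimisticSet T ζ K' := by
  simp only [optimisticSet, radius, Counters.empirical, hN, hM]

end LoopFreeMDP

end

/-! ### Occupancy measures of policies -/

section

variable {S A : Type*} [Fintype S] [Fintype A] {L : ℕ}

lemma policyOf_nonneg {θ : S × A × S → ℝ} (h : ∀ e, 0 ≤ θ e) (s : S) (a : A) :
    0 ≤ policyOf θ s a :=
  div_nonneg (Finset.sum_nonneg fun _ _ => h _)
    (Finset.sum_nonneg fun _ _ => Finset.sum_nonneg fun _ _ => h _)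

/-- A retrieved policy is substochastic; a state without mass gets the zero row. -/
lemma sum_policyOf_le_one (θ : S × A × S → ℝ) (s : S) : ∑ a, policyOf θ s a ≤ 1 := by
  simp only [policyOf, ← Finset.sum_div]
  exact div_self_le_one _

namespace LoopFreeMDP

variable [DecidableEq S] {M : LoopFreeMDP S A L} {π : S → A → ℝ}

lemma stateDist_nonneg (hπ : ∀ s a, 0 ≤ π s a) (k : ℕ) (s : S) : 0 ≤ M.stateDist π k s := by
  induction k generalizing s with
  | zero => simp only [stateDist]; split_ifs <;> norm_num
  | succ k ih =>
    exact Finset.sum_nonneg fun r _ => Finset.sum_nonneg fun a _ =>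
      mul_nonneg (mul_nonneg (ih r) (hπ r a)) (M.P_nonneg r a s)

lemma sum_P_le_one (M : LoopFreeMDP S A L) (s : S) (a : A) : ∑ s', M.P s a s' ≤ 1 := by
  by_cases hs : M.layer s < L
  · exact (M.P_sum s a hs).le
  · refine (Finset.sum_nonpos fun s' _ => (M.P_layer s a s' ?_).le).trans zero_le_one
    have := M.layer_le s'
    omega

lemma sum_P_mul_le (M : LoopFreeMDP S A L) {w : ℝ} (hw : 0 ≤ w) (hπ : ∀ s a, 0 ≤ π s a)
    (hπ1 : ∀ s, ∑ a, π s a ≤ 1) (s : S) : ∑ a, ∑ s', w * π s a * M.P s a s' ≤ w := by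
  calc ∑ a, ∑ s', w * π s a * M.P s a s' ≤ ∑ a, w * π s a := by
        refine Finset.sum_le_sum fun a _ => ?_
        rw [← Finset.mul_sum]
        exact mul_le_of_le_one_right (mul_nonneg hw (hπ s a)) (M.sum_P_le_one s a)
    _ = w * ∑ a, π s a := by rw [Finset.mul_sum]
    _ ≤ w := mul_le_of_le_one_right hw (hπ1 s)

lemma sum_stateDist_le_one (hπ : ∀ s a, 0 ≤ π s a) (hπ1 : ∀ s, ∑ a, π s a ≤ 1) (k : ℕ) :
    ∑ s, M.stateDist π k s ≤ 1 := by
  induction k with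
  | zero => simp [stateDist]
  | succ k ih =>
    refine le_trans ?_ ih
    simp only [stateDist]
    rw [Finset.sum_comm]
    refine Finset.sum_le_sum fun s _ => ?_
    rw [Finset.sum_comm]
    exact M.sum_P_mul_le (stateDist_nonneg hπ k s) hπ hπ1 s

lemma stateDist_eq_zero {k : ℕ} {s : S} (h : M.layer s ≠ k) : M.stateDist π k s = 0 := by
  induction k generalizing s with
  | zero =>
    rw [ne_eq, M.layer_eq_zero_iff] at h
    simp [stateDist, h]
  | succ k ih =>
    refine Finset.sum_eq_zero fun r _ => Finset.sum_eq_zero fun a _ => ?_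
    by_cases hr : M.layer r = k
    · rw [M.P_layer r a s (by omega), mul_zero]
    · rw [ih hr, zero_mul, zero_mul]

/-- The total of the widths `w` expected along an episode of the policy `π`. -/
def expectedWidth (M : LoopFreeMDP S A L) (π w : S → A → ℝ) : ℝ :=
  ∑ k ∈ Finset.range L, ∑ s, ∑ a, M.stateDist π k s * π s a * w s a

/-- One state of the comparison between a flow and the occupancy measure of its policy. -/
lemma sum_abs_sub_occupancy_le {T : ℕ} {ζ : ℝ} {K : Counters S A} {θ : S × A × S → ℝ}
    (hθ : θ ∈ M.optimisticSet T ζ K)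
    (hK : ∀ s a, M.layer s < L → ∑ s', |M.P s a s' - K.empirical s a s'| ≤ M.radius T ζ K s a)
    {s : S} (hs : M.layer s < L) {m : ℝ} (hm : 0 ≤ m) :
    ∑ a, ∑ s', |θ (s, a, s') - m * policyOf θ s a * M.P s a s'|
      ≤ |∑ a, ∑ s', θ (s, a, s') - m|
        + 2 * ∑ a, m * policyOf θ s a * M.radius T ζ K s a := by
  set mu : ℝ := ∑ a, ∑ s', θ (s, a, s') with hmu
  have hθ0 := hθ.1.nonneg
  have hterm : ∀ a, ∑ s', |θ (s, a, s') - m * policyOf θ s a * M.P s a s'|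
      ≤ |mu - m| * policyOf θ s a + 2 * (m * policyOf θ s a * M.radius T ζ K s a) := by
    intro a
    set w : ℝ := ∑ s', θ (s, a, s') with hw
    have hpol : policyOf θ s a = w / mu := rfl
    have hw0 : 0 ≤ w := Finset.sum_nonneg fun _ _ => hθ0 _
    have hwmu : w ≤ mu := Finset.single_le_sum (f := fun b => ∑ s', θ (s, b, s'))
      (fun b _ => Finset.sum_nonneg fun _ _ => hθ0 _) (Finset.mem_univ a)
    rcases hw0.eq_or_lt with h0 | h0
    · have hz : ∀ s', θ (s, a, s') = 0 := fun s' =>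
        (Finset.sum_eq_zero_iff_of_nonneg fun _ _ => hθ0 _).1 h0.symm s' (Finset.mem_univ s')
      simp [hpol, ← h0, hz]
    have hmu0 : 0 < mu := h0.trans_le hwmu
    set q : ℝ := policyOf θ s a with hq
    have hq0 : 0 ≤ q := policyOf_nonneg hθ0 s a
    have hqmu : mu * q = w := by rw [hpol]; field_simp
    have hcond : ∑ s', |θ (s, a, s') / w - K.empirical s a s'| ≤ M.radius T ζ K s a := by
      have h1 := hθ.2 s a
      rw [← hw] at h1
      have h2 : ∑ s', |θ (s, a, s') - K.empirical s a s' * w|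
          = (∑ s', |θ (s, a, s') / w - K.empirical s a s'|) * w := by
        rw [Finset.sum_mul]
        refine Finset.sum_congr rfl fun s' _ => ?_
        conv_rhs => rw [← abs_of_pos h0]
        rw [← abs_mul, abs_of_pos h0, sub_mul, div_mul_cancel₀ _ h0.ne']
      rw [h2] at h1
      exact le_of_mul_le_mul_right h1 h0
    have hone : ∑ s', θ (s, a, s') / w = 1 := by
      rw [← Finset.sum_div, ← hw, div_self h0.ne']
    calc ∑ s', |θ (s, a, s') - m * q * M.P s a s'|
        ≤ ∑ s', (|mu - m| * q * (θ (s, a, s') / w)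
            + m * q * (|θ (s, a, s') / w - K.empirical s a s'|
              + |M.P s a s' - K.empirical s a s'|)) := by
          refine Finset.sum_le_sum fun s' _ => ?_
          have e1 : θ (s, a, s') - m * q * M.P s a s'
              = (mu - m) * (q * (θ (s, a, s') / w))
                + m * q * ((θ (s, a, s') / w - K.empirical s a s')
                  - (M.P s a s' - K.empirical s a s')) := by
            have : mu * q * (θ (s, a, s') / w) = θ (s, a, s') := by
              rw [hqmu, mul_div_cancel₀ _ h0.ne']
            linear_combination -this
          rw [e1]
          refine (abs_add_le _ _).trans (add_le_add (le_of_eq ?_) ?_)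
          · rw [abs_mul, abs_of_nonneg (mul_nonneg hq0 (div_nonneg (hθ0 _) hw0)), mul_assoc]
          · rw [abs_mul, abs_of_nonneg (mul_nonneg hm hq0)]
            exact mul_le_mul_of_nonneg_left (abs_sub _ _) (mul_nonneg hm hq0)
      _ = |mu - m| * q + m * q * (∑ s', |θ (s, a, s') / w - K.empirical s a s'|
            + ∑ s', |M.P s a s' - K.empirical s a s'|) := by
          rw [Finset.sum_add_distrib, ← Finset.mul_sum, ← Finset.mul_sum, Finset.sum_add_distrib,
            hone, mul_one]
      _ ≤ |mu - m| * q + m * q * (M.radius T ζ K s a + M.radius T ζ K s a) := by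
          gcongr
          exact hK s a hs
      _ = _ := by ring
  calc _ ≤ ∑ a, (|mu - m| * policyOf θ s a + 2 * (m * policyOf θ s a * M.radius T ζ K s a)) :=
        Finset.sum_le_sum fun a _ => hterm a
    _ = |mu - m| * ∑ a, policyOf θ s a + 2 * ∑ a, m * policyOf θ s a * M.radius T ζ K s a := by
        rw [Finset.sum_add_distrib, Finset.mul_sum, Finset.mul_sum]
    _ ≤ _ := by
        gcongr
        exact mul_le_of_le_one_right (abs_nonneg _) (sum_policyOf_le_one θ s)

lemma occupancy_term (M : LoopFreeMDP S A L) (π : S → A → ℝ) (a : A) (s' : S) :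
    M.occupancy π (M.term, a, s') = 0 := by
  have h1 := M.layer_le s'
  have h2 := (M.layer_eq_last_iff M.term).2 rfl
  simp only [occupancy]
  rw [M.P_layer _ _ _ (by omega), mul_zero]

/-- A flow of the optimistic set is close to the true occupancy measure of its policy: the error
made in a layer is carried over to all later ones. -/
lemma l1Norm_sub_occupancy_le {T : ℕ} {ζ : ℝ} {K : Counters S A} {θ : S × A × S → ℝ}
    (hθ : θ ∈ M.optimisticSet T ζ K)
    (hK : ∀ s a, M.layer s < L → ∑ s', |M.P s a s' - K.empirical s a s'| ≤ M.radius T ζ K s a) :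
    l1Norm (θ - M.occupancy (policyOf θ))
      ≤ 2 * L * M.expectedWidth (policyOf θ) (M.radius T ζ K) := by
  have hθ0 := hθ.1.nonneg
  set π := policyOf θ with hπdef
  have hπ : ∀ s a, 0 ≤ π s a := policyOf_nonneg hθ0
  set w := M.radius T ζ K with hw
  have hw0 : ∀ s a, 0 ≤ w s a := fun s a => Real.sqrt_nonneg _
  set x : ℕ → ℝ := fun k => ∑ s, ∑ a, M.stateDist π k s * π s a * w s a with hx
  have hx0 : ∀ k, 0 ≤ x k := fun k => Finset.sum_nonneg fun s _ => Finset.sum_nonneg fun a _ =>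
    mul_nonneg (mul_nonneg (stateDist_nonneg hπ k s) (hπ s a)) (hw0 s a)
  -- the error in a layer, and the error of the state distribution
  set err : ℕ → ℝ := fun k => ∑ s with M.layer s = k, ∑ a, ∑ s',
    |θ (s, a, s') - M.occupancy π (s, a, s')| with herr
  set dlt : ℕ → ℝ := fun k => ∑ s with M.layer s = k,
    |∑ a, ∑ s', θ (s, a, s') - M.stateDist π k s| with hdlt
  have h1 : ∀ k < L, err k ≤ dlt k + 2 * x k := by
    intro k hk
    have e1 : x k = ∑ s with M.layer s = k, ∑ a, M.stateDist π k s * π s a * w s a := by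
      rw [Finset.sum_filter]
      refine Finset.sum_congr rfl fun s _ => ?_
      split_ifs with h
      · rfl
      · simp [stateDist_eq_zero h]
    rw [e1, Finset.mul_sum]
    simp only [herr, hdlt, ← Finset.sum_add_distrib]
    refine Finset.sum_le_sum fun s hs => ?_
    have hs : M.layer s = k := (Finset.mem_filter.1 hs).2
    have := sum_abs_sub_occupancy_le hθ hK (s := s) (by omega)
      (stateDist_nonneg (M := M) hπ k s)
    simpa only [occupancy, hs] using this
  have h2 : ∀ k, k + 1 < L → dlt (k + 1) ≤ err k := by
    intro k hk
    calc dlt (k + 1) ≤ ∑ s' with M.layer s' = k + 1, ∑ r with M.layer r = k, ∑ a,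
          |θ (r, a, s') - M.occupancy π (r, a, s')| := by
          refine Finset.sum_le_sum fun s' hs' => ?_
          have hs' : M.layer s' = k + 1 := (Finset.mem_filter.1 hs').2
          have e1 : ∑ a, ∑ s'', θ (s', a, s'') - M.stateDist π (k + 1) s'
              = ∑ r with M.layer r = k, ∑ a, (θ (r, a, s') - M.occupancy π (r, a, s')) := by
            rw [← hθ.1.flow s' (by omega) (by omega), Finset.sum_filter]
            simp only [stateDist]
            rw [← Finset.sum_sub_distrib]
            refine Finset.sum_congr rfl fun r _ => ?_
            split_ifs with hr
            · rw [← Finset.sum_sub_distrib]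
              simp only [occupancy, hr]
            · rw [Finset.sum_eq_zero fun a _ => hθ.1.support r a s' (by omega)]
              simp [stateDist_eq_zero hr]
          rw [e1]
          exact (Finset.abs_sum_le_sum_abs _ _).trans
            (Finset.sum_le_sum fun r _ => Finset.abs_sum_le_sum_abs _ _)
      _ ≤ ∑ s', ∑ r with M.layer r = k, ∑ a, |θ (r, a, s') - M.occupancy π (r, a, s')| :=
          Finset.sum_le_sum_of_subset_of_nonneg (Finset.filter_subset _ _) fun _ _ _ =>
            Finset.sum_nonneg fun _ _ => Finset.sum_nonneg fun _ _ => abs_nonneg _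
      _ = err k := by
          rw [Finset.sum_comm]
          refine Finset.sum_congr rfl fun r _ => ?_
          rw [Finset.sum_comm]
  have h3 : 0 < L → dlt 0 = 0 := by
    intro hL
    refine Finset.sum_eq_zero fun s hs => ?_
    have hs : s = M.init := (M.layer_eq_zero_iff s).1 (Finset.mem_filter.1 hs).2
    have e1 := hθ.1.mass 0 hL
    have e2 : (Finset.univ.filter fun s => M.layer s = 0) = {M.init} := by
      ext s
      simp [M.layer_eq_zero_iff]
    rw [e2, Finset.sum_singleton] at e1
    rw [hs, e1]
    simp [stateDist]
  have h4 : ∀ k < L, err k ≤ 2 * ∑ j ∈ Finset.range (k + 1), x j := by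
    intro k
    induction k with
    | zero =>
      intro hk
      have := h1 0 hk
      rw [h3 hk] at this
      simpa using this
    | succ k ih =>
      intro hk
      have e1 := h1 (k + 1) hk
      have e2 := h2 k hk
      have e3 := ih (by omega)
      rw [Finset.sum_range_succ]
      linarith
  have h5 : l1Norm (θ - M.occupancy π) = ∑ k ∈ Finset.range L, err k := by
    rw [l1Norm, sum_triple, M.sum_eq_sum_layers]
    · rfl
    · simp [hθ.1.eq_zero_of_term, occupancy_term]
  have h6 : M.expectedWidth π w = ∑ k ∈ Finset.range L, x k := rfl
  rw [h5, h6]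
  calc ∑ k ∈ Finset.range L, err k
      ≤ ∑ k ∈ Finset.range L, 2 * ∑ j ∈ Finset.range L, x j := by
        refine Finset.sum_le_sum fun k hk => (h4 k (Finset.mem_range.1 hk)).trans ?_
        have : ∑ j ∈ Finset.range (k + 1), x j ≤ ∑ j ∈ Finset.range L, x j :=
          Finset.sum_le_sum_of_subset_of_nonneg
            (Finset.range_subset_range.2 (Finset.mem_range.1 hk)) fun j _ _ => hx0 j
        linarith
    _ = _ := by
        rw [Finset.sum_const, Finset.card_range, nsmul_eq_mul]
        ring

end LoopFreeMDP

end

/-! ### The law of a path -/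

section

variable {S A : Type*} [Fintype S] [Fintype A] {L : ℕ}

/-- The measures obtained from `w` by applying the kernels `K 0, K 1, …` one after the other. -/
def forward (K : ℕ → S → A → S → ℝ) (w : S → ℝ) : ℕ → S → ℝ
  | 0 => w
  | k + 1 => fun s' => ∑ s, ∑ a, forward K w k s * K k s a s'

/-- Prolonging a path by one step. -/
def snocPath (S A : Type*) (L : ℕ) : Path S A L × A × S ≃ Path S A (L + 1) where
  toFun q := (Fin.snoc (α := fun _ => S) q.1.1 q.2.2, Fin.snoc (α := fun _ => A) q.1.2 q.2.1)
  invFun p := ((Fin.init (α := fun _ => S) p.1, Fin.init (α := fun _ => A) p.2),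
    p.2 (Fin.last L), p.1 (Fin.last (L + 1)))
  left_inv q := by simp
  right_inv p := by simp

lemma sum_path_prod (K : ℕ → S → A → S → ℝ) (w : S → ℝ) (L : ℕ) (ψ : S → ℝ) :
    ∑ p : Path S A L, w (p.1 0) * (∏ k : Fin L, K k (p.1 k.castSucc) (p.2 k) (p.1 k.succ))
        * ψ (p.1 (Fin.last L)) = ∑ s, forward K w L s * ψ s := by
  induction L generalizing ψ with
  | zero =>
    rw [Fintype.sum_prod_type]
    simp only [Finset.univ_unique, Finset.sum_singleton, Finset.univ_eq_empty, Finset.prod_empty,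
      mul_one, forward]
    rw [← (Equiv.funUnique (Fin 1) S).sum_comp fun s => w s * ψ s]
    rfl
  | succ L ih =>
    have h1 : ∑ s, forward K w (L + 1) s * ψ s
        = ∑ s, forward K w L s * ∑ a, ∑ s', K L s a s' * ψ s' := by
      simp only [forward, Finset.sum_mul, Finset.mul_sum]
      rw [Finset.sum_comm]
      refine Finset.sum_congr rfl fun s _ => ?_
      rw [Finset.sum_comm]
      exact Finset.sum_congr rfl fun a _ => Finset.sum_congr rfl fun s' _ => by ring
    rw [h1, ← ih]
    rw [← (snocPath S A L).sum_comp, Fintype.sum_prod_type]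
    refine Finset.sum_congr rfl fun p _ => ?_
    rw [Fintype.sum_prod_type, Finset.mul_sum]
    refine Finset.sum_congr rfl fun a _ => ?_
    rw [Finset.mul_sum]
    refine Finset.sum_congr rfl fun s' _ => ?_
    have h0 : (0 : Fin (L + 2)) = Fin.castSucc 0 := rfl
    simp only [snocPath, Equiv.coe_fn_mk, Fin.prod_univ_castSucc, Fin.snoc_last, h0,
      Fin.snoc_castSucc, Fin.succ_castSucc, Fin.succ_last, Fin.val_castSucc, Fin.val_last]
    ring

namespace LoopFreeMDP

variable [DecidableEq S] {M : LoopFreeMDP S A L} {π : S → A → ℝ}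

/-- A path of positive probability runs through the layers one after the other. -/
lemma layer_of_pathProb_ne_zero {p : Path S A L} (hp : M.pathProb π p ≠ 0) (k : Fin (L + 1)) :
    M.layer (p.1 k) = k := by
  have h1 := left_ne_zero_of_mul hp
  have h2 := right_ne_zero_of_mul hp
  rw [Finset.prod_ne_zero_iff] at h2
  induction k using Fin.induction with
  | zero =>
    have : p.1 0 = M.init := by
      by_contra h
      exact h1 (if_neg h)
    rw [this, M.layer_init]
    rfl
  | succ k ih =>
    have h3 := right_ne_zero_of_mul (h2 k (Finset.mem_univ k))
    by_contra h
    refine h3 (M.P_layer _ _ _ ?_)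
    rw [ih]
    simpa using h

/-- The step `(s_k, a_k, s_{k+1})` of a path. -/
def stepAt {S A : Type*} {L : ℕ} (p : Path S A L) (k : Fin L) : S × A × S :=
  (p.1 k.castSucc, p.2 k, p.1 k.succ)

/-- The distribution of the step in layer `k`. -/
def stepDist (M : LoopFreeMDP S A L) (π : S → A → ℝ) (k : ℕ) (e : S × A × S) : ℝ :=
  M.stateDist π k e.1 * π e.1 e.2.1 * M.P e.1 e.2.1 e.2.2

lemma sum_stepDist_le_one (hπ : ∀ s a, 0 ≤ π s a) (hπ1 : ∀ s, ∑ a, π s a ≤ 1) (k : ℕ) :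
    ∑ e, M.stepDist π k e ≤ 1 := by
  rw [sum_triple]
  refine le_trans (Finset.sum_le_sum fun s _ => ?_) (sum_stateDist_le_one (M := M) hπ hπ1 k)
  exact M.sum_P_mul_le (stateDist_nonneg hπ k s) hπ hπ1 s

/-- For a substochastic policy, paths that die out only lower the law of a step. -/
lemma sum_pathProb_mul_le (hπ : ∀ s a, 0 ≤ π s a) (hπ1 : ∀ s, ∑ a, π s a ≤ 1) (k : Fin L)
    {φ : S × A × S → ℝ} (hφ : ∀ e, 0 ≤ φ e) :
    ∑ p, M.pathProb π p * φ (stepAt p k) ≤ ∑ e, M.stepDist π k e * φ e := by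
  set K : ℕ → S → A → S → ℝ := fun j s a s' =>
    π s a * M.P s a s' * (if j = k then φ (s, a, s') else 1) with hK
  set w : S → ℝ := fun s => if s = M.init then 1 else 0 with hw
  have h1 : ∀ p : Path S A L, M.pathProb π p * φ (stepAt p k)
      = w (p.1 0) * (∏ j : Fin L, K j (p.1 j.castSucc) (p.2 j) (p.1 j.succ)) * 1 := by
    intro p
    have : ∏ j : Fin L, (if (j : ℕ) = k then φ (p.1 j.castSucc, p.2 j, p.1 j.succ) else 1)
        = φ (stepAt p k) := by
      rw [Finset.prod_eq_single k]
      · simp [stepAt]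
      · intro j _ hj
        exact if_neg fun h => hj (Fin.ext h)
      · simp
    simp only [hK, Finset.prod_mul_distrib, this, pathProb, hw]
    ring
  rw [Finset.sum_congr rfl fun p _ => h1 p, sum_path_prod K w L fun _ => 1]
  have hK0 : ∀ j s a s', 0 ≤ K j s a s' := by
    intro j s a s'
    refine mul_nonneg (mul_nonneg (hπ s a) (M.P_nonneg _ _ _)) ?_
    split_ifs
    exacts [hφ _, zero_le_one]
  have hF0 : ∀ j s, 0 ≤ forward K w j s := by
    intro j
    induction j with
    | zero => intro s; simp only [forward, hw]; split_ifs <;> norm_num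
    | succ j ih =>
      intro s'
      exact Finset.sum_nonneg fun s _ => Finset.sum_nonneg fun a _ =>
        mul_nonneg (ih s) (hK0 _ _ _ _)
  have h2 : ∀ j ≤ (k : ℕ), forward K w j = M.stateDist π j := by
    intro j
    induction j with
    | zero => exact fun _ => rfl
    | succ j ih =>
      intro hj
      funext s'
      simp only [forward, stateDist, ih (by omega)]
      refine Finset.sum_congr rfl fun s _ => Finset.sum_congr rfl fun a _ => ?_
      simp only [hK, if_neg (show ¬ j = (k : ℕ) by omega)]
      ring
  have h3 : ∑ s', forward K w (k + 1) s' = ∑ e, M.stepDist π k e * φ e := by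
    rw [sum_triple]
    simp only [forward, h2 k le_rfl]
    rw [Finset.sum_comm]
    refine Finset.sum_congr rfl fun s _ => ?_
    rw [Finset.sum_comm]
    refine Finset.sum_congr rfl fun a _ => Finset.sum_congr rfl fun s' _ => ?_
    simp only [hK, stepDist, if_true]
    ring
  have h4 : ∀ j, (k : ℕ) + 1 ≤ j → ∑ s', forward K w j s' ≤ ∑ e, M.stepDist π k e * φ e := by
    intro j hj
    induction j, hj using Nat.le_induction with
    | base => exact h3.le
    | succ j hj ih =>
      refine le_trans ?_ ih
      simp only [forward]
      rw [Finset.sum_comm]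
      refine Finset.sum_le_sum fun s _ => ?_
      rw [Finset.sum_comm]
      refine le_trans (le_of_eq ?_) (M.sum_P_mul_le (hF0 j s) hπ hπ1 s)
      refine Finset.sum_congr rfl fun a _ => Finset.sum_congr rfl fun s' _ => ?_
      simp only [hK, if_neg (show ¬ j = (k : ℕ) by omega)]
      ring
  simpa using h4 L k.2

/-- If no paths die out, then the step in layer `k` of a path has the law `stepDist π k`. -/
lemma sum_pathProb_mul (hπ : ∀ s a, 0 ≤ π s a) (hπ1 : ∀ s, ∑ a, π s a ≤ 1)
    (h1 : ∑ p, M.pathProb π p = 1) (k : Fin L) (φ : S × A × S → ℝ) :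
    ∑ p, M.pathProb π p * φ (stepAt p k) = ∑ e, M.stepDist π k e * φ e := by
  classical
  have h2 : ∀ ψ : S × A × S → ℝ, ∑ p, M.pathProb π p * ψ (stepAt p k)
      = ∑ e, (∑ p, M.pathProb π p * if stepAt p k = e then 1 else 0) * ψ e := by
    intro ψ
    simp only [Finset.sum_mul]
    rw [Finset.sum_comm]
    refine Finset.sum_congr rfl fun p _ => ?_
    simp
  have h3 : ∀ e, (∑ p, M.pathProb π p * if stepAt p k = e then 1 else 0) ≤ M.stepDist π k e := by
    intro e
    have := sum_pathProb_mul_le (M := M) hπ hπ1 k (φ := fun e' => if e' = e then 1 else 0)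
      (fun _ => by split_ifs <;> norm_num)
    simpa using this
  have h4 : ∑ e, (∑ p, M.pathProb π p * if stepAt p k = e then 1 else 0) = 1 := by
    have := h2 fun _ => 1
    simp only [mul_one] at this
    rw [← this, h1]
  have h5 : ∀ e ∈ Finset.univ, (∑ p, M.pathProb π p * if stepAt p k = e then 1 else 0)
      = M.stepDist π k e := by
    refine (Finset.sum_eq_sum_iff_of_le fun e _ => h3 e).1 (le_antisymm
      (Finset.sum_le_sum fun e _ => h3 e) ?_)
    rw [h4]
    exact sum_stepDist_le_one hπ hπ1 k
  rw [h2]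
  exact Finset.sum_congr rfl fun e he => by rw [h5 e he]

lemma sum_stepDist_eq_one (hπ : ∀ s a, 0 ≤ π s a) (hπ1 : ∀ s, ∑ a, π s a ≤ 1)
    (h1 : ∑ p, M.pathProb π p = 1) (k : Fin L) : ∑ e, M.stepDist π k e = 1 := by
  have := sum_pathProb_mul hπ hπ1 h1 k fun _ => 1
  simp only [mul_one] at this
  rw [← this, h1]

/-- The expected width is the expectation of the total width along a path. -/
lemma sum_pathProb_mul_width (hπ : ∀ s a, 0 ≤ π s a) (hπ1 : ∀ s, ∑ a, π s a ≤ 1)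
    (h1 : ∑ p, M.pathProb π p = 1) (w : S → A → ℝ) (hw : ∀ a, w M.term a = 0) :
    ∑ p, M.pathProb π p * ∑ k : Fin L, w (p.1 k.castSucc) (p.2 k) = M.expectedWidth π w := by
  simp only [Finset.mul_sum]
  rw [Finset.sum_comm, expectedWidth, Finset.sum_range]
  refine Finset.sum_congr rfl fun k _ => ?_
  have := sum_pathProb_mul (M := M) hπ hπ1 h1 k fun e => w e.1 e.2.1
  simp only [stepAt] at this
  rw [this, sum_triple]
  refine Finset.sum_congr rfl fun s _ => Finset.sum_congr rfl fun a _ => ?_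
  simp only [stepDist]
  rw [← Finset.sum_mul, ← Finset.mul_sum]
  by_cases hs : M.layer s < L
  · rw [M.P_sum s a hs, mul_one]
  · rw [M.layer_lt_iff, not_not] at hs
    simp [hs, hw]

section Visits

variable [DecidableEq A] {p : Path S A L}

/-- On a path that runs through the layers, a state can only be visited at the time given by its
layer. -/
lemma visits_eq_ite (hp : ∀ k, M.layer (p.1 k) = k) (k : Fin L) {s : S} (hs : M.layer s = k)
    (a : A) : visits p s a = if (stepAt p k).1 = s ∧ (stepAt p k).2.1 = a then 1 else 0 := by
  have : ∀ j : Fin L, (p.1 j.castSucc = s ∧ p.2 j = a) ↔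
      j = k ∧ p.1 k.castSucc = s ∧ p.2 k = a := by
    intro j
    constructor
    · rintro ⟨h1, h2⟩
      have h3 := hp j.castSucc
      rw [h1, hs] at h3
      obtain rfl : k = j := Fin.ext (by simpa using h3)
      exact ⟨rfl, h1, h2⟩
    · rintro ⟨rfl, h⟩
      exact h
  rw [visits, Finset.filter_congr fun j _ => this j]
  simp only [stepAt]
  split_ifs with h
  · simp [h, Finset.filter_eq']
  · simp [h]

lemma moves_eq_ite (hp : ∀ k, M.layer (p.1 k) = k) (k : Fin L) {s : S} (hs : M.layer s = k)
    (a : A) (s' : S) : moves p s a s' = if stepAt p k = (s, a, s') then 1 else 0 := by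
  have : ∀ j : Fin L, (p.1 j.castSucc = s ∧ p.2 j = a ∧ p.1 j.succ = s') ↔
      j = k ∧ p.1 k.castSucc = s ∧ p.2 k = a ∧ p.1 k.succ = s' := by
    intro j
    constructor
    · rintro ⟨h1, h2⟩
      have h3 := hp j.castSucc
      rw [h1, hs] at h3
      obtain rfl : k = j := Fin.ext (by simpa using h3)
      exact ⟨rfl, h1, h2⟩
    · rintro ⟨rfl, h⟩
      exact h
  rw [moves, Finset.filter_congr fun j _ => this j]
  simp only [stepAt, Prod.mk.injEq]
  split_ifs with h
  · simp [h, Finset.filter_eq']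
  · simp [h]

lemma visits_term (hp : ∀ k, M.layer (p.1 k) = k) (a : A) : visits p M.term a = 0 := by
  rw [visits, Finset.card_eq_zero, Finset.filter_eq_empty_iff]
  rintro k - ⟨h, -⟩
  have h1 := hp k.castSucc
  rw [h, (M.layer_eq_last_iff M.term).2 rfl] at h1
  have := k.2
  simp at h1
  omega

lemma visits_le_one (hp : ∀ k, M.layer (p.1 k) = k) (s : S) (a : A) : visits p s a ≤ 1 := by
  by_cases hs : M.layer s < L
  · rw [visits_eq_ite hp ⟨M.layer s, hs⟩ rfl]
    split_ifs <;> simp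
  · rw [M.layer_lt_iff, not_not] at hs
    rw [hs, visits_term hp]
    exact zero_le_one

/-- A sum along a path in terms of the visits. -/
lemma sum_path_eq_sum_visits (p : Path S A L) (w : S → A → ℝ) :
    ∑ k : Fin L, w (p.1 k.castSucc) (p.2 k) = ∑ s, ∑ a, (visits p s a : ℝ) * w s a := by
  have : ∀ s a, (visits p s a : ℝ) * w s a
      = ∑ k : Fin L, if p.1 k.castSucc = s ∧ p.2 k = a then w s a else 0 := by
    intro s a
    rw [← Finset.sum_filter, Finset.sum_const, nsmul_eq_mul]
    rfl
  simp only [this]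
  rw [← Fintype.sum_prod_type' (f := fun s a => ∑ k : Fin L,
    if p.1 k.castSucc = s ∧ p.2 k = a then w s a else 0), Finset.sum_comm]
  refine Finset.sum_congr rfl fun k _ => ?_
  rw [Finset.sum_eq_single (p.1 k.castSucc, p.2 k)]
  · simp
  · rintro ⟨s, a⟩ _ hne
    exact if_neg fun h => hne (Prod.ext h.1.symm h.2.symm)
  · simp

end Visits

end LoopFreeMDP

end

/-! ### Exponential supermartingales and conditional expectations -/

section

section Probability

variable {Ω : Type*} {m mΩ : MeasurableSpace Ω} {μ : Measure Ω} [IsProbabilityMeasure μ]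

/-- A product of nonnegative factors whose conditional expectations given the past are at most one
has expectation at most one. -/
lemma integral_prod_le_one (𝓕 : Filtration ℕ mΩ) (a : ℕ) {Y : ℕ → Ω → ℝ} {C : ℝ} (n : ℕ)
    (hm : ∀ j < n, StronglyMeasurable[𝓕 (a + j + 1)] (Y j))
    (hb : ∀ j < n, ∀ᵐ ω ∂μ, 0 ≤ Y j ω ∧ Y j ω ≤ C)
    (hc : ∀ j < n, μ[Y j | 𝓕 (a + j)] ≤ᵐ[μ] fun _ => 1) :
    StronglyMeasurable[𝓕 (a + n)] (fun ω => ∏ j ∈ Finset.range n, Y j ω) ∧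
    (∀ᵐ ω ∂μ, 0 ≤ ∏ j ∈ Finset.range n, Y j ω ∧ ∏ j ∈ Finset.range n, Y j ω ≤ C ^ n) ∧
    ∫ ω, ∏ j ∈ Finset.range n, Y j ω ∂μ ≤ 1 := by
  induction n with
  | zero =>
    refine ⟨?_, ?_, ?_⟩
    · simp only [Finset.range_zero, Finset.prod_empty]
      exact stronglyMeasurable_const
    · simp
    · simp
  | succ n ih =>
    obtain ⟨h1, h2, h3⟩ := ih (fun j hj => hm j (by omega)) (fun j hj => hb j (by omega))
      (fun j hj => hc j (by omega))
    have hmn := hm n (by omega)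
    have hbn := hb n (by omega)
    have hm' : StronglyMeasurable[𝓕 (a + (n + 1))]
        (fun ω => ∏ j ∈ Finset.range (n + 1), Y j ω) := by
      simp only [Finset.prod_range_succ]
      exact (h1.mono (𝓕.mono (by omega))).mul hmn
    have hb' : ∀ᵐ ω ∂μ, 0 ≤ ∏ j ∈ Finset.range (n + 1), Y j ω ∧
        ∏ j ∈ Finset.range (n + 1), Y j ω ≤ C ^ (n + 1) := by
      filter_upwards [h2, hbn] with ω e1 e2
      rw [Finset.prod_range_succ, pow_succ]
      exact ⟨mul_nonneg e1.1 e2.1, mul_le_mul e1.2 e2.2 e2.1 (e1.1.trans e1.2)⟩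
    refine ⟨hm', hb', ?_⟩
    set P : Ω → ℝ := fun ω => ∏ j ∈ Finset.range n, Y j ω with hP
    have hle := 𝓕.le (a + n)
    have hPint : Integrable P μ := Integrable.of_bound (h1.mono hle).aestronglyMeasurable (C ^ n)
      (h2.mono fun ω e => by rw [Real.norm_of_nonneg e.1]; exact e.2)
    have hYint : Integrable (Y n) μ :=
      Integrable.of_bound (hmn.mono (𝓕.le _)).aestronglyMeasurable C
        (hbn.mono fun ω e => by rw [Real.norm_of_nonneg e.1]; exact e.2)
    have hpull : μ[P * Y n | 𝓕 (a + n)] =ᵐ[μ] P * μ[Y n | 𝓕 (a + n)] :=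
      condExp_stronglyMeasurable_mul_of_bound hle h1 hYint (C ^ n)
        (h2.mono fun ω e => by rw [Real.norm_of_nonneg e.1]; exact e.2)
    calc ∫ ω, ∏ j ∈ Finset.range (n + 1), Y j ω ∂μ = ∫ ω, (P * Y n) ω ∂μ := by
          simp only [Finset.prod_range_succ, hP, Pi.mul_apply]
      _ = ∫ ω, (μ[P * Y n | 𝓕 (a + n)]) ω ∂μ := (integral_condExp hle).symm
      _ ≤ ∫ ω, P ω ∂μ := by
          refine integral_mono_ae integrable_condExp hPint ?_
          filter_upwards [hpull, h2, hc n (by omega)] with ω e1 e2 e3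
          rw [e1, Pi.mul_apply]
          exact mul_le_of_le_one_right e2.1 e3
      _ ≤ 1 := h3

/-- Markov's inequality for the product of `integral_prod_le_one`. -/
lemma measure_le_prod (𝓕 : Filtration ℕ mΩ) (a : ℕ) {Y : ℕ → Ω → ℝ} {C : ℝ} (n : ℕ)
    (hm : ∀ j < n, StronglyMeasurable[𝓕 (a + j + 1)] (Y j))
    (hb : ∀ j < n, ∀ᵐ ω ∂μ, 0 ≤ Y j ω ∧ Y j ω ≤ C)
    (hc : ∀ j < n, μ[Y j | 𝓕 (a + j)] ≤ᵐ[μ] fun _ => 1) {c : ℝ} (hc0 : 0 < c) :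
    μ {ω | c ≤ ∏ j ∈ Finset.range n, Y j ω} ≤ ENNReal.ofReal (1 / c) := by
  obtain ⟨h1, h2, h3⟩ := integral_prod_le_one 𝓕 a n hm hb hc
  have hint : Integrable (fun ω => ∏ j ∈ Finset.range n, Y j ω) μ :=
    Integrable.of_bound (h1.mono (𝓕.le _)).aestronglyMeasurable (C ^ n)
      (h2.mono fun ω e => by rw [Real.norm_of_nonneg e.1]; exact e.2)
  have h4 := (mul_meas_ge_le_integral_of_nonneg (h2.mono fun ω e => e.1) hint c).trans h3
  rw [← ofReal_measureReal]
  refine ENNReal.ofReal_le_ofReal ?_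
  rw [le_div_iff₀ hc0]
  linarith

/-- The Azuma-Hoeffding inequality in exponential form, for bounded increments whose conditional
expectations given the past are nonpositive. -/
lemma azuma (𝓕 : Filtration ℕ mΩ) (a : ℕ) {D : ℕ → Ω → ℝ} {c r : ℝ} (n : ℕ) (hc : 0 < c)
    (hr : 0 < r) (hm : ∀ j < n, StronglyMeasurable[𝓕 (a + j + 1)] (D j))
    (hb : ∀ j < n, ∀ᵐ ω ∂μ, |D j ω| ≤ c)
    (hD : ∀ j < n, μ[D j | 𝓕 (a + j)] ≤ᵐ[μ] fun _ => 0) (x : ℝ) :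
    μ {ω | x ≤ ∑ j ∈ Finset.range n, D j ω}
      ≤ ENNReal.ofReal (Real.exp (n * ((r * c) ^ 2 / 2) - r * x)) := by
  set Y : ℕ → Ω → ℝ := fun j ω => Real.exp (r * D j ω - (r * c) ^ 2 / 2) with hY
  have hYm : ∀ j < n, StronglyMeasurable[𝓕 (a + j + 1)] (Y j) := fun j hj =>
    Real.continuous_exp.comp_stronglyMeasurable
      (((hm j hj).const_mul r).sub stronglyMeasurable_const)
  have hYb : ∀ j < n, ∀ᵐ ω ∂μ, 0 ≤ Y j ω ∧ Y j ω ≤ Real.exp (r * c) := fun j hj =>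
    (hb j hj).mono fun ω e => ⟨(Real.exp_pos _).le, Real.exp_le_exp.2 (by
      nlinarith [le_abs_self (D j ω), sq_nonneg (r * c)])⟩
  have hYc : ∀ j < n, μ[Y j | 𝓕 (a + j)] ≤ᵐ[μ] fun _ => 1 := by
    intro j hj
    set α := Real.exp (-((r * c) ^ 2 / 2)) * Real.cosh (r * c) with hα
    set β := Real.exp (-((r * c) ^ 2 / 2)) * Real.sinh (r * c) / c with hβ
    have hα1 : α ≤ 1 := by
      rw [hα, ← Real.exp_zero, show (0 : ℝ) = -((r * c) ^ 2 / 2) + (r * c) ^ 2 / 2 by ring,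
        Real.exp_add]
      exact mul_le_mul_of_nonneg_left (Real.cosh_le_exp_half_sq _) (Real.exp_pos _).le
    have hβ0 : 0 ≤ β := div_nonneg (mul_nonneg (Real.exp_pos _).le
      (Real.sinh_nonneg_iff.2 (by positivity))) hc.le
    have hDint : Integrable (D j) μ :=
      Integrable.of_bound ((hm j hj).mono (𝓕.le _)).aestronglyMeasurable c (hb j hj)
    have hYint : Integrable (Y j) μ :=
      Integrable.of_bound ((hYm j hj).mono (𝓕.le _)).aestronglyMeasurable (Real.exp (r * c))
        ((hYb j hj).mono fun ω e => by rw [Real.norm_of_nonneg e.1]; exact e.2)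
    have hle : Y j ≤ᵐ[μ] (fun _ => α) + β • D j := by
      filter_upwards [hb j hj] with ω e
      have e1 : |D j ω / c| ≤ 1 := by rwa [abs_div, abs_of_pos hc, div_le_one hc]
      have e2 := Real.exp_mul_le_cosh_add_mul_sinh e1 (r * c)
      have e3 : D j ω / c * (r * c) = r * D j ω := by field_simp
      rw [e3] at e2
      simp only [hY, Pi.add_apply, Pi.smul_apply, smul_eq_mul]
      rw [sub_eq_neg_add, Real.exp_add]
      calc _ ≤ Real.exp (-((r * c) ^ 2 / 2))
            * (Real.cosh (r * c) + D j ω / c * Real.sinh (r * c)) :=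
            mul_le_mul_of_nonneg_left e2 (Real.exp_pos _).le
        _ = α + β * D j ω := by rw [hα, hβ]; ring
    have h1 := condExp_mono (m := 𝓕 (a + j)) hYint
      ((integrable_const α).add (hDint.smul β)) hle
    have h2 := condExp_add (integrable_const (μ := μ) α) (hDint.smul β) (𝓕 (a + j))
    have h3 := condExp_smul (μ := μ) β (D j) (𝓕 (a + j))
    have h4 : μ[fun _ => α | 𝓕 (a + j)] = fun _ => α := condExp_const (𝓕.le _) α
    filter_upwards [h1, h2, h3, hD j hj] with ω e1 e2 e3 e4
    rw [e2, Pi.add_apply, h4, e3, Pi.smul_apply, smul_eq_mul] at e1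
    nlinarith
  have key := measure_le_prod 𝓕 a n hYm hYb hYc (c := Real.exp (r * x - n * ((r * c) ^ 2 / 2)))
    (Real.exp_pos _)
  rw [one_div, ← Real.exp_neg, neg_sub] at key
  refine le_trans (measure_mono fun ω hω => ?_) key
  simp only [Set.mem_ofPred_eq, hY] at hω ⊢
  rw [← Real.exp_sum]
  refine Real.exp_le_exp.2 ?_
  rw [Finset.sum_sub_distrib, ← Finset.mul_sum, Finset.sum_const, Finset.card_range, nsmul_eq_mul]
  nlinarith

/-- The Azuma-Hoeffding inequality at confidence `δ`. -/
lemma azuma_sqrt (𝓕 : Filtration ℕ mΩ) (a : ℕ) {D : ℕ → Ω → ℝ} {c δ : ℝ} {n : ℕ} (hn : 0 < n)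
    (hc : 0 < c) (hδ : 0 < δ) (hδ1 : δ < 1)
    (hm : ∀ j < n, StronglyMeasurable[𝓕 (a + j + 1)] (D j))
    (hb : ∀ j < n, ∀ᵐ ω ∂μ, |D j ω| ≤ c)
    (hD : ∀ j < n, μ[D j | 𝓕 (a + j)] ≤ᵐ[μ] fun _ => 0) :
    μ {ω | c * √(2 * n * Real.log (1 / δ)) ≤ ∑ j ∈ Finset.range n, D j ω} ≤ ENNReal.ofReal δ := by
  have hlog : 0 < Real.log (1 / δ) := Real.log_pos (by rwa [lt_div_iff₀ hδ, one_mul])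
  have hn' : (0 : ℝ) < n := by exact_mod_cast hn
  set q := √(2 * n * Real.log (1 / δ)) with hq
  have hq0 : 0 < q := Real.sqrt_pos.2 (by positivity)
  have hq2 : q ^ 2 = 2 * n * Real.log (1 / δ) := Real.sq_sqrt (by positivity)
  refine (azuma 𝓕 a n hc (r := q / (n * c)) (by positivity) hm hb hD _).trans
    (ENNReal.ofReal_le_ofReal (le_of_eq ?_))
  have : n * ((q / (n * c) * c) ^ 2 / 2) - q / (n * c) * (c * q) = -Real.log (1 / δ) := by
    have e1 : n * ((q / (n * c) * c) ^ 2 / 2) - q / (n * c) * (c * q) = -(q ^ 2 / (2 * n)) := by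
      field_simp
      ring
    rw [e1, hq2]
    field_simp
  rw [this, Real.exp_neg, Real.exp_log (by positivity), one_div, inv_inv]

/-- Conditional expectation of a function of the past and a finitely valued variable. -/
lemma condExp_comp_finite {κ : Type*} [Fintype κ] (hm : m ≤ mΩ)
    {Y : Ω → κ} (hY : ∀ p, MeasurableSet {ω | Y ω = p}) {q : κ → Ω → ℝ}
    (hq : ∀ p, μ[Set.indicator {ω | Y ω = p} (fun _ => (1 : ℝ)) | m] =ᵐ[μ] q p)
    {H : κ → Ω → ℝ} {C : ℝ} (hH : ∀ p, StronglyMeasurable[m] (H p))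
    (hb : ∀ p, ∀ᵐ ω ∂μ, |H p ω| ≤ C) :
    μ[fun ω => H (Y ω) ω | m] =ᵐ[μ] fun ω => ∑ p, q p ω * H p ω := by
  classical
  have h1 : (fun ω => H (Y ω) ω)
      = ∑ p, H p * Set.indicator {ω | Y ω = p} (fun _ => (1 : ℝ)) := by
    funext ω
    rw [Finset.sum_apply, Finset.sum_eq_single (Y ω)]
    · simp
    · intro p _ hp
      simp [Ne.symm hp]
    · simp
  have hind : ∀ p, Integrable (Set.indicator {ω | Y ω = p} (fun _ => (1 : ℝ))) μ := fun p =>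
    (integrable_const 1).indicator (hY p)
  have h2 : ∀ p, Integrable (H p * Set.indicator {ω | Y ω = p} (fun _ => (1 : ℝ))) μ := fun p =>
    (hind p).bdd_mul ((hH p).mono hm).aestronglyMeasurable (hb p)
  rw [h1]
  have h3 := condExp_finsetSum (s := Finset.univ) (fun p _ => h2 p) m
  have h4 : ∀ᵐ ω ∂μ, ∀ p, (μ[H p * Set.indicator {ω | Y ω = p} (fun _ => (1 : ℝ)) | m]) ω
      = H p ω * q p ω := by
    rw [ae_all_iff]
    intro p
    filter_upwards [condExp_stronglyMeasurable_mul_of_bound hm (hH p) (hind p) C (hb p), hq p]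
      with ω e1 e2
    rw [e1, Pi.mul_apply, e2]
  filter_upwards [h3, h4] with ω e1 e2
  rw [e1, Finset.sum_apply]
  exact Finset.sum_congr rfl fun p _ => by rw [e2 p, mul_comm]

section Noise

variable {β : Type*} {mβ : MeasurableSpace β} {Z : Ω → β} {ν : Measure β}
  [IsProbabilityMeasure ν]

/-- If the conditional law of `Z` is constant, then its law on each event of the past is a multiple
of that constant. -/
lemma map_restrict_eq_smul (hm : m ≤ mΩ) (hZ : Measurable Z)
    (hlaw : ∀ E, MeasurableSet E →
      μ[Set.indicator (Z ⁻¹' E) (fun _ => (1 : ℝ)) | m] =ᵐ[μ] fun _ => ν.real E)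
    {F : Set Ω} (hF : MeasurableSet[m] F) : (μ.restrict F).map Z = μ F • ν := by
  ext E hE
  rw [Measure.map_apply hZ hE, Measure.restrict_apply (hZ hE), Measure.smul_apply, smul_eq_mul]
  have hint : Integrable (Set.indicator (Z ⁻¹' E) (fun _ => (1 : ℝ))) μ :=
    (integrable_const 1).indicator (hZ hE)
  have h1 := setIntegral_condExp hm hint hF
  rw [setIntegral_congr_ae (hm F hF) ((hlaw E hE).mono fun ω e _ => e), setIntegral_const,
    integral_indicator (hZ hE), Measure.restrict_restrict (hZ hE), setIntegral_const,
    smul_eq_mul, smul_eq_mul, mul_one] at h1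
  rw [← ENNReal.toReal_eq_toReal_iff' (by finiteness) (by finiteness), ENNReal.toReal_mul]
  exact h1.symm

lemma ae_comp_of_law (hm : m ≤ mΩ) (hZ : Measurable Z)
    (hlaw : ∀ E, MeasurableSet E →
      μ[Set.indicator (Z ⁻¹' E) (fun _ => (1 : ℝ)) | m] =ᵐ[μ] fun _ => ν.real E)
    {q : β → Prop} (hq : ∀ᵐ x ∂ν, q x) : ∀ᵐ ω ∂μ, q (Z ω) := by
  have h1 := map_restrict_eq_smul hm hZ hlaw MeasurableSet.univ
  rw [Measure.restrict_univ, measure_univ, one_smul] at h1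
  exact ae_of_ae_map hZ.aemeasurable (h1 ▸ hq)

lemma condExp_comp_of_law (hm : m ≤ mΩ) (hZ : Measurable Z)
    (hlaw : ∀ E, MeasurableSet E →
      μ[Set.indicator (Z ⁻¹' E) (fun _ => (1 : ℝ)) | m] =ᵐ[μ] fun _ => ν.real E)
    {h : β → ℝ} (hh : Measurable h) (hint : Integrable h ν) :
    μ[fun ω => h (Z ω) | m] =ᵐ[μ] fun _ => ∫ x, h x ∂ν := by
  have h1 := map_restrict_eq_smul hm hZ hlaw MeasurableSet.univ
  rw [Measure.restrict_univ, measure_univ, one_smul] at h1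
  have hi : Integrable (fun ω => h (Z ω)) μ := by
    rw [← h1] at hint
    exact hint.comp_measurable hZ
  refine (ae_eq_condExp_of_forall_setIntegral_eq hm hi
    (fun F _ _ => (integrable_const _).integrableOn)
    (fun F hF _ => ?_) aestronglyMeasurable_const).symm
  have h2 := map_restrict_eq_smul hm hZ hlaw hF
  rw [← integral_map (μ := μ.restrict F) hZ.aemeasurable hh.aestronglyMeasurable, h2,
    integral_smul_measure, setIntegral_const]
  rfl

end Noise

end Probability

end

/-! ### Runs of the algorithm -/

section

lemma measurable_policyOf {S A : Type*} [Fintype S] [Fintype A] (s : S) (a : A) :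
    Measurable fun θ : S × A × S → ℝ => policyOf θ s a := by
  unfold policyOf
  fun_prop

namespace LoopFreeMDP

lemma measurable_stateDist {S A : Type*} [Fintype S] [Fintype A] [DecidableEq S] {L : ℕ}
    (M : LoopFreeMDP S A L) (k : ℕ) (s : S) :
    Measurable fun θ : S × A × S → ℝ => M.stateDist (policyOf θ) k s := by
  induction k generalizing s with
  | zero => exact measurable_const
  | succ k ih =>
    simp only [stateDist]
    refine Finset.measurable_sum _ fun r _ => Finset.measurable_sum _ fun a _ => ?_
    exact ((ih r).mul (measurable_policyOf r a)).mul_const _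

namespace IsUCPDRun

variable {S A ι : Type*} [Fintype S] [Fintype A] [Fintype ι] [DecidableEq S] [DecidableEq A]
  {L : ℕ} {Ξ : ι → Type*} [∀ i, MeasurableSpace (Ξ i)] {Ω : Type*} [mΩ : MeasurableSpace Ω]
  {M : LoopFreeMDP S A L} {T : ℕ} {V α lam ζ : ℝ} {f : ℕ → S × A × S → ℝ}
  {G : (i : ι) → S × A × S → Ξ i → ℝ} {D : (i : ι) → Measure (Ξ i)} {c : ι → ℝ} {μ : Measure Ω}
  {𝓕 : Filtration ℕ mΩ} {X : ℕ → Ω → Path S A L} {ξ : ℕ → Ω → (i : ι) → Ξ i}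
  {θ : ℕ → Ω → S × A × S → ℝ}

/-- A quantity that only depends on the paths of the episodes `1, …, t` is known after
episode `t`. -/
lemma measurable_of_paths (h : M.IsUCPDRun T V α lam ζ f G D c μ 𝓕 X ξ θ) (t : ℕ)
    {γ : Type*} [MeasurableSpace γ] {F : Ω → γ}
    (hF : ∀ ω ω', (∀ j, 1 ≤ j → j ≤ t → X j ω = X j ω') → F ω = F ω') : Measurable[𝓕 t] F := by
  intro B _
  set R : Ω → Fin t → Path S A L := fun ω j => X (j + 1) ω with hR
  have hRm : ∀ r, MeasurableSet[𝓕 t] {ω | R ω = r} := by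
    intro r
    have : {ω | R ω = r} = ⋂ j : Fin t, {ω | X ((j : ℕ) + 1) ω = r j} := by
      ext ω
      simp [hR, funext_iff]
    rw [this]
    exact MeasurableSet.iInter fun j =>
      𝓕.mono (by omega) _ (h.measurable_path (j + 1) (by omega) (r j))
  have : F ⁻¹' B = ⋃ r ∈ R '' (F ⁻¹' B), {ω | R ω = r} := by
    ext ω
    simp only [Set.mem_preimage, Set.mem_iUnion, Set.mem_image, exists_prop, Set.mem_ofPred_eq]
    constructor
    · exact fun hω => ⟨R ω, ⟨ω, hω, rfl⟩, rfl⟩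
    · rintro ⟨r, ⟨ω', h1, h2⟩, h3⟩
      rwa [hF ω ω' fun j hj hj' => ?_]
      have := congrFun (h3.trans h2.symm) ⟨j - 1, by omega⟩
      simpa only [hR, Nat.sub_add_cancel hj] using this
  rw [this]
  exact MeasurableSet.biUnion (Set.to_countable _) fun r _ => hRm r

variable [∀ i, IsProbabilityMeasure (D i)] [IsProbabilityMeasure μ]

lemma measurableSet_path (h : M.IsUCPDRun T V α lam ζ f G D c μ 𝓕 X ξ θ) (t : ℕ)
    (p : Path S A L) : MeasurableSet {ω | X (t + 1) ω = p} :=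
  𝓕.le _ _ (h.measurable_path (t + 1) (by omega) p)

lemma measurable_noise' (h : M.IsUCPDRun T V α lam ζ f G D c μ 𝓕 X ξ θ) (t : ℕ) :
    Measurable (ξ (t + 1)) :=
  (h.measurable_noise (t + 1) (by omega)).mono (𝓕.le _) le_rfl

lemma law_path (h : M.IsUCPDRun T V α lam ζ f G D c μ 𝓕 X ξ θ) (t : ℕ) (p : Path S A L) :
    μ[Set.indicator {ω | X (t + 1) ω = p} (fun _ => (1 : ℝ)) | 𝓕 t]
      =ᵐ[μ] fun ω => M.pathProb (policyOf (θ (t + 1) ω)) p := by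
  simpa using h.law t p Set.univ MeasurableSet.univ

/-- No paths die out: since the conditional law of a path has mass one, the policy has a nonzero row
at each state that can be reached. -/
lemma ae_sum_pathProb (h : M.IsUCPDRun T V α lam ζ f G D c μ 𝓕 X ξ θ) (t : ℕ) :
    ∀ᵐ ω ∂μ, ∑ p, M.pathProb (policyOf (θ (t + 1) ω)) p = 1 := by
  have h1 := condExp_comp_finite (𝓕.le t) (h.measurableSet_path t) (h.law_path t)
    (H := fun _ _ => 1) (C := 1) (fun _ => stronglyMeasurable_const) (fun _ => by simp)
  have h2 : μ[fun _ : Ω => (1 : ℝ) | 𝓕 t] = fun _ => 1 := condExp_const (𝓕.le t) 1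
  rw [h2] at h1
  filter_upwards [h1] with ω e
  simpa using e.symm

lemma law_noise (h : M.IsUCPDRun T V α lam ζ f G D c μ 𝓕 X ξ θ) (t : ℕ)
    (E : Set ((i : ι) → Ξ i)) (hE : MeasurableSet E) :
    μ[Set.indicator (ξ (t + 1) ⁻¹' E) (fun _ => (1 : ℝ)) | 𝓕 t]
      =ᵐ[μ] fun _ => (Measure.pi D).real E := by
  have h1 : Set.indicator (ξ (t + 1) ⁻¹' E) (fun _ => (1 : ℝ))
      = ∑ p, Set.indicator {ω | X (t + 1) ω = p ∧ ξ (t + 1) ω ∈ E} (fun _ => (1 : ℝ)) := by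
    funext ω
    rw [Finset.sum_apply, Finset.sum_eq_single (X (t + 1) ω)]
    · by_cases hω : ξ (t + 1) ω ∈ E <;> simp [hω]
    · intro p _ hp
      simp [Ne.symm hp]
    · simp
  have h2 : ∀ p, Integrable (Set.indicator {ω | X (t + 1) ω = p ∧ ξ (t + 1) ω ∈ E}
      (fun _ => (1 : ℝ))) μ := fun p =>
    (integrable_const 1).indicator ((h.measurableSet_path t p).inter (h.measurable_noise' t hE))
  rw [h1]
  have h3 := condExp_finsetSum (s := Finset.univ) (fun p _ => h2 p) (𝓕 t)
  have h4 : ∀ᵐ ω ∂μ, ∀ p, _ := ae_all_iff.2 fun p => h.law t p E hE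
  filter_upwards [h3, h4, h.ae_sum_pathProb t] with ω e1 e2 e3
  rw [e1, Finset.sum_apply, Finset.sum_congr rfl fun p _ => e2 p, ← Finset.sum_mul, e3, one_mul]

/-- The paths run through the layers one after the other. -/
lemma ae_layer_path (h : M.IsUCPDRun T V α lam ζ f G D c μ 𝓕 X ξ θ) :
    ∀ᵐ ω ∂μ, ∀ t, 1 ≤ t → ∀ k : Fin (L + 1), M.layer ((X t ω).1 k) = k := by
  have h1 : ∀ t, ∀ᵐ ω ∂μ, ∀ p, (¬ ∀ k : Fin (L + 1), M.layer (p.1 k) = k) → X (t + 1) ω ≠ p := by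
    intro t
    rw [ae_all_iff]
    intro p
    by_cases hp : ∀ k : Fin (L + 1), M.layer (p.1 k) = k
    · exact Filter.Eventually.of_forall fun ω hn => absurd hp hn
    have h2 : ∫ ω, Set.indicator {ω | X (t + 1) ω = p} (fun _ => (1 : ℝ)) ω ∂μ = 0 := by
      rw [← integral_condExp (𝓕.le t), integral_congr_ae (h.law_path t p)]
      refine integral_eq_zero_of_ae (Filter.Eventually.of_forall fun ω => ?_)
      by_contra hne
      exact hp (layer_of_pathProb_ne_zero hne)
    rw [integral_indicator (h.measurableSet_path t p), setIntegral_const, smul_eq_mul,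
      mul_one] at h2
    have h3 : μ {ω | X (t + 1) ω = p} = 0 := (measureReal_eq_zero_iff (by finiteness)).1 h2
    filter_upwards [measure_eq_zero_iff_ae_notMem.1 h3] with ω e _ hX using e hX
  filter_upwards [ae_all_iff.2 h1] with ω e t ht
  obtain ⟨j, rfl⟩ : ∃ j, t = j + 1 := ⟨t - 1, by omega⟩
  by_contra hn
  exact e j _ hn rfl

lemma ae_isFlow [Nonempty A] (h : M.IsUCPDRun T V α lam ζ f G D c μ 𝓕 X ξ θ) :
    ∀ᵐ ω ∂μ, ∀ t, 1 ≤ t → M.IsFlow (θ t ω) := by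
  filter_upwards [h.algorithm] with ω e t ht
  obtain ⟨j, rfl⟩ : ∃ j, t = j + 1 := ⟨t - 1, by omega⟩
  rcases Nat.eq_zero_or_pos j with rfl | hj
  · simp only [zero_add]
    rw [show θ 1 ω = M.uniform from e.first]
    exact M.isFlow_uniform
  · exact (e.mem j hj).1

lemma ae_noise (h : M.IsUCPDRun T V α lam ζ f G D c μ 𝓕 X ξ θ) {q : ((i : ι) → Ξ i) → Prop}
    (hq : ∀ᵐ x ∂(Measure.pi D), q x) : ∀ᵐ ω ∂μ, ∀ t, 1 ≤ t → q (ξ t ω) := by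
  have h1 : ∀ᵐ ω ∂μ, ∀ t, q (ξ (t + 1) ω) := ae_all_iff.2 fun t =>
    ae_comp_of_law (𝓕.le t) (h.measurable_noise' t) (h.law_noise t) hq
  filter_upwards [h1] with ω e t ht
  obtain ⟨j, rfl⟩ : ∃ j, t = j + 1 := ⟨t - 1, by omega⟩
  exact e j

lemma integrable_constraint (hG : ∀ i e, Measurable (G i e))
    (hb : ∀ᵐ x ∂(Measure.pi D), ∑ i, ⨆ e, |G i e (x i)| ≤ 1) (i : ι) (e : S × A × S) :
    Integrable (fun x : (i : ι) → Ξ i => G i e (x i)) (Measure.pi D) :=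
  Integrable.of_bound ((hG i e).comp (measurable_pi_apply i)).aestronglyMeasurable 1
    (hb.mono fun x hx => abs_le_one_of_sum_iSup_le (g := fun i e => G i e (x i)) hx i e)

lemma integral_constraint (hG : ∀ i e, Measurable (G i e)) (i : ι) (e : S × A × S) :
    ∫ x, G i e (x i) ∂(Measure.pi D) = meanConstraint G D i e := by
  have h1 := (measurePreserving_eval D i).map_eq
  rw [meanConstraint, ← h1, integral_map (measurable_pi_apply i).aemeasurable
    (hG i e).aestronglyMeasurable]

lemma condExp_constraint (h : M.IsUCPDRun T V α lam ζ f G D c μ 𝓕 X ξ θ)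
    (hG : ∀ i e, Measurable (G i e))
    (hb : ∀ᵐ x ∂(Measure.pi D), ∑ i, ⨆ e, |G i e (x i)| ≤ 1) (t : ℕ) (i : ι) (e : S × A × S) :
    μ[fun ω => G i e (ξ (t + 1) ω i) | 𝓕 t] =ᵐ[μ] fun _ => meanConstraint G D i e := by
  rw [← integral_constraint hG i e]
  exact condExp_comp_of_law (𝓕.le t) (h.measurable_noise' t) (h.law_noise t)
    (h := fun x => G i e (x i)) ((hG i e).comp (measurable_pi_apply i))
    (integrable_constraint hG hb i e)

/-- The pairings of the mean constraint functions with `z` sum up to at most the `ℓ¹` norm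
of `z`. -/
lemma sum_abs_pairing_mean_le (hG : ∀ i e, Measurable (G i e))
    (hb : ∀ᵐ x ∂(Measure.pi D), ∑ i, ⨆ e, |G i e (x i)| ≤ 1) (z : S × A × S → ℝ) :
    ∑ i, |pairing (meanConstraint G D i) z| ≤ l1Norm z := by
  have hint : ∀ i, Integrable (fun x : (i : ι) → Ξ i => pairing (fun e => G i e (x i)) z)
      (Measure.pi D) := fun i =>
    integrable_finsetSum _ fun e _ => (integrable_constraint hG hb i e).mul_const _
  have h1 : ∀ i, pairing (meanConstraint G D i) z
      = ∫ x, pairing (fun e => G i e (x i)) z ∂(Measure.pi D) := by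
    intro i
    simp only [pairing]
    rw [integral_finsetSum _ fun e _ => (integrable_constraint hG hb i e).mul_const _]
    refine Finset.sum_congr rfl fun e _ => ?_
    rw [integral_mul_const, integral_constraint hG]
  calc ∑ i, |pairing (meanConstraint G D i) z|
      ≤ ∑ i, ∫ x, |pairing (fun e => G i e (x i)) z| ∂(Measure.pi D) := by
        refine Finset.sum_le_sum fun i _ => ?_
        rw [h1]
        exact abs_integral_le_integral_abs
    _ = ∫ x, ∑ i, |pairing (fun e => G i e (x i)) z| ∂(Measure.pi D) :=
        (integral_finsetSum _ fun i _ => (hint i).abs).symm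
    _ ≤ ∫ _, l1Norm z ∂(Measure.pi D) :=
        integral_mono_ae (integrable_finsetSum _ fun i _ => (hint i).abs) (integrable_const _)
          (hb.mono fun x hx => sum_abs_pairing_le (g := fun i e => G i e (x i)) z hx)
    _ = l1Norm z := by simp

/-- The conditional mean of a linear combination of the constraint functions whose coefficients are
known before the episode. -/
lemma condExp_sum_constraint (h : M.IsUCPDRun T V α lam ζ f G D c μ 𝓕 X ξ θ)
    (hG : ∀ i e, Measurable (G i e))
    (hb : ∀ᵐ x ∂(Measure.pi D), ∑ i, ⨆ e, |G i e (x i)| ≤ 1) (t : ℕ)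
    {w : ι → S × A × S → Ω → ℝ} {C : ℝ} (hw : ∀ i e, StronglyMeasurable[𝓕 t] (w i e))
    (hwC : ∀ i e, ∀ᵐ ω ∂μ, |w i e ω| ≤ C) :
    μ[fun ω => ∑ i, ∑ e, w i e ω * G i e (ξ (t + 1) ω i) | 𝓕 t]
      =ᵐ[μ] fun ω => ∑ i, ∑ e, w i e ω * meanConstraint G D i e := by
  have hGint : ∀ i e, Integrable (fun ω => G i e (ξ (t + 1) ω i)) μ := by
    intro i e
    refine Integrable.of_bound ((hG i e).comp
      ((measurable_pi_apply i).comp (h.measurable_noise' t))).aestronglyMeasurable 1 ?_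
    filter_upwards [h.ae_noise hb] with ω hω
    exact abs_le_one_of_sum_iSup_le (g := fun i e => G i e (ξ (t + 1) ω i))
      (hω (t + 1) (by omega)) i e
  have h1 : (fun ω => ∑ i, ∑ e, w i e ω * G i e (ξ (t + 1) ω i))
      = ∑ q : ι × (S × A × S), w q.1 q.2 * fun ω => G q.1 q.2 (ξ (t + 1) ω q.1) := by
    funext ω
    rw [Finset.sum_apply, Fintype.sum_prod_type]
    rfl
  have hint : ∀ q : ι × (S × A × S),
      Integrable (w q.1 q.2 * fun ω => G q.1 q.2 (ξ (t + 1) ω q.1)) μ := fun q =>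
    (hGint q.1 q.2).bdd_mul ((hw q.1 q.2).mono (𝓕.le t)).aestronglyMeasurable (hwC q.1 q.2)
  rw [h1]
  have h3 := condExp_finsetSum (s := Finset.univ) (fun q _ => hint q) (𝓕 t)
  have h4 : ∀ᵐ ω ∂μ, ∀ q : ι × (S × A × S),
      (μ[w q.1 q.2 * fun ω => G q.1 q.2 (ξ (t + 1) ω q.1) | 𝓕 t]) ω
        = w q.1 q.2 ω * meanConstraint G D q.1 q.2 := by
    rw [ae_all_iff]
    intro q
    filter_upwards [condExp_stronglyMeasurable_mul_of_bound (𝓕.le t) (hw q.1 q.2)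
      (hGint q.1 q.2) C (hwC q.1 q.2), h.condExp_constraint hG hb t q.1 q.2] with ω e1 e2
    rw [e1, Pi.mul_apply, e2]
  filter_upwards [h3, h4] with ω e1 e2
  rw [e1, Finset.sum_apply, Fintype.sum_prod_type]
  exact Finset.sum_congr rfl fun i _ => Finset.sum_congr rfl fun e _ => e2 (i, e)

end IsUCPDRun

end LoopFreeMDP

end

/-! ### The confidence sets contain the true model -/

section

/-- Hoeffding's lemma for a Bernoulli variable. -/
lemma bernoulli_mgf_le {q : ℝ} (h0 : 0 ≤ q) (h1 : q ≤ 1) (r : ℝ) :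
    q * Real.exp (r * (1 - q)) + (1 - q) * Real.exp (r * (0 - q)) ≤ Real.exp (r ^ 2 / 8) := by
  set ν : Measure ℝ := ENNReal.ofReal q • Measure.dirac 1
    + ENNReal.ofReal (1 - q) • Measure.dirac 0 with hν
  have hint : ∀ g : ℝ → ℝ, ∫ x, g x ∂ν = q * g 1 + (1 - q) * g 0 := by
    intro g
    rw [hν, integral_add_measure, integral_smul_measure, integral_smul_measure, integral_dirac,
      integral_dirac, ENNReal.toReal_ofReal h0, ENNReal.toReal_ofReal (by linarith)]
    · rfl
    · exact (integrable_dirac (by simp)).smul_measure (by finiteness)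
    · exact (integrable_dirac (by simp)).smul_measure (by finiteness)
  have hp : IsProbabilityMeasure ν := by
    constructor
    simp only [hν, Measure.add_apply, Measure.smul_apply, measure_univ, smul_eq_mul, mul_one]
    rw [← ENNReal.ofReal_add h0 (by linarith)]
    simp
  have hIcc : ∀ᵐ x ∂ν, x ∈ Set.Icc (0 : ℝ) 1 := by
    rw [hν, ae_add_measure_iff]
    constructor
    · exact Measure.ae_smul_measure ((ae_dirac_iff measurableSet_Icc).2 (by simp)) _
    · exact Measure.ae_smul_measure ((ae_dirac_iff measurableSet_Icc).2 (by simp)) _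
  have h2 := (hasSubgaussianMGF_of_mem_Icc (X := fun x : ℝ => x) aemeasurable_id hIcc).mgf_le r
  simp only [mgf, hint, mul_one, mul_zero, add_zero] at h2
  refine h2.trans (Real.exp_le_exp.2 (le_of_eq ?_))
  push_cast
  norm_num
  ring

lemma measure_biUnion_le_card {Ω κ : Type*} [MeasurableSpace Ω] (μ : Measure Ω) (I : Finset κ)
    (U : κ → Set Ω) {b : ℝ} (h : ∀ i ∈ I, μ (U i) ≤ ENNReal.ofReal b) :
    μ (⋃ i ∈ I, U i) ≤ ENNReal.ofReal (I.card * b) := by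
  refine (measure_biUnion_finset_le I U).trans ((Finset.sum_le_sum h).trans ?_)
  rw [Finset.sum_const, nsmul_eq_mul, ENNReal.ofReal_mul (by positivity), ENNReal.ofReal_natCast]

namespace LoopFreeMDP

section Deterministic

variable {S A : Type*} [Fintype S] [Fintype A] {L : ℕ}

/-- The argument of the logarithm in the confidence radius. -/
def logArg (S A : Type*) [Fintype S] [Fintype A] (T : ℕ) (ζ : ℝ) : ℝ :=
  ((T : ℝ) + 1) * Fintype.card S * Fintype.card A / ζ

lemma radius_eq (M : LoopFreeMDP S A L) (T : ℕ) (ζ : ℝ) (K : Counters S A) (s : S) (a : A) :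
    M.radius T ζ K s a = √(2 * M.layerCard (M.layer s + 1) * Real.log (logArg S A T ζ) /
      (max 1 (K.N s a) : ℕ)) := rfl

lemma card_mul_card_div_le_logArg {T : ℕ} {ζ : ℝ} (hT : 1 ≤ T) (hζ : 0 < ζ) (hζ1 : ζ ≤ 1)
    (hS : 1 < Fintype.card S) (hA : 1 < Fintype.card A) : 8 ≤ logArg S A T ζ := by
  have h1 : (1 : ℝ) ≤ T := by exact_mod_cast hT
  have h2 : (2 : ℝ) ≤ Fintype.card S := by exact_mod_cast hS
  have h3 : (2 : ℝ) ≤ Fintype.card A := by exact_mod_cast hA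
  rw [logArg, le_div_iff₀ hζ]
  have h4 : (2 : ℝ) * 2 ≤ ((T : ℝ) + 1) * Fintype.card S := by nlinarith
  nlinarith

lemma one_le_log_logArg {T : ℕ} {ζ : ℝ} (hT : 1 ≤ T) (hζ : 0 < ζ) (hζ1 : ζ ≤ 1)
    (hS : 1 < Fintype.card S) (hA : 1 < Fintype.card A) :
    1 ≤ Real.log (logArg S A T ζ) := by
  rw [Real.le_log_iff_exp_le (by linarith [card_mul_card_div_le_logArg hT hζ hζ1 hS hA])]
  have := Real.exp_one_lt_d9
  linarith [card_mul_card_div_le_logArg hT hζ hζ1 hS hA]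

variable [DecidableEq S] [DecidableEq A]

/-- The event that the moves from `(s, a)` to the set `B` exceed their mean by too much, when
`(s, a)` has been visited `n` times in `t` episodes. -/
def Deviates (M : LoopFreeMDP S A L) (T : ℕ) (ζ : ℝ) (x : ℕ → Path S A L) (s : S) (a : A)
    (t n : ℕ) (B : Finset S) : Prop :=
  totalVisits x (t + 1) s a = n ∧
    n * (√(2 * M.layerCard (M.layer s + 1) * Real.log (logArg S A T ζ) / n) / 2)
      < ∑ s' ∈ B, (totalMoves x (t + 1) s a s' : ℝ) - n * ∑ s' ∈ B, M.P s a s'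

/-- The `ℓ¹` distance of two vectors of equal mass in terms of the set where the second one is
larger. -/
lemma sum_abs_sub_eq_two_mul {p q : S → ℝ} (h : ∑ s, p s = ∑ s, q s) :
    ∑ s, |p s - q s| = 2 * (∑ s with p s < q s, q s - ∑ s with p s < q s, p s) := by
  have h1 : ∑ s, |p s - q s| = ∑ s, ((p s - q s) + 2 * if p s < q s then q s - p s else 0) := by
    refine Finset.sum_congr rfl fun s _ => ?_
    split_ifs with hs
    · rw [abs_of_neg (by linarith)]; ring
    · rw [abs_of_nonneg (by linarith)]; ring
  rw [h1, Finset.sum_add_distrib, Finset.sum_sub_distrib, h, sub_self, zero_add, ← Finset.mul_sum,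
    ← Finset.sum_filter, Finset.sum_sub_distrib]

lemma moves_le_visits (p : Path S A L) (s : S) (a : A) : ∑ s', moves p s a s' = visits p s a := by
  simp only [moves, visits]
  rw [Finset.card_eq_sum_card_fiberwise (f := fun k : Fin L => p.1 k.succ) (t := Finset.univ)
    (fun _ _ => Finset.mem_univ _)]
  refine Finset.sum_congr rfl fun s' _ => ?_
  rw [Finset.filter_filter]
  congr 1
  ext k
  simp [and_assoc]

lemma moves_eq_zero {M : LoopFreeMDP S A L} {p : Path S A L}
    (hp : ∀ k : Fin (L + 1), M.layer (p.1 k) = k) {s s' : S} (a : A)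
    (h : M.layer s' ≠ M.layer s + 1) : moves p s a s' = 0 := by
  rw [moves, Finset.card_eq_zero, Finset.filter_eq_empty_iff]
  rintro k - ⟨h1, -, h2⟩
  have e1 := hp k.castSucc
  have e2 := hp k.succ
  rw [h1] at e1
  rw [h2] at e2
  simp at e1 e2
  omega

/-- If no set of next states deviates, then the empirical model is within the confidence radius of
the true one. -/
lemma confidence_of_not_deviates {M : LoopFreeMDP S A L} {T : ℕ} {ζ : ℝ} {x : ℕ → Path S A L}
    (hlog : 1 ≤ Real.log (logArg S A T ζ))
    (hx : ∀ t, 1 ≤ t → ∀ k : Fin (L + 1), M.layer ((x t).1 k) = k)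
    {s : S} (hs : M.layer s < L) (a : A) {t : ℕ} (ht : 1 ≤ t) (htT : t ≤ T + 1)
    (hdev : 2 ≤ M.layerCard (M.layer s + 1) → ∀ t' ≤ T, ∀ n, 1 ≤ n → n ≤ T →
      ∀ B ⊆ Finset.univ.filter (fun s' => M.layer s' = M.layer s + 1),
        ¬ M.Deviates T ζ x s a t' n B) :
    ∑ s', |M.P s a s' - (Counters.atEpisode x t).empirical s a s'|
      ≤ M.radius T ζ (Counters.atEpisode x t) s a := by
  obtain ⟨t', ht'1, ht't, hN, hM⟩ := Counters.exists_eq_total x ht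
  obtain ⟨j, rfl⟩ : ∃ j, t' = j + 1 := ⟨t' - 1, by omega⟩
  have hcard : 1 ≤ M.layerCard (M.layer s + 1) := by
    have : Nonempty A := ⟨a⟩
    exact M.layerCard_pos hs
  set m := M.layerCard (M.layer s + 1) with hm
  have hsum : ∑ s', totalMoves x (j + 1) s a s' = totalVisits x (j + 1) s a := by
    simp only [totalMoves, totalVisits]
    rw [Finset.sum_comm]
    exact Finset.sum_congr rfl fun i _ => moves_le_visits _ _ _
  have hoff : ∀ s', M.layer s' ≠ M.layer s + 1 → totalMoves x (j + 1) s a s' = 0 :=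
    fun s' hs' => Finset.sum_eq_zero fun i hi => moves_eq_zero
      (hx i (Finset.mem_Ico.1 hi).1) a hs'
  rw [radius_eq, ← hm]
  simp only [Counters.empirical, hN, hM]
  set n := totalVisits x (j + 1) s a with hn
  rcases Nat.eq_zero_or_pos n with h0 | hpos
  · have hz : ∀ s', totalMoves x (j + 1) s a s' = 0 := fun s' => by
      have := Finset.sum_eq_zero_iff.1 (hsum.trans h0) s' (Finset.mem_univ s')
      exact this
    have h1 : (1 : ℝ) ≤ m := by exact_mod_cast hcard
    simp only [hz, h0, Nat.cast_zero, zero_div, sub_zero, abs_of_nonneg (M.P_nonneg _ _ _),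
      M.P_sum s a hs]
    rw [Real.one_le_sqrt]
    simp
    nlinarith
  have hmax : max 1 n = n := max_eq_right hpos
  rw [hmax]
  have hn0 : (0 : ℝ) < n := by exact_mod_cast hpos
  have hsumq : ∑ s', (totalMoves x (j + 1) s a s' : ℝ) / n = 1 := by
    rw [← Finset.sum_div, div_eq_one_iff_eq hn0.ne']
    exact_mod_cast hsum
  rcases hcard.eq_or_lt with h1 | h2
  · -- a layer with a single state: both models are deterministic
    obtain ⟨r, hr⟩ := Finset.card_eq_one.1 h1.symm
    have hr' : ∀ s', s' ≠ r → M.layer s' ≠ M.layer s + 1 := by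
      intro s' hs' hl
      have : s' ∈ Finset.univ.filter (fun s' => M.layer s' = M.layer s + 1) := by simp [hl]
      rw [hr, Finset.mem_singleton] at this
      exact hs' this
    have e1 : M.P s a r = 1 := by
      rw [← M.P_sum s a hs]
      exact (Finset.sum_eq_single r (fun s' _ h => M.P_layer _ _ _ (hr' s' h)) (by simp)).symm
    have e2 : (totalMoves x (j + 1) s a r : ℝ) / n = 1 := by
      rw [← hsumq]
      symm
      refine Finset.sum_eq_single r (fun s' _ h => ?_) (by simp)
      simp [hoff s' (hr' s' h)]
    have e3 : ∑ s', |M.P s a s' - (totalMoves x (j + 1) s a s' : ℝ) / n| = 0 := by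
      refine Finset.sum_eq_zero fun s' _ => ?_
      by_cases h : s' = r
      · rw [h, e1, e2, sub_self, abs_zero]
      · simp [M.P_layer _ a _ (hr' s' h), hoff s' (hr' s' h)]
    rw [e3]
    exact Real.sqrt_nonneg _
  · rw [sum_abs_sub_eq_two_mul ((M.P_sum s a hs).trans hsumq.symm)]
    set B := Finset.univ.filter fun s' => M.P s a s' < (totalMoves x (j + 1) s a s' : ℝ) / n
    have hB : B ⊆ Finset.univ.filter (fun s' => M.layer s' = M.layer s + 1) := by
      intro s' hs'
      by_contra hl
      have hl : M.layer s' ≠ M.layer s + 1 := by simpa using hl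
      have := (Finset.mem_filter.1 hs').2
      simp [M.P_layer _ a _ hl, hoff s' hl] at this
    have hnT : n ≤ T := by
      calc n ≤ ∑ i ∈ Finset.Ico 1 (j + 1), 1 := Finset.sum_le_sum fun i hi =>
            visits_le_one (hx i (Finset.mem_Ico.1 hi).1) s a
        _ = j := by simp
        _ ≤ T := by omega
    have h3 := hdev h2 j (by omega) n hpos hnT B hB
    rw [Deviates, ← hm] at h3
    push Not at h3
    have h3 := h3 rfl
    rw [← Finset.sum_div]
    have e4 : (∑ s' ∈ B, (totalMoves x (j + 1) s a s' : ℝ)) / n - ∑ s' ∈ B, M.P s a s'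
        = (∑ s' ∈ B, (totalMoves x (j + 1) s a s' : ℝ) - n * ∑ s' ∈ B, M.P s a s') / n := by
      field_simp
    rw [e4]
    have e5 := div_le_div_of_nonneg_right h3 hn0.le
    rw [mul_div_cancel_left₀ _ hn0.ne'] at e5
    linarith

end Deterministic

namespace IsUCPDRun

variable {S A ι : Type*} [Fintype S] [Fintype A] [Fintype ι] [DecidableEq S] [DecidableEq A]
  {L : ℕ} {Ξ : ι → Type*} [∀ i, MeasurableSpace (Ξ i)] {Ω : Type*} [mΩ : MeasurableSpace Ω]
  {M : LoopFreeMDP S A L} {T : ℕ} {V α lam ζ : ℝ} {f : ℕ → S × A × S → ℝ}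
  {G : (i : ι) → S × A × S → Ξ i → ℝ} {D : (i : ι) → Measure (Ξ i)} {c : ι → ℝ} {μ : Measure Ω}
  {𝓕 : Filtration ℕ mΩ} {X : ℕ → Ω → Path S A L} {ξ : ℕ → Ω → (i : ι) → Ξ i}
  {θ : ℕ → Ω → S × A × S → ℝ} [∀ i, IsProbabilityMeasure (D i)] [IsProbabilityMeasure μ]

/-- The deviation of the number of moves to `B` for a fixed number `n` of visits. The exponential
supermartingale counts the visits in its compensator, so that a parameter tuned to `n` gives
Hoeffding's bound on the event of exactly `n` visits. -/
lemma measure_deviates_le [Nonempty A] (h : M.IsUCPDRun T V α lam ζ f G D c μ 𝓕 X ξ θ)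
    (hlog : 1 ≤ Real.log (logArg S A T ζ)) {s : S} (hs : M.layer s < L) (a : A) (t : ℕ) {n : ℕ}
    (hn : 1 ≤ n) (B : Finset S) :
    μ {ω | M.Deviates T ζ (fun t => X t ω) s a t n B}
      ≤ ENNReal.ofReal (Real.exp (-(M.layerCard (M.layer s + 1) * Real.log (logArg S A T ζ)))) := by
  set m := M.layerCard (M.layer s + 1) with hm
  have hn0 : (0 : ℝ) < n := by exact_mod_cast hn
  set ε := √(2 * m * Real.log (logArg S A T ζ) / n) with hε
  have hε2 : n * ε ^ 2 = 2 * m * Real.log (logArg S A T ζ) := by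
    rw [hε, Real.sq_sqrt (by positivity)]
    field_simp
  have hε0 : 0 ≤ ε := Real.sqrt_nonneg _
  set q := ∑ s' ∈ B, M.P s a s' with hq
  have hq0 : 0 ≤ q := Finset.sum_nonneg fun _ _ => M.P_nonneg _ _ _
  have hq1 : q ≤ 1 := by
    rw [← M.P_sum s a hs]
    exact Finset.sum_le_sum_of_subset_of_nonneg (Finset.subset_univ _)
      fun _ _ _ => M.P_nonneg _ _ _
  set r := 2 * ε with hr
  set k : Fin L := ⟨M.layer s, hs⟩ with hk
  set y : S × A × S → ℝ := fun e => if e.1 = s ∧ e.2.1 = a then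
    Real.exp (r * ((if e.2.2 ∈ B then 1 else 0) - q) - r ^ 2 / 8) else 1 with hy
  have hy0 : ∀ e, 0 ≤ y e := by
    intro e
    simp only [hy]
    split_ifs <;> positivity
  have hyC : ∀ e, y e ≤ ∑ e', y e' := fun e =>
    Finset.single_le_sum (fun e' _ => hy0 e') (Finset.mem_univ e)
  set Y : ℕ → Ω → ℝ := fun j ω => y (stepAt (X (j + 1) ω) k) with hY
  have hmean : ∑ s', M.P s a s' * y (s, a, s') ≤ 1 := by
    have e1 : ∀ s', M.P s a s' * y (s, a, s') = Real.exp (-(r ^ 2 / 8)) *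
        ((if s' ∈ B then M.P s a s' else 0) * Real.exp (r * (1 - q))
          + (if s' ∈ B then 0 else M.P s a s') * Real.exp (r * (0 - q))) := by
      intro s'
      simp only [hy, and_self, if_true]
      rw [sub_eq_neg_add, Real.exp_add]
      split_ifs <;> ring
    have e2 : ∑ s', (if s' ∈ B then 0 else M.P s a s') = 1 - q := by
      have hq' : q = ∑ s', if s' ∈ B then M.P s a s' else 0 := by
        rw [Finset.sum_ite_mem, Finset.univ_inter]
      rw [← M.P_sum s a hs, hq', ← Finset.sum_sub_distrib]
      refine Finset.sum_congr rfl fun s' _ => ?_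
      split_ifs <;> ring
    rw [Finset.sum_congr rfl fun s' _ => e1 s', ← Finset.mul_sum, Finset.sum_add_distrib,
      ← Finset.sum_mul, ← Finset.sum_mul, e2, Finset.sum_ite_mem, Finset.univ_inter, ← hq]
    calc _ ≤ Real.exp (-(r ^ 2 / 8)) * Real.exp (r ^ 2 / 8) :=
          mul_le_mul_of_nonneg_left (bernoulli_mgf_le hq0 hq1 r) (Real.exp_pos _).le
      _ = 1 := by rw [← Real.exp_add]; simp
  have hYc : ∀ j < t, μ[Y j | 𝓕 (0 + j)] ≤ᵐ[μ] fun _ => 1 := by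
    intro j _
    rw [zero_add]
    have h1 := condExp_comp_finite (𝓕.le j) (h.measurableSet_path j) (h.law_path j)
      (H := fun p _ => y (stepAt p k)) (C := ∑ e', y e') (fun _ => stronglyMeasurable_const)
      (fun p => Filter.Eventually.of_forall fun ω => by
        rw [abs_of_nonneg (hy0 _)]; exact hyC _)
    filter_upwards [h1, h.ae_sum_pathProb j, h.ae_isFlow] with ω e1 e2 e3
    have hπ : ∀ s a, 0 ≤ policyOf (θ (j + 1) ω) s a :=
      policyOf_nonneg (e3 (j + 1) (by omega)).nonneg
    have hπ1 := sum_policyOf_le_one (θ (j + 1) ω)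
    rw [e1, sum_pathProb_mul hπ hπ1 e2, ← sum_stepDist_eq_one hπ hπ1 e2 k, sum_triple, sum_triple]
    refine Finset.sum_le_sum fun s₁ _ => Finset.sum_le_sum fun a₁ _ => ?_
    by_cases hsa : s₁ = s ∧ a₁ = a
    · obtain ⟨rfl, rfl⟩ := hsa
      simp only [stepDist, mul_assoc]
      rw [← Finset.mul_sum, ← Finset.mul_sum, ← Finset.mul_sum, ← Finset.mul_sum,
        M.P_sum s₁ a₁ hs]
      exact mul_le_mul_of_nonneg_left (mul_le_mul_of_nonneg_left hmean (hπ _ _))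
        (stateDist_nonneg hπ _ _)
    · simp [hy, hsa]
  have hYm : ∀ j < t, StronglyMeasurable[𝓕 (0 + j + 1)] (Y j) := by
    intro j _
    refine (h.measurable_of_paths (0 + j + 1) fun ω ω' hω => ?_).stronglyMeasurable
    simp only [hY]
    rw [hω (j + 1) (by omega) (by omega)]
  have key := measure_le_prod (μ := μ) 𝓕 0 t hYm (C := ∑ e', y e')
    (fun j _ => Filter.Eventually.of_forall fun ω => ⟨hy0 _, hyC _⟩) hYc
    (c := Real.exp (m * Real.log (logArg S A T ζ))) (Real.exp_pos _)
  rw [one_div, ← Real.exp_neg] at key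
  refine le_trans (measure_mono_ae ?_) key
  filter_upwards [h.ae_layer_path] with ω hω hdev
  obtain ⟨hd1, hd2⟩ := hdev
  rw [← hm, ← hε] at hd2
  change Real.exp (m * Real.log (logArg S A T ζ)) ≤ ∏ j ∈ Finset.range t, Y j ω
  have hYj : ∀ j, Y j ω = Real.exp (r * (∑ s' ∈ B, (moves (X (j + 1) ω) s a s' : ℝ)
      - (visits (X (j + 1) ω) s a : ℝ) * q) - (visits (X (j + 1) ω) s a : ℝ) * (r ^ 2 / 8)) := by
    intro j
    have hl := hω (j + 1) (by omega)
    simp only [moves_eq_ite hl k (show M.layer s = k from rfl),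
      visits_eq_ite hl k (show M.layer s = k from rfl), hY, hy]
    generalize stepAt (X (j + 1) ω) k = e
    obtain ⟨s₁, a₁, s₂⟩ := e
    by_cases hsa : s₁ = s ∧ a₁ = a
    · obtain ⟨rfl, rfl⟩ := hsa
      simp
    · have : ∀ s', ¬ (s₁ = s ∧ a₁ = a ∧ s₂ = s') := fun s' hh => hsa ⟨hh.1, hh.2.1⟩
      simp [hsa, this]
  have hprod : ∏ j ∈ Finset.range t, Y j ω
      = Real.exp (r * (∑ s' ∈ B, (totalMoves (fun t => X t ω) (t + 1) s a s' : ℝ) - n * q)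
        - n * (r ^ 2 / 8)) := by
    rw [Finset.prod_congr rfl fun j _ => hYj j, ← Real.exp_sum]
    congr 1
    rw [Finset.sum_sub_distrib, ← Finset.mul_sum, ← Finset.sum_mul, Finset.sum_sub_distrib,
      ← Finset.sum_mul, ← hd1]
    simp only [totalMoves, totalVisits, Finset.sum_Ico_eq_sum_range, Nat.add_sub_cancel,
      Nat.cast_sum]
    rw [Finset.sum_comm]
    simp only [add_comm 1]
  rw [hprod]
  refine Real.exp_le_exp.2 ?_
  have e1 : r * (n * (ε / 2)) ≤
      r * (∑ s' ∈ B, (totalMoves (fun t => X t ω) (t + 1) s a s' : ℝ) - n * q) :=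
    mul_le_mul_of_nonneg_left hd2.le (by positivity)
  have e2 : r * (n * (ε / 2)) - n * (r ^ 2 / 8) = m * Real.log (logArg S A T ζ) := by
    rw [hr]
    linear_combination hε2 / 2
  linarith

/-- With probability at least `1 - ζ`, the true model is within all the confidence radii. -/
lemma measure_not_confidence_le (h : M.IsUCPDRun T V α lam ζ f G D c μ 𝓕 X ξ θ)
    (hT : 1 ≤ T) (hS : 1 < Fintype.card S) (hA : 1 < Fintype.card A)
    (hζ : 0 < ζ) (hζ1 : ζ ≤ 1) :
    μ {ω | ¬ ∀ t, 1 ≤ t → t ≤ T + 1 → ∀ s a, M.layer s < L →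
      ∑ s', |M.P s a s' - (Counters.atEpisode (fun t => X t ω) t).empirical s a s'|
        ≤ M.radius T ζ (Counters.atEpisode (fun t => X t ω) t) s a} ≤ ENNReal.ofReal ζ := by
  have hNA : Nonempty A := Fintype.card_pos_iff.1 (by omega)
  have hlog := one_le_log_logArg hT hζ hζ1 hS hA
  have hX8 := card_mul_card_div_le_logArg hT hζ hζ1 hS hA
  set Xi := logArg S A T ζ with hXi
  set W : S → A → ℕ → ℕ → Finset S → Set Ω := fun s a t n B =>
    {ω | M.layer s < L ∧ 2 ≤ M.layerCard (M.layer s + 1) ∧ 1 ≤ n ∧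
      M.Deviates T ζ (fun t => X t ω) s a t n B} with hW
  have h1 : ∀ s a t n, μ (⋃ B ∈ (Finset.univ.filter
      (fun s' => M.layer s' = M.layer s + 1)).powerset, W s a t n B)
      ≤ ENNReal.ofReal ((2 / Xi) ^ 2) := by
    intro s a t n
    by_cases hc : M.layer s < L ∧ 2 ≤ M.layerCard (M.layer s + 1) ∧ 1 ≤ n
    · obtain ⟨hs, hc2, hn⟩ := hc
      refine (measure_biUnion_le_card μ _ _ fun B _ => (measure_mono fun ω hω => ?_).trans
        (h.measure_deviates_le hlog hs a t hn B)).trans (ENNReal.ofReal_le_ofReal ?_)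
      · exact hω.2.2.2
      · rw [Finset.card_powerset]
        change ((2 ^ M.layerCard (M.layer s + 1) : ℕ) : ℝ) * _ ≤ _
        rw [← hXi, ← mul_neg, mul_comm (M.layerCard _ : ℝ), Real.exp_mul, Real.exp_neg,
          Real.exp_log (by linarith), Real.rpow_natCast]
        push_cast
        rw [← mul_pow, ← div_eq_mul_inv]
        exact pow_le_pow_of_le_one (by positivity) (by rw [div_le_one (by linarith)]; linarith) hc2
    · have : (⋃ B ∈ (Finset.univ.filter
        (fun s' => M.layer s' = M.layer s + 1)).powerset, W s a t n B) = ∅ := by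
        simp only [Set.iUnion_eq_empty]
        intro B _
        ext ω
        simp only [hW, Set.mem_ofPred_eq, Set.mem_empty_iff_false, iff_false]
        exact fun hω => hc ⟨hω.1, hω.2.1, hω.2.2.1⟩
      rw [this, measure_empty]
      exact zero_le
  have h2 : ∀ s a t, μ (⋃ n ∈ Finset.range (T + 1), _) ≤ _ := fun s a t =>
    measure_biUnion_le_card μ (Finset.range (T + 1)) _ fun n _ => h1 s a t n
  have h3 : ∀ s a, μ (⋃ t ∈ Finset.range (T + 1), _) ≤ _ := fun s a =>
    measure_biUnion_le_card μ (Finset.range (T + 1)) _ fun t _ => h2 s a t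
  have h4 : ∀ s, μ (⋃ a ∈ (Finset.univ : Finset A), _) ≤ _ := fun s =>
    measure_biUnion_le_card μ Finset.univ _ fun a _ => h3 s a
  have h5 : μ (⋃ s ∈ (Finset.univ : Finset S), _) ≤ _ :=
    measure_biUnion_le_card μ Finset.univ _ fun s _ => h4 s
  refine (measure_mono_ae ?_).trans (h5.trans (ENNReal.ofReal_le_ofReal ?_))
  · filter_upwards [h.ae_layer_path] with ω hω hnot
    by_contra hcon
    refine hnot fun t ht htT s a hs => confidence_of_not_deviates hlog hω hs a ht htT ?_
    intro hc2 t' ht' n hn hnT B hB hdev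
    exact hcon (Set.mem_iUnion₂.2 ⟨s, Finset.mem_univ s, Set.mem_iUnion₂.2 ⟨a, Finset.mem_univ a,
      Set.mem_iUnion₂.2 ⟨t', Finset.mem_range.2 (by omega), Set.mem_iUnion₂.2 ⟨n,
      Finset.mem_range.2 (by omega), Set.mem_iUnion₂.2 ⟨B, Finset.mem_powerset.2 hB,
      hs, hc2, hn, hdev⟩⟩⟩⟩⟩)
  · simp only [Finset.card_univ, Finset.card_range]
    have e1 : (0 : ℝ) < T + 1 := by positivity
    have e2 : (2 : ℝ) ≤ Fintype.card S := by exact_mod_cast hS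
    have e3 : (2 : ℝ) ≤ Fintype.card A := by exact_mod_cast hA
    have e4 : (Fintype.card S : ℝ) * (Fintype.card A * (((T + 1 : ℕ) : ℝ) * (((T + 1 : ℕ) : ℝ) *
        (2 / Xi) ^ 2))) = ζ * (4 * ζ / (Fintype.card S * Fintype.card A)) := by
      rw [hXi, logArg]
      push_cast
      field_simp
      ring
    rw [e4]
    refine mul_le_of_le_one_right hζ.le ?_
    rw [div_le_one (by positivity)]
    nlinarith
end IsUCPDRun

end LoopFreeMDP

end

/-! ### The occupancy error -/

section

namespace LoopFreeMDP

section Deterministic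

variable {S A : Type*} [Fintype S] [Fintype A] {L : ℕ}

lemma layerCard_eq_zero (M : LoopFreeMDP S A L) {k : ℕ} (hk : L < k) : M.layerCard k = 0 := by
  rw [layerCard, Finset.card_eq_zero, Finset.filter_eq_empty_iff]
  intro s _
  have := M.layer_le s
  omega

lemma radius_term (M : LoopFreeMDP S A L) (T : ℕ) (ζ : ℝ) (K : Counters S A) (a : A) :
    M.radius T ζ K M.term a = 0 := by
  rw [radius, (M.layer_eq_last_iff M.term).2 rfl, M.layerCard_eq_zero (Nat.lt_succ_self L)]
  simp

lemma radius_nonneg (M : LoopFreeMDP S A L) (T : ℕ) (ζ : ℝ) (K : Counters S A) (s : S) (a : A) :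
    0 ≤ M.radius T ζ K s a := Real.sqrt_nonneg _

lemma radius_eq_mul (M : LoopFreeMDP S A L) {T : ℕ} {ζ : ℝ}
    (K : Counters S A) (s : S) (a : A) :
    M.radius T ζ K s a = √(2 * Real.log (logArg S A T ζ)) * √(M.layerCard (M.layer s + 1)) *
      (1 / √((max 1 (K.N s a) : ℕ) : ℝ)) := by
  rw [radius_eq, Real.sqrt_div' _ (by positivity), mul_right_comm, Real.sqrt_mul' _ (by positivity),
    mul_one_div]

lemma radius_le (M : LoopFreeMDP S A L) {T : ℕ} {ζ : ℝ} (K : Counters S A) (s : S) (a : A) :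
    M.radius T ζ K s a
      ≤ √(2 * Real.log (logArg S A T ζ)) * M.layerCard (M.layer s + 1) := by
  rw [radius_eq_mul, mul_assoc]
  refine mul_le_mul_of_nonneg_left ?_ (Real.sqrt_nonneg _)
  have h1 : √(M.layerCard (M.layer s + 1) : ℝ) ≤ M.layerCard (M.layer s + 1) := by
    rw [Real.sqrt_le_left (by positivity)]
    have : M.layerCard (M.layer s + 1) ≤ M.layerCard (M.layer s + 1) ^ 2 :=
      Nat.le_self_pow two_ne_zero _
    exact_mod_cast this
  have h2 : (1 : ℝ) / √((max 1 (K.N s a) : ℕ) : ℝ) ≤ 1 := by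
    have e1 : (1 : ℝ) ≤ ((max 1 (K.N s a) : ℕ) : ℝ) := by exact_mod_cast le_max_left _ _
    have e2 : 1 ≤ √((max 1 (K.N s a) : ℕ) : ℝ) := Real.one_le_sqrt.2 e1
    rw [div_le_one (by linarith)]
    exact e2
  calc _ ≤ √(M.layerCard (M.layer s + 1) : ℝ) * 1 :=
        mul_le_mul_of_nonneg_left h2 (Real.sqrt_nonneg _)
    _ ≤ _ := by rw [mul_one]; exact h1

lemma sum_layerCard_succ_le (M : LoopFreeMDP S A L) :
    ∑ k ∈ Finset.range L, (M.layerCard (k + 1) : ℝ) ≤ Fintype.card S := by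
  have h1 := M.sum_layerCard
  rw [Finset.sum_range_succ'] at h1
  have h2 : ∑ k ∈ Finset.range L, M.layerCard (k + 1) ≤ Fintype.card S := by omega
  exact_mod_cast h2

lemma sum_layerCard_le (M : LoopFreeMDP S A L) :
    ∑ k ∈ Finset.range L, (M.layerCard k : ℝ) ≤ Fintype.card S := by
  have h1 := M.sum_layerCard
  rw [Finset.sum_range_succ] at h1
  have h2 : ∑ k ∈ Finset.range L, M.layerCard k ≤ Fintype.card S := by omega
  exact_mod_cast h2

variable [DecidableEq S]

lemma expectedWidth_nonneg {M : LoopFreeMDP S A L} {π w : S → A → ℝ} (hπ : ∀ s a, 0 ≤ π s a)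
    (hw : ∀ s a, 0 ≤ w s a) : 0 ≤ M.expectedWidth π w :=
  Finset.sum_nonneg fun k _ => Finset.sum_nonneg fun s _ => Finset.sum_nonneg fun a _ =>
    mul_nonneg (mul_nonneg (stateDist_nonneg hπ k s) (hπ s a)) (hw s a)

lemma expectedWidth_radius_le {M : LoopFreeMDP S A L} {π : S → A → ℝ} (hπ : ∀ s a, 0 ≤ π s a)
    (hπ1 : ∀ s, ∑ a, π s a ≤ 1) {T : ℕ} {ζ : ℝ} (K : Counters S A) :
    M.expectedWidth π (M.radius T ζ K)
      ≤ √(2 * Real.log (logArg S A T ζ)) * Fintype.card S := by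
  set q := √(2 * Real.log (logArg S A T ζ)) with hq
  calc M.expectedWidth π (M.radius T ζ K)
      ≤ ∑ k ∈ Finset.range L, q * M.layerCard (k + 1) := by
        refine Finset.sum_le_sum fun k _ => ?_
        calc ∑ s, ∑ a, M.stateDist π k s * π s a * M.radius T ζ K s a
            ≤ ∑ s, M.stateDist π k s * (q * M.layerCard (k + 1)) := by
              refine Finset.sum_le_sum fun s _ => ?_
              by_cases hs : M.layer s = k
              · have h0 := stateDist_nonneg (M := M) hπ k s
                calc ∑ a, M.stateDist π k s * π s a * M.radius T ζ K s a
                    ≤ ∑ a, M.stateDist π k s * π s a * (q * M.layerCard (k + 1)) := by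
                      refine Finset.sum_le_sum fun a _ =>
                        mul_le_mul_of_nonneg_left ?_ (mul_nonneg h0 (hπ s a))
                      have := M.radius_le (T := T) (ζ := ζ) K s a
                      rwa [hs] at this
                  _ = M.stateDist π k s * (q * M.layerCard (k + 1)) * ∑ a, π s a := by
                      rw [Finset.mul_sum]
                      exact Finset.sum_congr rfl fun a _ => by ring
                  _ ≤ _ := mul_le_of_le_one_right (mul_nonneg h0 (by positivity)) (hπ1 s)
              · simp [stateDist_eq_zero hs]
          _ = (∑ s, M.stateDist π k s) * (q * M.layerCard (k + 1)) := by rw [Finset.sum_mul]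
          _ ≤ _ := mul_le_of_le_one_left (by positivity) (sum_stateDist_le_one hπ hπ1 k)
    _ = q * ∑ k ∈ Finset.range L, (M.layerCard (k + 1) : ℝ) := by rw [Finset.mul_sum]
    _ ≤ _ := mul_le_mul_of_nonneg_left M.sum_layerCard_succ_le (Real.sqrt_nonneg _)

lemma sum_path_radius_le {M : LoopFreeMDP S A L} {p : Path S A L}
    (hp : ∀ k : Fin (L + 1), M.layer (p.1 k) = k) {T : ℕ} {ζ : ℝ} (K : Counters S A) :
    ∑ k : Fin L, M.radius T ζ K (p.1 k.castSucc) (p.2 k)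
      ≤ √(2 * Real.log (logArg S A T ζ)) * Fintype.card S := by
  calc ∑ k : Fin L, M.radius T ζ K (p.1 k.castSucc) (p.2 k)
      ≤ ∑ k : Fin L, √(2 * Real.log (logArg S A T ζ)) * M.layerCard ((k : ℕ) + 1) := by
        refine Finset.sum_le_sum fun k _ => ?_
        have := M.radius_le (T := T) (ζ := ζ) K (p.1 k.castSucc) (p.2 k)
        rwa [hp] at this
    _ = √(2 * Real.log (logArg S A T ζ)) * ∑ k ∈ Finset.range L, (M.layerCard (k + 1) : ℝ) := by
        rw [Finset.mul_sum, Finset.sum_range]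
    _ ≤ _ := mul_le_mul_of_nonneg_left M.sum_layerCard_succ_le (Real.sqrt_nonneg _)

variable [DecidableEq A]

/-- The widths along the sampled paths sum up to `O(|S| √(|A| T log))`: within each layer this is
the Cauchy-Schwarz inequality, since a path visits every layer once. -/
lemma sum_sum_path_radius_le {M : LoopFreeMDP S A L} {x : ℕ → Path S A L} {T : ℕ} {ζ : ℝ}
    (hx : ∀ t, 1 ≤ t → ∀ k : Fin (L + 1), M.layer ((x t).1 k) = k) :
    ∑ t ∈ Finset.Icc 1 T, ∑ k : Fin L,
        M.radius T ζ (Counters.atEpisode x t) ((x t).1 k.castSucc) ((x t).2 k)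
      ≤ 2 * √2 * √(2 * Real.log (logArg S A T ζ)) * (Fintype.card S * √(T * Fintype.card A)) := by
  set q := √(2 * Real.log (logArg S A T ζ)) with hq
  have hq0 : 0 ≤ q := Real.sqrt_nonneg _
  set C : S → A → ℝ := fun s a => totalVisits x (T + 1) s a with hC
  have h1 : ∑ t ∈ Finset.Icc 1 T, ∑ k : Fin L,
        M.radius T ζ (Counters.atEpisode x t) ((x t).1 k.castSucc) ((x t).2 k)
      ≤ ∑ s, ∑ a, q * √(M.layerCard (M.layer s + 1)) * (2 * √2 * √(C s a)) := by
    simp only [sum_path_eq_sum_visits]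
    rw [Finset.sum_comm]
    refine Finset.sum_le_sum fun s _ => ?_
    rw [Finset.sum_comm]
    refine Finset.sum_le_sum fun a _ => ?_
    have e1 := Counters.sum_visits_div_sqrt_le x s a T fun t ht _ => visits_le_one (hx t ht) s a
    calc _ = q * √(M.layerCard (M.layer s + 1)) * ∑ t ∈ Finset.Icc 1 T, (visits (x t) s a : ℝ) *
          (1 / √((max 1 ((Counters.atEpisode x t).N s a) : ℕ) : ℝ)) := by
          rw [Finset.mul_sum]
          refine Finset.sum_congr rfl fun t _ => ?_
          rw [radius_eq_mul, ← hq]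
          ring
      _ ≤ _ := mul_le_mul_of_nonneg_left e1 (by positivity)
  have hvis : ∀ k, ∑ s with M.layer s = k, ∑ a, C s a ≤ T := by
    intro k
    have e1 : ∀ t, 1 ≤ t → ∑ s with M.layer s = k, ∑ a, (visits (x t) s a : ℝ) ≤ 1 := by
      intro t ht
      have e2 := sum_path_eq_sum_visits (x t) fun s _ => if M.layer s = k then (1 : ℝ) else 0
      have e3 : ∑ s with M.layer s = k, ∑ a, (visits (x t) s a : ℝ)
          = ∑ s, ∑ a, (visits (x t) s a : ℝ) * if M.layer s = k then (1 : ℝ) else 0 := by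
        rw [Finset.sum_filter]
        refine Finset.sum_congr rfl fun s _ => ?_
        split_ifs <;> simp
      rw [e3, ← e2]
      simp only [hx t ht, Fin.val_castSucc]
      rw [Finset.sum_boole]
      have : (Finset.univ.filter fun j : Fin L => (j : ℕ) = k).card ≤ 1 :=
        Finset.card_le_one.2 fun i hi j hj => Fin.ext
          ((Finset.mem_filter.1 hi).2.trans (Finset.mem_filter.1 hj).2.symm)
      exact_mod_cast this
    calc ∑ s with M.layer s = k, ∑ a, C s a
        = ∑ t ∈ Finset.Ico 1 (T + 1), ∑ s with M.layer s = k, ∑ a, (visits (x t) s a : ℝ) := by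
          simp only [hC, totalVisits, Nat.cast_sum]
          conv_rhs => rw [Finset.sum_comm]
          refine Finset.sum_congr rfl fun s _ => ?_
          conv_rhs => rw [Finset.sum_comm]
      _ ≤ ∑ t ∈ Finset.Ico 1 (T + 1), 1 :=
          Finset.sum_le_sum fun t ht => e1 t (Finset.mem_Ico.1 ht).1
      _ = T := by simp
  have hCterm : ∀ a, C M.term a = 0 := by
    intro a
    simp only [hC, totalVisits, Nat.cast_eq_zero]
    exact Finset.sum_eq_zero fun t ht => visits_term (hx t (Finset.mem_Ico.1 ht).1) a
  have h2 : ∑ s, ∑ a, √(M.layerCard (M.layer s + 1) : ℝ) * √(C s a)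
      ≤ Fintype.card S * √(T * Fintype.card A) := by
    rw [M.sum_eq_sum_layers _ (by simp [hCterm])]
    calc _ ≤ ∑ k ∈ Finset.range L, √(T * Fintype.card A) *
          (((M.layerCard k : ℝ) + M.layerCard (k + 1)) / 2) := by
          refine Finset.sum_le_sum fun k _ => ?_
          have e1 : ∑ s with M.layer s = k, ∑ a, √(M.layerCard (M.layer s + 1) : ℝ) * √(C s a)
              = ∑ sa ∈ (Finset.univ.filter fun s => M.layer s = k) ×ˢ (Finset.univ : Finset A),
                √(M.layerCard (k + 1) : ℝ) * √(C sa.1 sa.2) := by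
            rw [Finset.sum_product]
            refine Finset.sum_congr rfl fun s hs => ?_
            rw [(Finset.mem_filter.1 hs).2]
          rw [e1]
          refine (Real.sum_sqrt_mul_sqrt_le (f := fun _ => (M.layerCard (k + 1) : ℝ))
            (g := fun sa : S × A => C sa.1 sa.2) _ (fun _ => Nat.cast_nonneg _)
            (fun _ => Nat.cast_nonneg _)).trans ?_
          have e2 : ∑ sa ∈ (Finset.univ.filter fun s => M.layer s = k) ×ˢ (Finset.univ : Finset A),
              (M.layerCard (k + 1) : ℝ) = M.layerCard k * M.layerCard (k + 1) * Fintype.card A := by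
            rw [Finset.sum_const, Finset.card_product, nsmul_eq_mul, Finset.card_univ]
            change ((M.layerCard k * Fintype.card A : ℕ) : ℝ) * _ = _
            push_cast
            ring
          have e3 : ∑ sa ∈ (Finset.univ.filter fun s => M.layer s = k) ×ˢ (Finset.univ : Finset A),
              C sa.1 sa.2 ≤ T := by
            rw [Finset.sum_product]
            exact hvis k
          rw [e2]
          calc _ ≤ √(M.layerCard k * M.layerCard (k + 1) * Fintype.card A) * √(T : ℝ) :=
                mul_le_mul_of_nonneg_left (Real.sqrt_le_sqrt e3) (Real.sqrt_nonneg _)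
            _ = √(T * Fintype.card A) * √(M.layerCard k * M.layerCard (k + 1)) := by
                rw [← Real.sqrt_mul (by positivity), ← Real.sqrt_mul (by positivity)]
                congr 1
                ring
            _ ≤ _ := by
                refine mul_le_mul_of_nonneg_left ?_ (Real.sqrt_nonneg _)
                rw [Real.sqrt_le_left (by positivity)]
                nlinarith [sq_nonneg ((M.layerCard k : ℝ) - M.layerCard (k + 1))]
      _ = √(T * Fintype.card A) * ((∑ k ∈ Finset.range L, (M.layerCard k : ℝ)
            + ∑ k ∈ Finset.range L, (M.layerCard (k + 1) : ℝ)) / 2) := by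
          rw [← Finset.mul_sum, ← Finset.sum_div, Finset.sum_add_distrib]
      _ ≤ √(T * Fintype.card A) * Fintype.card S := by
          refine mul_le_mul_of_nonneg_left ?_ (Real.sqrt_nonneg _)
          linarith [M.sum_layerCard_le, M.sum_layerCard_succ_le]
      _ = _ := mul_comm _ _
  calc _ ≤ _ := h1
    _ = 2 * √2 * q * ∑ s, ∑ a, √(M.layerCard (M.layer s + 1) : ℝ) * √(C s a) := by
        simp only [Finset.mul_sum]
        exact Finset.sum_congr rfl fun s _ => Finset.sum_congr rfl fun a _ => by ring
    _ ≤ _ := mul_le_mul_of_nonneg_left h2 (by positivity)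

end Deterministic

namespace IsUCPDRun

variable {S A ι : Type*} [Fintype S] [Fintype A] [Fintype ι] [DecidableEq S] [DecidableEq A]
  {L : ℕ} {Ξ : ι → Type*} [∀ i, MeasurableSpace (Ξ i)] {Ω : Type*} [mΩ : MeasurableSpace Ω]
  {M : LoopFreeMDP S A L} {T : ℕ} {V α lam ζ : ℝ} {f : ℕ → S × A × S → ℝ}
  {G : (i : ι) → S × A × S → Ξ i → ℝ} {D : (i : ι) → Measure (Ξ i)} {c : ι → ℝ} {μ : Measure Ω}
  {𝓕 : Filtration ℕ mΩ} {X : ℕ → Ω → Path S A L} {ξ : ℕ → Ω → (i : ι) → Ξ i}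
  {θ : ℕ → Ω → S × A × S → ℝ} [∀ i, IsProbabilityMeasure (D i)] [IsProbabilityMeasure μ]

/-- With probability at least `1 - ζ`, the expected widths sum up to
`O(|S| √(T |A|) log)`: up to a martingale, they are the widths along the sampled paths. -/
lemma measure_expectedWidth_le (h : M.IsUCPDRun T V α lam ζ f G D c μ 𝓕 X ξ θ)
    (hT : 1 ≤ T) (hS : 1 < Fintype.card S) (hA : 1 < Fintype.card A)
    (hζ : 0 < ζ) (hζ1 : ζ < 1) :
    μ {ω | ¬ ∑ t ∈ Finset.Icc 1 T, M.expectedWidth (policyOf (θ t ω))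
        (M.radius T ζ (Counters.atEpisode (fun t => X t ω) t))
      ≤ 6 * (Fintype.card S * √(T * Fintype.card A)) * Real.log (logArg S A T ζ)}
      ≤ ENNReal.ofReal ζ := by
  have hNA : Nonempty A := Fintype.card_pos_iff.1 (by omega)
  have hlog := one_le_log_logArg hT hζ hζ1.le hS hA
  set q := √(2 * Real.log (logArg S A T ζ)) with hq
  have hq0 : 0 < q := Real.sqrt_pos.2 (by linarith)
  have hSpos : (0 : ℝ) < Fintype.card S := by exact_mod_cast (by omega : 0 < Fintype.card S)
  have hA1 : (1 : ℝ) ≤ Fintype.card A := by exact_mod_cast hA.le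
  have hT1 : (1 : ℝ) ≤ T := by exact_mod_cast hT
  set w : ℕ → Ω → S → A → ℝ := fun j ω =>
    M.radius T ζ (Counters.atEpisode (fun t => X t ω) (j + 1)) with hw
  set E : ℕ → Ω → ℝ := fun j ω => M.expectedWidth (policyOf (θ (j + 1) ω)) (w j ω) with hE
  set Dm : ℕ → Ω → ℝ := fun j ω =>
    E j ω - ∑ k : Fin L, w j ω ((X (j + 1) ω).1 k.castSucc) ((X (j + 1) ω).2 k) with hDm
  have hwm : ∀ j s a, Measurable[𝓕 j] fun ω => w j ω s a := by
    intro j s a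
    refine h.measurable_of_paths j fun ω ω' hω => ?_
    simp only [hw]
    rw [Counters.atEpisode_congr (x := fun t => X t ω) (y := fun t => X t ω')
      fun i hi hi' => hω i hi (by omega)]
  have hEm : ∀ j, Measurable[𝓕 j] (E j) := by
    intro j
    have hθ := h.measurable_occ j
    simp only [hE, expectedWidth]
    refine Finset.measurable_sum _ fun k _ => Finset.measurable_sum _ fun s _ =>
      Finset.measurable_sum _ fun a _ => ?_
    exact (((M.measurable_stateDist k s).comp hθ).mul ((measurable_policyOf s a).comp hθ)).mul
      (hwm j s a)
  have hEb : ∀ j, ∀ᵐ ω ∂μ, 0 ≤ E j ω ∧ E j ω ≤ q * Fintype.card S := by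
    intro j
    filter_upwards [h.ae_isFlow] with ω hω
    have hπ : ∀ s a, 0 ≤ policyOf (θ (j + 1) ω) s a :=
      policyOf_nonneg (hω (j + 1) (by omega)).nonneg
    exact ⟨expectedWidth_nonneg hπ fun s a => M.radius_nonneg _ _ _ _ _,
      expectedWidth_radius_le hπ (sum_policyOf_le_one _) _⟩
  have hDmm : ∀ j < T, StronglyMeasurable[𝓕 (0 + j + 1)] (Dm j) := by
    intro j _
    rw [zero_add]
    refine (((hEm j).mono (𝓕.mono (by omega)) le_rfl).sub
      (h.measurable_of_paths (j + 1) fun ω ω' hω => ?_)).stronglyMeasurable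
    simp only [hw]
    rw [hω (j + 1) (by omega) le_rfl, Counters.atEpisode_congr (x := fun t => X t ω)
      (y := fun t => X t ω') fun i hi hi' => hω i hi (by omega)]
  have hDmb : ∀ j < T, ∀ᵐ ω ∂μ, |Dm j ω| ≤ q * Fintype.card S := by
    intro j _
    filter_upwards [hEb j, h.ae_layer_path] with ω h1 h2
    have e1 := sum_path_radius_le (T := T) (ζ := ζ) (h2 (j + 1) (by omega))
      (Counters.atEpisode (fun t => X t ω) (j + 1))
    have e2 : 0 ≤ ∑ k : Fin L, w j ω ((X (j + 1) ω).1 k.castSucc) ((X (j + 1) ω).2 k) :=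
      Finset.sum_nonneg fun k _ => M.radius_nonneg _ _ _ _ _
    simp only [hDm]
    rw [abs_le]
    constructor
    · linarith [h1.1]
    · linarith [h1.2]
  have hDmc : ∀ j < T, μ[Dm j | 𝓕 (0 + j)] ≤ᵐ[μ] fun _ => 0 := by
    intro j _
    rw [zero_add]
    have hHm : ∀ p : Path S A L, StronglyMeasurable[𝓕 j] fun ω =>
        E j ω - ∑ k : Fin L, w j ω (p.1 k.castSucc) (p.2 k) := fun p =>
      ((hEm j).sub (Finset.measurable_sum _ fun k _ => hwm j _ _)).stronglyMeasurable
    have hHb : ∀ p : Path S A L, ∀ᵐ ω ∂μ,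
        |E j ω - ∑ k : Fin L, w j ω (p.1 k.castSucc) (p.2 k)|
          ≤ q * Fintype.card S + L * (q * Fintype.card S) := by
      intro p
      filter_upwards [hEb j] with ω h1
      have e2 : 0 ≤ ∑ k : Fin L, w j ω (p.1 k.castSucc) (p.2 k) :=
        Finset.sum_nonneg fun k _ => M.radius_nonneg _ _ _ _ _
      have e3 : ∑ k : Fin L, w j ω (p.1 k.castSucc) (p.2 k) ≤ L * (q * Fintype.card S) := by
        calc _ ≤ ∑ k : Fin L, q * Fintype.card S := by
              refine Finset.sum_le_sum fun k _ => (M.radius_le _ _ _).trans ?_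
              exact mul_le_mul_of_nonneg_left (by exact_mod_cast M.layerCard_le _) hq0.le
          _ = _ := by simp
      have e4 : 0 ≤ q * Fintype.card S := by positivity
      rw [abs_le]
      constructor
      · linarith [h1.1]
      · linarith [h1.2, mul_nonneg (Nat.cast_nonneg (α := ℝ) L) e4]
    have h1 := condExp_comp_finite (𝓕.le j) (h.measurableSet_path j) (h.law_path j) hHm hHb
    filter_upwards [h1, h.ae_sum_pathProb j, h.ae_isFlow] with ω e1 e2 e3
    have hπ : ∀ s a, 0 ≤ policyOf (θ (j + 1) ω) s a :=
      policyOf_nonneg (e3 (j + 1) (by omega)).nonneg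
    refine (e1.trans ?_).le
    simp only [mul_sub, Finset.sum_sub_distrib]
    rw [← Finset.sum_mul, e2, one_mul, sum_pathProb_mul_width hπ (sum_policyOf_le_one _) e2 _
      fun a => M.radius_term _ _ _ _]
    exact sub_self _
  have key := azuma_sqrt (μ := μ) 𝓕 0 (by omega : 0 < T) (show 0 < q * Fintype.card S by positivity)
    hζ hζ1 hDmm hDmb hDmc
  refine le_trans (measure_mono_ae ?_) key
  filter_upwards [h.ae_layer_path] with ω hω hnot
  change q * Fintype.card S * √(2 * T * Real.log (1 / ζ)) ≤ ∑ j ∈ Finset.range T, Dm j ω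
  by_contra hcon
  refine hnot ?_
  push Not at hcon
  have e1 := sum_sum_path_radius_le (T := T) (ζ := ζ) (x := fun t => X t ω) hω
  have hIcc : ∀ F : ℕ → ℝ, ∑ t ∈ Finset.Icc 1 T, F t = ∑ j ∈ Finset.range T, F (j + 1) := by
    intro F
    rw [← Finset.Ico_add_one_right_eq_Icc, Finset.sum_Ico_eq_sum_range]
    simp [add_comm]
  rw [hIcc] at e1 ⊢
  simp only [hDm, hE, hw, Finset.sum_sub_distrib] at hcon
  have e2 : Real.log (1 / ζ) ≤ Real.log (logArg S A T ζ) := by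
    refine Real.log_le_log (by positivity) ?_
    rw [logArg]
    refine div_le_div_of_nonneg_right ?_ hζ.le
    have : (1 : ℝ) ≤ Fintype.card S := by exact_mod_cast hS.le
    have h3 : (1 : ℝ) * 1 ≤ ((T : ℝ) + 1) * Fintype.card S := by nlinarith
    nlinarith
  set l := Real.log (logArg S A T ζ) with hl
  have e3 : √(2 * T * Real.log (1 / ζ)) ≤ q * √(T * Fintype.card A) := by
    rw [hq, ← Real.sqrt_mul (by positivity)]
    refine Real.sqrt_le_sqrt ?_
    calc 2 * T * Real.log (1 / ζ) ≤ 2 * T * l := by gcongr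
      _ ≤ 2 * T * l * Fintype.card A := le_mul_of_one_le_right (by positivity) hA1
      _ = _ := by ring
  have e4 : q * q = 2 * l := Real.mul_self_sqrt (by linarith)
  have e5 : √2 * q ≤ 2 * l := by
    rw [hq, ← Real.sqrt_mul (by norm_num), Real.sqrt_le_left (by linarith)]
    nlinarith
  set P := Fintype.card S * √(T * Fintype.card A) with hP
  have hP0 : 0 ≤ P := by positivity
  have e6 : q * Fintype.card S * √(2 * T * Real.log (1 / ζ)) ≤ 2 * l * P := by
    calc _ ≤ q * Fintype.card S * (q * √(T * Fintype.card A)) :=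
          mul_le_mul_of_nonneg_left e3 (by positivity)
      _ = q * q * P := by rw [hP]; ring
      _ = _ := by rw [e4]
  have e7 : 2 * √2 * q * P ≤ 4 * l * P := by
    refine mul_le_mul_of_nonneg_right ?_ hP0
    linarith
  linarith

end IsUCPDRun

end LoopFreeMDP

end

/-! ### The dual multipliers and the drift inequality along a path -/

section

section Norm

variable {ι : Type*} [Fintype ι]

/-- The Euclidean norm of a vector of multipliers. -/
def vecNorm (v : ι → ℝ) : ℝ := ‖(WithLp.toLp 2 v : EuclideanSpace ℝ ι)‖

lemma vecNorm_nonneg (v : ι → ℝ) : 0 ≤ vecNorm v := norm_nonneg _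

lemma vecNorm_sq (v : ι → ℝ) : vecNorm v ^ 2 = ∑ i, v i ^ 2 := by
  rw [vecNorm, EuclideanSpace.real_norm_sq_eq]

lemma vecNorm_zero : vecNorm (fun _ : ι => (0 : ℝ)) = 0 := by
  have h := vecNorm_sq (fun _ : ι => (0 : ℝ))
  simpa using h

lemma abs_le_vecNorm (v : ι → ℝ) (i : ι) : |v i| ≤ vecNorm v := by
  rw [← sq_le_sq₀ (abs_nonneg _) (vecNorm_nonneg v), vecNorm_sq, sq_abs]
  exact Finset.single_le_sum (f := fun i => v i ^ 2) (fun _ _ => sq_nonneg _) (Finset.mem_univ i)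

lemma vecNorm_le_sum_abs (v : ι → ℝ) : vecNorm v ≤ ∑ i, |v i| := by
  have h0 : 0 ≤ ∑ i, |v i| := Finset.sum_nonneg fun _ _ => abs_nonneg _
  rw [← sq_le_sq₀ (vecNorm_nonneg v) h0, vecNorm_sq, sq (∑ i, |v i|), Finset.sum_mul]
  refine Finset.sum_le_sum fun i _ => ?_
  rw [← sq_abs, sq]
  exact mul_le_mul_of_nonneg_left (Finset.single_le_sum (f := fun i => |v i|)
    (fun _ _ => abs_nonneg _) (Finset.mem_univ i)) (abs_nonneg _)

lemma vecNorm_add_le (v w : ι → ℝ) : vecNorm (fun i => v i + w i) ≤ vecNorm v + vecNorm w :=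
  norm_add_le (WithLp.toLp 2 v : EuclideanSpace ℝ ι) (WithLp.toLp 2 w)

lemma vecNorm_mono {v w : ι → ℝ} (h0 : ∀ i, 0 ≤ v i) (h : ∀ i, v i ≤ w i) :
    vecNorm v ≤ vecNorm w := by
  rw [← sq_le_sq₀ (vecNorm_nonneg v) (vecNorm_nonneg w), vecNorm_sq, vecNorm_sq]
  exact Finset.sum_le_sum fun i _ => pow_le_pow_left₀ (h0 i) (h i) 2

lemma abs_sum_mul_le (v w : ι → ℝ) : |∑ i, v i * w i| ≤ vecNorm v * ∑ i, |w i| := by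
  rw [Finset.mul_sum]
  refine (Finset.abs_sum_le_sum_abs _ _).trans (Finset.sum_le_sum fun i _ => ?_)
  rw [abs_mul]
  exact mul_le_mul_of_nonneg_right (abs_le_vecNorm v i) (abs_nonneg _)

end Norm

variable {S A ι : Type*} [Fintype S] [Fintype A] [Fintype ι] {L : ℕ}

section Multiplier

variable {g : ℕ → ι → S × A × S → ℝ} {c : ι → ℝ} {θ : ℕ → S × A × S → ℝ}

lemma multiplier_succ {t : ℕ} (ht : 1 ≤ t) (i : ι) : multiplier g c θ (t + 1) i
    = max (multiplier g c θ t i + (pairing (g t i) (θ (t + 1)) - c i)) 0 := by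
  obtain ⟨t, rfl⟩ : ∃ k, t = k + 1 := ⟨t - 1, by omega⟩
  rw [← add_sub_assoc]
  rfl

lemma multiplier_nonneg (t : ℕ) (i : ι) : 0 ≤ multiplier g c θ t i := by
  match t with
  | 0 => exact le_rfl
  | 1 => exact le_rfl
  | t + 2 => exact le_max_right _ _

lemma vecNorm_multiplier_one : vecNorm (multiplier g c θ 1) = 0 := vecNorm_zero

end Multiplier

variable [DecidableEq S] [DecidableEq A]

/-- The properties of a path of the algorithm on the event that the true model lies in all the
confidence sets; `V = L √T`, `α = L T`, `λ = 1 / T`. -/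
structure GoodPath (M : LoopFreeMDP S A L) (T : ℕ) (ζ : ℝ) (f : ℕ → S × A × S → ℝ)
    (g : ℕ → ι → S × A × S → ℝ) (c : ι → ℝ) (x : ℕ → Path S A L) (θ : ℕ → S × A × S → ℝ) :
    Prop where
  card_states : 1 < Fintype.card S
  card_actions : 1 < Fintype.card A
  card_le : Fintype.card S * Fintype.card A ≤ T
  loss : ∀ t, 1 ≤ t → t ≤ T → ∀ e, |f t e| ≤ 1
  constraint : ∀ t, 1 ≤ t → ∑ i, ⨆ e, |g t i e| ≤ 1
  level : ∑ i, |c i| ≤ L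
  seq : M.IsUCPDSequence T (L * √T) (L * T) (1 / T) ζ f g c x θ
  layered : ∀ t, 1 ≤ t → ∀ k : Fin (L + 1), M.layer ((x t).1 k) = k
  isFlow : ∀ t, 1 ≤ t → M.IsFlow (θ t)
  confidence : ∀ t, 1 ≤ t → t ≤ T + 1 → ∀ s a, M.layer s < L →
    ∑ s', |M.P s a s' - (Counters.atEpisode x t).empirical s a s'|
      ≤ M.radius T ζ (Counters.atEpisode x t) s a

/-- In a quadratic inequality for `d`, either the linear or the constant part dominates. -/
lemma le_of_quadratic_le {H d s l T : ℝ} (hl : 0 ≤ l) (hH : 0 ≤ H) (hd : 0 ≤ d) (hs : 1 ≤ s)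
    (hT : s ^ 2 = T) (h : T / 4 * d ^ 2 ≤ H * (d + 2 * l / T) + 2 * l ^ 2) :
    d ≤ 8 * H / T + 5 * l / s := by
  have hs0 : 0 < s := by linarith
  obtain ⟨a, rfl⟩ : ∃ a, H = a * s ^ 2 := ⟨H / s ^ 2, by field_simp⟩
  obtain ⟨b, rfl⟩ : ∃ b, l = b * s := ⟨l / s, by field_simp⟩
  have ha : 0 ≤ a := nonneg_of_mul_nonneg_left hH (by positivity)
  have hb : 0 ≤ b := nonneg_of_mul_nonneg_left hl hs0
  subst hT
  have e1 : 8 * (a * s ^ 2) / s ^ 2 + 5 * (b * s) / s = 8 * a + 5 * b := by field_simp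
  rw [e1]
  have e2 : a * s ^ 2 * (d + 2 * (b * s) / s ^ 2) = s ^ 2 * (a * d) + 2 * (a * b) * s := by
    field_simp
  rw [e2] at h
  have e3 : 2 * (a * b) * s ≤ 2 * (a * b) * s ^ 2 :=
    mul_le_mul_of_nonneg_left (by nlinarith) (by positivity)
  have e4 : s ^ 2 * (d ^ 2 / 4) ≤ s ^ 2 * (a * d + 2 * (a * b) + 2 * b ^ 2) := by linarith
  have e5 := le_of_mul_le_mul_left e4 (by positivity)
  by_contra! hcon
  have e6 := mul_le_mul_of_nonneg_right hcon.le hd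
  have e7 := mul_le_mul_of_nonneg_left hcon.le ha
  have e8 := mul_le_mul_of_nonneg_left hcon.le hb
  have e9 : 0 < d := by nlinarith
  have e10 := mul_lt_mul_of_pos_right hcon e9
  nlinarith [mul_nonneg ha hb, sq_nonneg a, sq_nonneg b]

namespace GoodPath

variable {M : LoopFreeMDP S A L} {T : ℕ} {ζ : ℝ} {f : ℕ → S × A × S → ℝ}
  {g : ℕ → ι → S × A × S → ℝ} {c : ι → ℝ} {x : ℕ → Path S A L} {θ : ℕ → S × A × S → ℝ}

lemma nonempty_actions (h : GoodPath M T ζ f g c x θ) : Nonempty A :=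
  Fintype.card_pos_iff.1 (by have := h.card_actions; omega)

lemma four_le (h : GoodPath M T ζ f g c x θ) : 4 ≤ T := by
  have := Nat.mul_le_mul h.card_states h.card_actions
  have := h.card_le
  omega

lemma one_le_length (h : GoodPath M T ζ f g c x θ) : (1 : ℝ) ≤ L := by
  have := M.length_pos h.card_states
  exact_mod_cast this

lemma sum_abs_sub_level_le (h : GoodPath M T ζ f g c x θ) {t : ℕ} (ht : 1 ≤ t)
    {z : S × A × S → ℝ} (hz : M.IsFlow z) : ∑ i, |pairing (g t i) z - c i| ≤ 2 * L := by
  calc ∑ i, |pairing (g t i) z - c i| ≤ ∑ i, (|pairing (g t i) z| + |c i|) :=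
        Finset.sum_le_sum fun i _ => abs_sub _ _
    _ ≤ L + L := by
        rw [Finset.sum_add_distrib]
        refine add_le_add ?_ h.level
        rw [← hz.l1Norm_eq]
        exact sum_abs_pairing_le z (h.constraint t ht)
    _ = 2 * L := by ring

lemma vecNorm_sub_le (h : GoodPath M T ζ f g c x θ) {t : ℕ} (ht : 1 ≤ t) (n : ℕ) :
    vecNorm (fun i => multiplier g c θ (t + n) i - multiplier g c θ t i) ≤ 2 * L * n := by
  induction n with
  | zero =>
    simp only [add_zero, sub_self]
    rw [vecNorm_zero]
    simp
  | succ n ih =>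
    have h1 : vecNorm (fun i => multiplier g c θ (t + n + 1) i - multiplier g c θ (t + n) i)
        ≤ 2 * L := by
      refine (vecNorm_le_sum_abs _).trans (le_trans (Finset.sum_le_sum fun i _ => ?_)
        (h.sum_abs_sub_level_le (t := t + n) (by omega) (h.isFlow (t + n + 1) (by omega))))
      rw [multiplier_succ (by omega)]
      set b := pairing (g (t + n) i) (θ (t + n + 1)) - c i
      have hq := multiplier_nonneg (g := g) (c := c) (θ := θ) (t + n) i
      set q := multiplier g c θ (t + n) i
      calc |max (q + b) 0 - q| = |max (q + b) 0 - max q 0| := by rw [max_eq_left hq]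
        _ ≤ |q + b - q| := abs_max_sub_max_le_abs _ _ _
        _ = |b| := by rw [add_sub_cancel_left]
    have h2 := vecNorm_add_le
      (fun i => multiplier g c θ (t + n + 1) i - multiplier g c θ (t + n) i)
      (fun i => multiplier g c θ (t + n) i - multiplier g c θ t i)
    simp only [sub_add_sub_cancel] at h2
    rw [← add_assoc]
    push_cast
    linarith

lemma vecNorm_le_add (h : GoodPath M T ζ f g c x θ) {t : ℕ} (ht : 1 ≤ t) (n : ℕ) :
    vecNorm (multiplier g c θ (t + n)) ≤ vecNorm (multiplier g c θ t) + 2 * L * n := by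
  have h1 := h.vecNorm_sub_le ht n
  have h2 := vecNorm_add_le (fun i => multiplier g c θ (t + n) i - multiplier g c θ t i)
    (multiplier g c θ t)
  simp only [sub_add_cancel] at h2
  linarith

lemma vecNorm_sq_succ_le (h : GoodPath M T ζ f g c x θ) {t : ℕ} (ht : 1 ≤ t) :
    vecNorm (multiplier g c θ (t + 1)) ^ 2 ≤ vecNorm (multiplier g c θ t) ^ 2
      + 2 * ∑ i, multiplier g c θ t i * (pairing (g t i) (θ (t + 1)) - c i) + 4 * L ^ 2 := by
  set b : ι → ℝ := fun i => pairing (g t i) (θ (t + 1)) - c i with hb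
  have h1 : ∑ i, b i ^ 2 ≤ 4 * L ^ 2 := by
    have e1 := (vecNorm_le_sum_abs b).trans
      (h.sum_abs_sub_level_le ht (h.isFlow (t + 1) (by omega)))
    rw [← vecNorm_sq]
    nlinarith [vecNorm_nonneg b]
  rw [vecNorm_sq, vecNorm_sq]
  calc ∑ i, multiplier g c θ (t + 1) i ^ 2
      ≤ ∑ i, (multiplier g c θ t i ^ 2 + 2 * (multiplier g c θ t i * b i) + b i ^ 2) := by
        refine Finset.sum_le_sum fun i _ => ?_
        rw [multiplier_succ ht]
        change max (multiplier g c θ t i + b i) 0 ^ 2 ≤ _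
        rcases max_cases (multiplier g c θ t i + b i) 0 with ⟨h2, _⟩ | ⟨h2, _⟩
        · rw [h2]
          exact le_of_eq (by ring)
        · rw [h2]
          nlinarith [sq_nonneg (multiplier g c θ t i + b i)]
    _ ≤ _ := by
        rw [Finset.sum_add_distrib, Finset.sum_add_distrib, ← Finset.mul_sum]
        linarith

lemma pairing_objective (V : ℝ) (φ : S × A × S → ℝ) (ψ : ι → S × A × S → ℝ) (Q : ι → ℝ)
    (z : S × A × S → ℝ) : pairing (fun e => V * φ e + ∑ i, Q i * ψ i e) z
      = V * pairing φ z + ∑ i, Q i * pairing (ψ i) z := by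
  simp only [pairing, add_mul, Finset.sum_add_distrib, Finset.mul_sum, Finset.sum_mul, mul_assoc]
  rw [Finset.sum_comm]

/-- The mixing rate `λ = 1 / T` costs at most `2 / T`. -/
lemma neg_log_one_sub_le (h : GoodPath M T ζ f g c x θ) : -Real.log (1 - 1 / T) ≤ 2 / T := by
  have hT : (4 : ℝ) ≤ T := by exact_mod_cast h.four_le
  have h1 : (0 : ℝ) < 1 - 1 / T := by
    rw [sub_pos, div_lt_one (by linarith)]
    linarith
  have h2 := Real.one_sub_inv_le_log_of_pos h1
  have h3 : (1 - 1 / (T : ℝ))⁻¹ - 1 = 1 / (T - 1) := by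
    have : (T : ℝ) - 1 ≠ 0 := by linarith
    field_simp
    ring
  have h4 : 1 / ((T : ℝ) - 1) ≤ 2 / T := by
    rw [div_le_div_iff₀ (by linarith) (by linarith)]
    linarith
  linarith

lemma lam_mem (h : GoodPath M T ζ f g c x θ) : (0 : ℝ) < 1 / T ∧ (1 : ℝ) / T < 1 := by
  have hT : (4 : ℝ) ≤ T := by exact_mod_cast h.four_le
  refine ⟨by positivity, ?_⟩
  rw [div_lt_one (by linarith)]
  linarith

lemma mix_pos (h : GoodPath M T ζ f g c x θ) {t : ℕ} (ht : 1 ≤ t) (e : S × A × S)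
    (he : M.layer e.2.2 = M.layer e.1 + 1) : 0 < M.mix (1 / T) (θ t) e := by
  have := h.nonempty_actions
  exact LoopFreeMDP.mix_pos (h.isFlow t ht) h.lam_mem.1 h.lam_mem.2.le he

lemma isFlow_mix (h : GoodPath M T ζ f g c x θ) {t : ℕ} (ht : 1 ≤ t) :
    M.IsFlow (M.mix (1 / T) (θ t)) := by
  have := h.nonempty_actions
  exact (h.isFlow t ht).mix h.lam_mem.1.le h.lam_mem.2.le

lemma l1Norm_mix_sub_le (h : GoodPath M T ζ f g c x θ) {t : ℕ} (ht : 1 ≤ t) :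
    l1Norm (M.mix (1 / T) (θ t) - θ t) ≤ 2 * L / T := by
  have := h.nonempty_actions
  refine ((h.isFlow t ht).l1Norm_mix_sub_le h.lam_mem.1.le).trans (le_of_eq ?_)
  ring

lemma occupancySet_subset (h : GoodPath M T ζ f g c x θ) {t : ℕ} (ht : 1 ≤ t) (htT : t ≤ T + 1) :
    M.occupancySet ⊆ M.optimisticSet T ζ (Counters.atEpisode x t) :=
  LoopFreeMDP.occupancySet_subset_optimisticSet (h.confidence t ht htT)

lemma sq_l1Norm_le (h : GoodPath M T ζ f g c x θ) {t : ℕ} (ht : 1 ≤ t) :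
    T / 4 * l1Norm (θ (t + 1) - M.mix (1 / T) (θ t)) ^ 2
      ≤ L * T * divergence (θ (t + 1)) (M.mix (1 / T) (θ t)) := by
  have h1 := LoopFreeMDP.l1Norm_sub_sq_le_divergence (h.isFlow (t + 1) (by omega))
    (h.isFlow_mix ht) (h.mix_pos ht)
  have := mul_le_mul_of_nonneg_left h1 (show (0 : ℝ) ≤ T / 4 by positivity)
  calc _ ≤ _ := this
    _ = _ := by ring

/-- One step of the primal-dual method: the drift of the multipliers plus the weighted loss,
compared with an occupancy measure `z` that is admissible in the next episode. -/
lemma drift_step (h : GoodPath M T ζ f g c x θ) {t : ℕ} (ht : 1 ≤ t) (htT : t ≤ T)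
    {z : S × A × S → ℝ} (hz : z ∈ M.optimisticSet T ζ (Counters.atEpisode x (t + 1))) :
    L * √T * pairing (f t) (θ t - z)
        + (vecNorm (multiplier g c θ (t + 1)) ^ 2 - vecNorm (multiplier g c θ t) ^ 2) / 2
      ≤ ∑ i, multiplier g c θ t i * (pairing (g t i) z - c i) + 7 * L ^ 2
        + L * T * (divergence z (M.mix (1 / T) (θ t))
          - divergence z (M.mix (1 / T) (θ (t + 1)))) := by
  have hNA := h.nonempty_actions
  have hT : (4 : ℝ) ≤ T := by exact_mod_cast h.four_le
  have hL := h.one_le_length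
  set Q := multiplier g c θ t with hQ
  have h1 := LoopFreeMDP.mirror_step
    (K := M.optimisticSet T ζ (Counters.atEpisode x (t + 1))) (fun _ hθ => hθ.1)
    (fun _ hθ _ hθ' p q hp hq hpq => LoopFreeMDP.optimisticSet_convexComb hθ hθ' hp hq hpq)
    (show (0 : ℝ) ≤ L * T by positivity) h.lam_mem.1 h.lam_mem.2 (h.isFlow_mix ht) (h.mix_pos ht)
    (h.seq.mem t ht) (h.seq.min t ht) hz
  rw [pairing_objective, pairing_objective, ← hQ] at h1
  have h2 := h.vecNorm_sq_succ_le ht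
  rw [← hQ] at h2
  have h3 := h.sq_l1Norm_le ht
  have h4 : -(L * T * (L * Real.log (1 - 1 / T))) ≤ 2 * (L : ℝ) ^ 2 := by
    have := mul_le_mul_of_nonneg_left h.neg_log_one_sub_le (show (0 : ℝ) ≤ L * T * L by positivity)
    calc -(L * T * (L * Real.log (1 - 1 / T))) = L * T * L * -Real.log (1 - 1 / T) := by ring
      _ ≤ _ := this
      _ = _ := by field_simp
  set y := θ (t + 1) with hy
  set r := M.mix (1 / T) (θ t) with hr
  set d := l1Norm (y - r) with hd
  have hd0 : 0 ≤ d := l1Norm_nonneg _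
  have hs0 : 0 < √(T : ℝ) := Real.sqrt_pos.2 (by linarith)
  have hs2 : √(T : ℝ) ^ 2 = T := Real.sq_sqrt (by linarith)
  have hs1 : 1 ≤ √(T : ℝ) := Real.one_le_sqrt.2 (by linarith)
  have h5 : pairing (f t) (θ t - y) ≤ 2 * L / T + d := by
    refine (le_abs_self _).trans ((abs_pairing_le (h.loss t ht htT)).trans ?_)
    rw [one_mul]
    refine (l1Norm_sub_le _ r _).trans (add_le_add ?_ ?_)
    · rw [l1Norm_sub_comm]
      exact h.l1Norm_mix_sub_le ht
    · rw [l1Norm_sub_comm]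
  have h6 : L * √T * pairing (f t) (θ t - y) ≤ 3 * L ^ 2 + T / 4 * d ^ 2 := by
    have e1 := mul_le_mul_of_nonneg_left h5 (show 0 ≤ L * √(T : ℝ) by positivity)
    have e2 : L * √T * (2 * L / T) ≤ 2 * (L : ℝ) ^ 2 := by
      have : L * √T * (2 * L / T) = 2 * (L : ℝ) ^ 2 * (1 / √T) := by
        have e0 : L * √T * (2 * L / T) = 2 * (L : ℝ) ^ 2 * (√T / T) := by ring
        rw [e0, Real.sqrt_div_self, one_div]
      rw [this]
      refine mul_le_of_le_one_right (by positivity) ?_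
      rw [div_le_one hs0]
      exact hs1
    have e3 : L * √T * d ≤ L ^ 2 + T / 4 * d ^ 2 := by
      rw [← hs2]
      rw [Real.sqrt_sq hs0.le]
      nlinarith [sq_nonneg ((L : ℝ) - √T * d / 2)]
    nlinarith
  rw [pairing_sub_right] at h6 ⊢
  simp only [mul_sub, Finset.sum_sub_distrib] at h2 h6 ⊢
  linarith

/-- The drift inequality over a window of episodes. -/
lemma drift_window (h : GoodPath M T ζ f g c x θ) {w : ℕ} (hw : 1 ≤ w) (n : ℕ)
    (hwT : w + n ≤ T + 1) {z : S × A × S → ℝ} (hz : z ∈ M.occupancySet) :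
    L * √T * ∑ j ∈ Finset.range n, pairing (f (w + j)) (θ (w + j) - z)
        + (vecNorm (multiplier g c θ (w + n)) ^ 2 - vecNorm (multiplier g c θ w) ^ 2) / 2
      ≤ ∑ j ∈ Finset.range n, ∑ i, multiplier g c θ (w + j) i * (pairing (g (w + j) i) z - c i)
        + 7 * L ^ 2 * n + L * T *
          (divergence z (M.mix (1 / T) (θ w)) - divergence z (M.mix (1 / T) (θ (w + n)))) := by
  induction n with
  | zero => simp
  | succ n ih =>
    have h1 := ih (by omega)
    have h2 := h.drift_step (t := w + n) (by omega) (by omega)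
      (h.occupancySet_subset (by omega) (by omega) hz)
    rw [Finset.sum_range_succ, Finset.sum_range_succ, ← add_assoc]
    push_cast
    linarith

lemma log_card_le (h : GoodPath M T ζ f g c x θ) :
    Real.log ((Fintype.card S : ℝ) ^ 2 * Fintype.card A / (1 / T)) ≤ 3 * Real.log T := by
  have hT : (4 : ℝ) ≤ T := by exact_mod_cast h.four_le
  have h1 : (Fintype.card S : ℝ) * Fintype.card A ≤ T := by exact_mod_cast h.card_le
  have h2 : (1 : ℝ) < Fintype.card S := by exact_mod_cast h.card_states
  have h3 : (1 : ℝ) < Fintype.card A := by exact_mod_cast h.card_actions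
  have h4 : 3 * Real.log T = Real.log ((T : ℝ) ^ 3) := by
    rw [Real.log_pow]
    norm_num
  rw [h4]
  refine Real.log_le_log (by positivity) ?_
  rw [div_div_eq_mul_div, div_one, pow_succ]
  refine mul_le_mul_of_nonneg_right ?_ (by linarith)
  have h5 : (Fintype.card S : ℝ) ≤ T := by nlinarith
  calc (Fintype.card S : ℝ) ^ 2 * Fintype.card A
      = Fintype.card S * (Fintype.card S * Fintype.card A) := by ring
    _ ≤ T * T := mul_le_mul h5 h1 (by positivity) (by linarith)
    _ = T ^ 2 := by ring

lemma divergence_le (h : GoodPath M T ζ f g c x θ) {t : ℕ} (ht : 1 ≤ t) {z : S × A × S → ℝ}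
    (hz : M.IsFlow z) : divergence z (M.mix (1 / T) (θ t)) ≤ L * (3 * Real.log T) := by
  have := h.nonempty_actions
  exact (LoopFreeMDP.divergence_mix_le hz (h.isFlow t ht) h.lam_mem.1 h.lam_mem.2.le).trans
    (mul_le_mul_of_nonneg_left h.log_card_le (by positivity))

/-- Within an epoch the occupancy measures of consecutive episodes are close to each other. -/
lemma l1Norm_sub_le_of_same (h : GoodPath M T ζ f g c x θ) {t : ℕ} (ht : 1 ≤ t) (htT : t ≤ T)
    (hmem : θ t ∈ M.optimisticSet T ζ (Counters.atEpisode x (t + 1))) :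
    l1Norm (θ (t + 1) - θ t) ≤ 15 * L / √T + 8 * vecNorm (multiplier g c θ t) / T := by
  have hNA := h.nonempty_actions
  have hT : (4 : ℝ) ≤ T := by exact_mod_cast h.four_le
  have hL := h.one_le_length
  set Q := multiplier g c θ t with hQ
  have hQ0 : 0 ≤ vecNorm Q := vecNorm_nonneg _
  set y := θ (t + 1) with hy
  set r := M.mix (1 / T) (θ t) with hr
  set d := l1Norm (y - r) with hd
  have hd0 : 0 ≤ d := l1Norm_nonneg _
  set s := √(T : ℝ) with hs
  have hs2 : s ^ 2 = T := Real.sq_sqrt (by linarith)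
  have hs1 : 1 ≤ s := Real.one_le_sqrt.2 (by linarith)
  set H := L * s + vecNorm Q with hH
  have hH0 : 0 ≤ H := by positivity
  have h1 := h.seq.min t ht (θ t) hmem
  simp only [LoopFreeMDP.objective] at h1
  rw [← hQ, ← hr, ← hy] at h1
  have h2 := h.sq_l1Norm_le ht
  rw [← hr, ← hy, ← hd] at h2
  have h3 := LoopFreeMDP.divergence_mix_self_le (h.isFlow t ht) h.lam_mem.1 h.lam_mem.2
  rw [← hr] at h3
  have h4 : L * T * divergence (θ t) r ≤ 2 * (L : ℝ) ^ 2 := by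
    have e1 := h.neg_log_one_sub_le
    calc L * T * divergence (θ t) r ≤ L * T * (L * (2 / T)) := by
          refine mul_le_mul_of_nonneg_left (h3.trans ?_) (by positivity)
          rw [← mul_neg]
          exact mul_le_mul_of_nonneg_left e1 (by positivity)
      _ = _ := by field_simp
  have h5 : l1Norm (y - θ t) ≤ d + 2 * L / T := by
    refine (l1Norm_sub_le _ r _).trans (add_le_add le_rfl (h.l1Norm_mix_sub_le ht))
  set hvec : S × A × S → ℝ := fun e => L * s * f t e + ∑ i, Q i * g t i e with hvec_def
  have h6 : |pairing hvec (θ t - y)| ≤ H * l1Norm (θ t - y) := by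
    refine abs_pairing_le fun e => ?_
    refine (abs_add_le _ _).trans (add_le_add ?_ ?_)
    · rw [abs_mul, abs_of_nonneg (by positivity)]
      exact mul_le_of_le_one_right (by positivity) (h.loss t ht htT e)
    · refine (abs_sum_mul_le Q fun i => g t i e).trans (mul_le_of_le_one_right hQ0 ?_)
      exact (Finset.sum_le_sum fun i _ =>
        le_ciSup (Set.finite_range fun e => |g t i e|).bddAbove e).trans (h.constraint t ht)
  rw [pairing_sub_right, l1Norm_sub_comm] at h6
  have h7 : T / 4 * d ^ 2 ≤ H * (d + 2 * L / T) + 2 * L ^ 2 := by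
    have e1 := (le_abs_self _).trans h6
    have e2 := mul_le_mul_of_nonneg_left h5 hH0
    linarith
  have h8 := le_of_quadratic_le (by linarith) hH0 hd0 hs1 hs2 h7
  have h9 : 2 * L / (T : ℝ) ≤ 2 * L / s := by
    refine div_le_div_of_nonneg_left (by positivity) (by linarith) ?_
    rw [← hs2]
    nlinarith
  calc l1Norm (y - θ t) ≤ d + 2 * L / T := h5
    _ ≤ 8 * H / T + 5 * L / s + 2 * L / s := by linarith
    _ = _ := by
        rw [hH, ← hs2]
        field_simp
        ring

end GoodPath

end

/-! ### The bound on the multipliers along a path -/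

section

variable {S A ι : Type*} [Fintype S] [Fintype A] [Fintype ι] {L : ℕ}

/-- The deviation of the observed constraint functions `g` from their means `gm` at `z`, in the
direction of the multipliers `Q`. It vanishes if `Q = 0`, because of the convention `0 / 0 = 0`. -/
def constraintNoise (Q : ι → ℝ) (g gm : ι → S × A × S → ℝ) (z : S × A × S → ℝ) : ℝ :=
  ∑ i, Q i / vecNorm Q * (pairing (g i) z - pairing (gm i) z)

lemma vecNorm_mul_constraintNoise (Q : ι → ℝ) (g gm : ι → S × A × S → ℝ) (z : S × A × S → ℝ) :
    vecNorm Q * constraintNoise Q g gm z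
      = ∑ i, Q i * (pairing (g i) z - pairing (gm i) z) := by
  rw [constraintNoise, Finset.mul_sum]
  refine Finset.sum_congr rfl fun i _ => ?_
  rcases eq_or_ne (vecNorm Q) 0 with h | h
  · have : Q i = 0 := abs_nonpos_iff.1 (h ▸ abs_le_vecNorm Q i)
    simp [this]
  · rw [← mul_assoc, mul_div_cancel₀ _ h]

/-- The terms of the drift over a window of `τ` episodes that do not depend on the multipliers. -/
def windowError (L T τ : ℕ) (σ B : ℝ) : ℝ :=
  τ * (L * √T * (3 * L + σ * B)) + 7 * L ^ 2 * τ + 4 * L ^ 2 * τ ^ 2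
    + 3 * L ^ 2 * T * Real.log T

/-- The size of the multipliers from which on they drift downwards. -/
def driftThreshold (L T τ : ℕ) (σ ϑ B : ℝ) : ℝ :=
  L * √T * (B + ϑ) + 2 * windowError L T τ σ B / (σ * τ)

lemma windowError_pos {L T τ : ℕ} {σ B : ℝ} (hL : (1 : ℝ) ≤ L) (hT : (4 : ℝ) ≤ T) (hσ : 0 < σ)
    (hB : 0 < B) : 0 < windowError L T τ σ B := by
  have : 0 < Real.log T := Real.log_pos (by linarith)
  unfold windowError
  positivity

/-- `z` nearly minimizes the Lagrangian at the multipliers `Q`, as far as the error bound with the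
constant `σ` controls its value. -/
def NearMinimizer (T : ℕ) (L : ℕ) (σ ϑ B : ℝ) (φ : S × A × S → ℝ) (gm : ι → S × A × S → ℝ)
    (c : ι → ℝ) (Q : ι → ℝ) (z : S × A × S → ℝ) : Prop :=
  L * √T * (B + ϑ) ≤ vecNorm Q →
    L * √T * pairing φ z + ∑ i, Q i * (pairing (gm i) z - c i)
      ≤ 2 * (L * √T) * L - σ * (vecNorm Q - L * √T * B)

lemma pairing_avgLoss {f : ℕ → S × A × S → ℝ} {w τ : ℕ} (hτ : 0 < τ) (z : S × A × S → ℝ) :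
    (τ : ℝ) * pairing (avgLoss f w τ) z = ∑ j ∈ Finset.range τ, pairing (f (w + j)) z := by
  have : (τ : ℝ) ≠ 0 := by exact_mod_cast hτ.ne'
  simp only [pairing, avgLoss]
  rw [Finset.mul_sum, Finset.sum_comm]
  refine Finset.sum_congr rfl fun e _ => ?_
  rw [← Finset.sum_mul]
  field_simp

namespace GoodPath

variable [DecidableEq S] [DecidableEq A] {M : LoopFreeMDP S A L} {T : ℕ} {ζ : ℝ}
  {f : ℕ → S × A × S → ℝ} {g : ℕ → ι → S × A × S → ℝ} {c : ι → ℝ} {x : ℕ → Path S A L}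
  {θ : ℕ → S × A × S → ℝ} {τ : ℕ} {σ ϑ B : ℝ} {gm : ι → S × A × S → ℝ}

/-- The drift of the multipliers over one window. -/
lemma window_le (h : GoodPath M T ζ f g c x θ) (hτ : 0 < τ) {w : ℕ} (hw : 1 ≤ w)
    (hwT : w + τ ≤ T + 1) {z : S × A × S → ℝ} (hz : z ∈ M.occupancySet)
    (hmin : NearMinimizer T L σ ϑ B (avgLoss f w τ) gm c (multiplier g c θ w) z)
    (hbig : L * √T * (B + ϑ) ≤ vecNorm (multiplier g c θ w)) :
    (vecNorm (multiplier g c θ (w + τ)) ^ 2 - vecNorm (multiplier g c θ w) ^ 2) / 2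
      ≤ -(σ * τ * vecNorm (multiplier g c θ w)) + windowError L T τ σ B
        + vecNorm (multiplier g c θ w) *
          ∑ j ∈ Finset.range τ, constraintNoise (multiplier g c θ w) (g (w + j)) gm z := by
  have hT : (4 : ℝ) ≤ T := by exact_mod_cast h.four_le
  have hNA := h.nonempty_actions
  set Q := multiplier g c θ w with hQ
  have h1 := h.drift_window hw τ hwT hz
  rw [← hQ] at h1
  have h2 := h.divergence_le hw hz.1
  have h3 : 0 ≤ divergence z (M.mix (1 / T) (θ (w + τ))) :=
    LoopFreeMDP.divergence_nonneg hz.1 (h.isFlow_mix (by omega)) (h.mix_pos (by omega))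
  have h4 : L * T * (divergence z (M.mix (1 / T) (θ w))
      - divergence z (M.mix (1 / T) (θ (w + τ)))) ≤ 3 * L ^ 2 * T * Real.log T := by
    calc _ ≤ L * T * (L * (3 * Real.log T)) :=
          mul_le_mul_of_nonneg_left (by linarith) (by positivity)
      _ = _ := by ring
  have h5 : -(τ * L) ≤ ∑ j ∈ Finset.range τ, pairing (f (w + j)) (θ (w + j)) := by
    calc -((τ : ℝ) * L) = ∑ j ∈ Finset.range τ, -(L : ℝ) := by simp
      _ ≤ _ := by
        refine Finset.sum_le_sum fun j hj => ?_
        have hj := Finset.mem_range.1 hj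
        have e1 := abs_pairing_le (θ := θ (w + j)) (h.loss (w + j) (by omega) (by omega))
        rw [(h.isFlow (w + j) (by omega)).l1Norm_eq, one_mul] at e1
        exact (abs_le.1 e1).1
  have h6 : ∑ j ∈ Finset.range τ, ∑ i, multiplier g c θ (w + j) i * (pairing (g (w + j) i) z - c i)
      ≤ ∑ j ∈ Finset.range τ, (∑ i, Q i * (pairing (g (w + j) i) z - c i) + 4 * L ^ 2 * τ) := by
    refine Finset.sum_le_sum fun j hj => ?_
    have hj := Finset.mem_range.1 hj
    have e1 := (le_abs_self _).trans (abs_sum_mul_le (fun i => multiplier g c θ (w + j) i - Q i)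
      (fun i => pairing (g (w + j) i) z - c i))
    have e2 := h.vecNorm_sub_le hw j
    have e3 := h.sum_abs_sub_level_le (t := w + j) (by omega) hz.1
    have e4 : 2 * (L : ℝ) * j * (2 * L) ≤ 4 * L ^ 2 * τ := by
      have : (j : ℝ) ≤ τ := by exact_mod_cast hj.le
      nlinarith [mul_le_mul_of_nonneg_left this (sq_nonneg (L : ℝ))]
    have e5 := mul_le_mul e2 e3 (Finset.sum_nonneg fun _ _ => abs_nonneg _)
      (show (0 : ℝ) ≤ 2 * L * j by positivity)
    simp only [sub_mul, Finset.sum_sub_distrib] at e1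
    linarith
  have h7 : ∑ j ∈ Finset.range τ, ∑ i, Q i * (pairing (g (w + j) i) z - c i)
      = τ * ∑ i, Q i * (pairing (gm i) z - c i)
        + vecNorm Q * ∑ j ∈ Finset.range τ, constraintNoise Q (g (w + j)) gm z := by
    rw [Finset.mul_sum (Finset.range τ)]
    simp only [vecNorm_mul_constraintNoise]
    rw [← nsmul_eq_mul, ← Finset.card_range τ, ← Finset.sum_const, Finset.card_range,
      ← Finset.sum_add_distrib]
    refine Finset.sum_congr rfl fun j _ => ?_
    rw [← Finset.sum_add_distrib]
    exact Finset.sum_congr rfl fun i _ => by ring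
  rw [Finset.sum_add_distrib, h7, Finset.sum_const, Finset.card_range, nsmul_eq_mul] at h6
  simp only [pairing_sub_right, Finset.sum_sub_distrib] at h1
  rw [← pairing_avgLoss hτ] at h1
  have h8 := mul_le_mul_of_nonneg_left (hmin hbig) (Nat.cast_nonneg (α := ℝ) τ)
  have h9 := mul_le_mul_of_nonneg_left h5 (show 0 ≤ L * √(T : ℝ) by positivity)
  rw [windowError]
  linarith

lemma vecNorm_window_le (h : GoodPath M T ζ f g c x θ) (hτ : 0 < τ) (hσ : 0 < σ) (hϑ : 0 < ϑ)
    (hB : 0 < B) {w : ℕ} (hw : 1 ≤ w)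
    (hwT : w + τ ≤ T + 1) {z : S × A × S → ℝ} (hz : z ∈ M.occupancySet)
    (hmin : NearMinimizer T L σ ϑ B (avgLoss f w τ) gm c (multiplier g c θ w) z)
    (hbig : driftThreshold L T τ σ ϑ B ≤ vecNorm (multiplier g c θ w)) :
    vecNorm (multiplier g c θ (w + τ)) ≤ vecNorm (multiplier g c θ w)
      + (∑ j ∈ Finset.range τ, constraintNoise (multiplier g c θ w) (g (w + j)) gm z
        - σ * τ / 2) := by
  have hT : (4 : ℝ) ≤ T := by exact_mod_cast h.four_le
  have hL := h.one_le_length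
  have hτ' : (0 : ℝ) < τ := by exact_mod_cast hτ
  have hR := windowError_pos (τ := τ) hL hT hσ hB
  have hs0 : 0 < √(T : ℝ) := Real.sqrt_pos.2 (by linarith)
  rw [driftThreshold] at hbig
  have e1 : 0 < 2 * windowError L T τ σ B / (σ * τ) := by positivity
  have e2 : 0 < L * √(T : ℝ) * (B + ϑ) := by positivity
  have h1 := h.window_le hτ hw hwT hz hmin (by linarith)
  set Z := vecNorm (multiplier g c θ w)
  set Z' := vecNorm (multiplier g c θ (w + τ)) with hZ'
  set N := ∑ j ∈ Finset.range τ, constraintNoise (multiplier g c θ w) (g (w + j)) gm z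
  have hZ'0 : 0 ≤ Z' := vecNorm_nonneg _
  have hZ : 0 < Z := by linarith
  have e3 : 2 * windowError L T τ σ B ≤ Z * (σ * τ) := by
    rw [← div_le_iff₀ (by positivity)]
    linarith
  -- `Z'² ≤ Z (Z + 2 δ)` is at most `(Z + δ)²`, and negative if `Z + δ < 0`
  set δ := N - σ * τ / 2 with hδ
  have e4 : Z' ^ 2 ≤ Z ^ 2 + 2 * Z * δ := by
    rw [hδ]
    nlinarith
  have e5 : 0 ≤ Z + δ := by
    by_contra! hcon
    nlinarith [mul_neg_of_pos_of_neg hZ hcon, sq_nonneg Z']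
  have e6 : Z' ^ 2 ≤ (Z + δ) ^ 2 := by nlinarith [sq_nonneg δ]
  exact (sq_le_sq₀ hZ'0 e5).1 e6

/-- On the event that the noise exceeds its allowance by at most `y`, so do the multipliers: going
back in steps of length `τ` from any episode, one reaches an episode at which they are small,
and from then on they drift downwards up to the noise. -/
lemma vecNorm_multiplier_le (h : GoodPath M T ζ f g c x θ) (hτ : 0 < τ) (hσ : 0 < σ) (hϑ : 0 < ϑ)
    (hB : 0 < B) {z : ℕ → S × A × S → ℝ} (hz : ∀ w, z w ∈ M.occupancySet)
    (hmin : ∀ w, 1 ≤ w → w + τ ≤ T + 1 →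
      NearMinimizer T L σ ϑ B (avgLoss f w τ) gm c (multiplier g c θ w) (z w)) {y : ℝ}
    (hnoise : ∀ a k, 1 ≤ a → a + k * τ ≤ T + 1 → ∑ n ∈ Finset.range (k * τ),
      constraintNoise (multiplier g c θ (a + n / τ * τ)) (g (a + n)) gm (z (a + n / τ * τ))
        ≤ (k * τ : ℕ) * (σ / 2) + y) {t : ℕ} (ht : 1 ≤ t) (htT : t ≤ T + 1) :
    vecNorm (multiplier g c θ t) ≤ driftThreshold L T τ σ ϑ B + 2 * L * τ + y := by
  have hT : (4 : ℝ) ≤ T := by exact_mod_cast h.four_le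
  have hL := h.one_le_length
  have hτ' : (0 : ℝ) < τ := by exact_mod_cast hτ
  have hR := windowError_pos (τ := τ) hL hT hσ hB
  have hΘ : 0 < driftThreshold L T τ σ ϑ B := by
    have hs0 : 0 < √(T : ℝ) := Real.sqrt_pos.2 (by linarith)
    unfold driftThreshold
    positivity
  set N : ℕ → ℕ → ℝ := fun a n =>
    constraintNoise (multiplier g c θ (a + n / τ * τ)) (g (a + n)) gm (z (a + n / τ * τ)) with hN
  have key : ∀ t, 1 ≤ t → t ≤ T + 1 → ∃ a k, 1 ≤ a ∧ t = a + k * τ ∧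
      vecNorm (multiplier g c θ t) ≤ driftThreshold L T τ σ ϑ B + 2 * L * τ
        + (∑ n ∈ Finset.range (k * τ), N a n - (k * τ : ℕ) * (σ / 2)) := by
    intro t
    induction t using Nat.strong_induction_on with
    | _ t ih =>
      intro ht htT
      rcases Nat.lt_or_ge τ t with hlt | hge
      · obtain ⟨w, rfl⟩ : ∃ w, t = w + τ := ⟨t - τ, by omega⟩
        have hw : 1 ≤ w := by omega
        rcases lt_or_ge (vecNorm (multiplier g c θ w)) (driftThreshold L T τ σ ϑ B) with hs | hb
        · refine ⟨w + τ, 0, ht, by simp, ?_⟩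
          have := h.vecNorm_le_add hw τ
          simp only [zero_mul, Finset.range_zero, Finset.sum_empty, Nat.cast_zero]
          linarith
        · obtain ⟨a, k, ha, hwk, hle⟩ := ih w (by omega) hw (by omega)
          refine ⟨a, k + 1, ha, by rw [hwk]; ring, ?_⟩
          have h1 := h.vecNorm_window_le hτ hσ hϑ hB hw htT (hz w) (hmin w hw htT) hb
          have h2 : ∑ n ∈ Finset.range ((k + 1) * τ), N a n = ∑ n ∈ Finset.range (k * τ), N a n
              + ∑ j ∈ Finset.range τ,
                constraintNoise (multiplier g c θ w) (g (w + j)) gm (z w) := by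
            rw [Nat.succ_mul, Finset.sum_range_add]
            congr 1
            refine Finset.sum_congr rfl fun j hj => ?_
            have hj := Finset.mem_range.1 hj
            have hdiv : (k * τ + j) / τ = k := by
              rw [mul_comm, Nat.mul_add_div hτ, Nat.div_eq_of_lt hj, add_zero]
            simp only [hN]
            rw [hdiv, ← hwk, ← add_assoc, ← hwk]
          rw [h2]
          push_cast at hle ⊢
          linarith
      · refine ⟨t, 0, ht, by simp, ?_⟩
        have h1 := h.vecNorm_le_add (t := 1) le_rfl (t - 1)
        rw [show 1 + (t - 1) = t by omega, vecNorm_multiplier_one] at h1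
        have h2 : ((t - 1 : ℕ) : ℝ) ≤ τ := by exact_mod_cast (by omega : t - 1 ≤ τ)
        have h3 : 2 * (L : ℝ) * (t - 1 : ℕ) ≤ 2 * L * τ :=
          mul_le_mul_of_nonneg_left h2 (by positivity)
        simp only [zero_mul, Finset.range_zero, Finset.sum_empty, Nat.cast_zero]
        linarith
  obtain ⟨a, k, ha, rfl, hle⟩ := key t ht htT
  have := hnoise a k ha htT
  linarith

end GoodPath

end

/-! ### Measurable choice of near-minimizers of the Lagrangian -/

section

/-- If some point of `K` satisfies the strict inequality `F q z < b q`, then such a point can be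
chosen measurably in `q`: take the first one in a dense sequence of `K`. -/
lemma exists_measurable_choice {α E : Type*} [MeasurableSpace α] [TopologicalSpace E]
    [SecondCountableTopology E] [MeasurableSpace E] {K : Set E} (hK : K.Nonempty)
    {F : α → E → ℝ} {b : α → ℝ} (hF : ∀ z, Measurable fun q => F q z)
    (hFc : ∀ q, Continuous (F q)) (hb : Measurable b) :
    ∃ sel : α → E, Measurable sel ∧ (∀ q, sel q ∈ K) ∧
      ∀ q, (∃ z ∈ K, F q z < b q) → F q (sel q) < b q := by
  classical
  have : Nonempty K := hK.to_subtype
  set u : ℕ → K := TopologicalSpace.denseSeq K with hu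
  set p : α → ℕ → Prop := fun q n => F q (u n) < b q ∨ ∀ m, ¬ F q (u m) < b q with hp
  have hex : ∀ q, ∃ n, p q n := by
    intro q
    by_cases h : ∃ n, F q (u n) < b q
    · exact h.imp fun n hn => Or.inl hn
    · exact ⟨0, Or.inr fun m hm => h ⟨m, hm⟩⟩
  have hlt : ∀ n, MeasurableSet {q | F q (u n) < b q} := fun n => measurableSet_lt (hF _) hb
  have hm : ∀ n, MeasurableSet {q | p q n} := by
    intro n
    have e : {q | p q n} = {q | F q (u n) < b q} ∪ ⋂ m, {q | F q (u m) < b q}ᶜ := by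
      ext q
      simp [hp]
    rw [e]
    exact (hlt n).union (MeasurableSet.iInter fun m => (hlt m).compl)
  refine ⟨fun q => u (Nat.find (hex q)), ?_, fun q => (u _).2, fun q hq => ?_⟩
  · exact (measurable_from_nat (f := fun n => (u n : E))).comp (measurable_find hex hm)
  · obtain ⟨z, hz, hlt⟩ := hq
    have hopen : IsOpen {z : K | F q z < b q} :=
      isOpen_lt ((hFc q).comp continuous_subtype_val) continuous_const
    obtain ⟨y, hy, n, rfl⟩ := (TopologicalSpace.denseRange_denseSeq K).exists_mem_open hopen
      ⟨⟨z, hz⟩, hlt⟩ |>.elim (fun n hn => (⟨_, hn, n, rfl⟩ :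
        ∃ y : K, F q y < b q ∧ ∃ n, TopologicalSpace.denseSeq K n = y))
    exact (Nat.find_spec (hex q)).resolve_right fun h => h n hy

lemma measurable_vecNorm {ι : Type*} [Fintype ι] : Measurable (vecNorm : (ι → ℝ) → ℝ) := by
  have : (vecNorm : (ι → ℝ) → ℝ) = fun v => √(∑ i, v i ^ 2) := by
    funext v
    rw [← vecNorm_sq, Real.sqrt_sq (vecNorm_nonneg v)]
  rw [this]
  fun_prop

section Selection

variable {S A ι : Type*} [Fintype S] [Fintype A] [Fintype ι] {L : ℕ} {M : LoopFreeMDP S A L}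
  {g : ι → S × A × S → ℝ} {c : ι → ℝ} {φ : S × A × S → ℝ}

/-- Weak duality at a feasible point. -/
lemma LoopFreeMDP.dualFunction_le (hfeas : (M.feasibleSet g c).Nonempty) (hφ : ∀ e, |φ e| ≤ 1)
    {η : EuclideanSpace ℝ ι} (hη : ∀ i, 0 ≤ η i) : M.dualFunction g c φ η ≤ L := by
  obtain ⟨z, hz, hzc⟩ := hfeas
  rw [dualFunction]
  by_cases hbdd : BddBelow ((fun θ => pairing φ θ + ∑ i, η i * (pairing (g i) θ - c i)) ''
      M.occupancySet)
  · refine (csInf_le hbdd ⟨z, hz, rfl⟩).trans ?_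
    have h1 := (le_abs_self _).trans (abs_pairing_le (θ := z) hφ)
    rw [hz.1.l1Norm_eq, one_mul] at h1
    have h2 : ∑ i, η i * (pairing (g i) z - c i) ≤ 0 := Finset.sum_nonpos fun i _ =>
      mul_nonpos_of_nonneg_of_nonpos (hη i) (by linarith [hzc i])
    simp only
    linarith
  · rw [Real.sInf_of_not_bddBelow hbdd]
    positivity

/-- The error bound yields near-minimizers of the Lagrangian at all large multipliers, and these
can be chosen measurably. -/
lemma exists_nearMinimizer {T : ℕ} {σ ϑ B : ℝ} (hT : 0 < T) (hL : 0 < L) (hσ : 0 < σ) (hϑ : 0 < ϑ)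
    (hfeas : (M.feasibleSet g c).Nonempty) (hφ : ∀ e, |φ e| ≤ 1)
    (hmult : (M.multiplierSet g c φ).Nonempty) (hB : ∀ η ∈ M.multiplierSet g c φ, ‖η‖ ≤ B)
    (herr : ∃ σ' ϑ' : ℝ, σ ≤ σ' ∧ 0 < ϑ' ∧ ϑ' ≤ ϑ ∧ M.ErrorBound g c φ σ' ϑ') :
    ∃ sel : (ι → ℝ) → S × A × S → ℝ, Measurable sel ∧ (∀ Q, sel Q ∈ M.occupancySet) ∧
      ∀ Q, (∀ i, 0 ≤ Q i) → NearMinimizer T L σ ϑ B φ g c Q (sel Q) := by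
  have hs0 : 0 < √(T : ℝ) := Real.sqrt_pos.2 (by exact_mod_cast hT)
  have hL' : (0 : ℝ) < L := by exact_mod_cast hL
  set V := L * √(T : ℝ) with hV
  have hV0 : 0 < V := by positivity
  obtain ⟨sel, h1, h2, h3⟩ := exists_measurable_choice
    (hfeas.mono fun _ hz => hz.1 : M.occupancySet.Nonempty)
    (F := fun Q z => V * pairing φ z + ∑ i, Q i * (pairing (g i) z - c i))
    (b := fun Q => 2 * V * L - σ * (vecNorm Q - V * B)) (fun z => by fun_prop)
    (fun Q => by unfold pairing; fun_prop)
    (((measurable_vecNorm.sub_const _).const_mul _).const_sub _)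
  refine ⟨sel, h1, h2, fun Q hQ hbig => (h3 Q ?_).le⟩
  rw [← hV] at hbig
  obtain ⟨ηs, hηs⟩ := hmult
  obtain ⟨σ', ϑ', hσσ, hϑ'0, hϑϑ, hEB⟩ := herr
  set η : EuclideanSpace ℝ ι := WithLp.toLp 2 fun i => V⁻¹ * Q i with hη
  have hη0 : ∀ i, 0 ≤ η i := fun i => mul_nonneg (inv_nonneg.2 hV0.le) (hQ i)
  have hnorm : ‖η‖ = V⁻¹ * vecNorm Q := by
    have : η = V⁻¹ • (WithLp.toLp 2 Q : EuclideanSpace ℝ ι) := rfl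
    rw [this, norm_smul, Real.norm_of_nonneg (inv_nonneg.2 hV0.le), vecNorm]
  have hdist : V⁻¹ * vecNorm Q - B ≤ Metric.infDist η (M.multiplierSet g c φ) := by
    rw [Metric.le_infDist ⟨ηs, hηs⟩]
    intro y hy
    rw [dist_eq_norm, ← hnorm]
    linarith [norm_sub_norm_le η y, hB y hy]
  have hlarge : ϑ ≤ V⁻¹ * vecNorm Q - B := by
    have := mul_le_mul_of_nonneg_left hbig (inv_nonneg.2 hV0.le)
    rw [inv_mul_cancel_left₀ hV0.ne'] at this
    linarith
  have h4 := hEB η hη0 (hϑϑ.trans (hlarge.trans hdist)) ηs hηs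
  have h5 := M.dualFunction_le hfeas hφ hηs.1
  have h6 : σ * (V⁻¹ * vecNorm Q - B) ≤ σ' * Metric.infDist η (M.multiplierSet g c φ) :=
    mul_le_mul hσσ hdist (by linarith) (by linarith)
  have h7 : M.dualFunction g c φ η < 2 * L - σ * (V⁻¹ * vecNorm Q - B) := by linarith
  obtain ⟨_, ⟨z, hz, rfl⟩, hlt⟩ := exists_lt_of_csInf_lt
    ((hfeas.mono fun _ hz => hz.1 : M.occupancySet.Nonempty).image _) h7
  refine ⟨z, hz, ?_⟩
  have h8 := mul_lt_mul_of_pos_left hlt hV0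
  have h9 : V * (pairing φ z + ∑ i, η i * (pairing (g i) z - c i))
      = V * pairing φ z + ∑ i, Q i * (pairing (g i) z - c i) := by
    rw [mul_add, Finset.mul_sum]
    congr 1
    refine Finset.sum_congr rfl fun i _ => ?_
    change V * (V⁻¹ * Q i * _) = _
    rw [← mul_assoc, mul_inv_cancel_left₀ hV0.ne']
  have h10 : V * (2 * L - σ * (V⁻¹ * vecNorm Q - B)) = 2 * V * L - σ * (vecNorm Q - V * B) := by
    field_simp
  rw [h9, h10] at h8
  exact h8

end Selection

/-! ### The noise of the constraint functions -/

namespace LoopFreeMDP.IsUCPDRun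

variable {S A ι : Type*} [Fintype S] [Fintype A] [Fintype ι] [DecidableEq S] [DecidableEq A]
  {L : ℕ} {Ξ : ι → Type*} [∀ i, MeasurableSpace (Ξ i)] {Ω : Type*} [mΩ : MeasurableSpace Ω]
  {M : LoopFreeMDP S A L} {T : ℕ} {V α lam ζ : ℝ} {f : ℕ → S × A × S → ℝ}
  {G : (i : ι) → S × A × S → Ξ i → ℝ} {D : (i : ι) → Measure (Ξ i)} {c : ι → ℝ} {μ : Measure Ω}
  {𝓕 : Filtration ℕ mΩ} {X : ℕ → Ω → Path S A L} {ξ : ℕ → Ω → (i : ι) → Ξ i}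
  {θ : ℕ → Ω → S × A × S → ℝ} [∀ i, IsProbabilityMeasure (D i)] [IsProbabilityMeasure μ]

/-- The constraint functions of an episode are known at its end. -/
lemma measurable_constraint (h : M.IsUCPDRun T V α lam ζ f G D c μ 𝓕 X ξ θ)
    (hG : ∀ i e, Measurable (G i e)) (t : ℕ) (i : ι) (e : S × A × S) :
    Measurable[𝓕 (t + 1)] fun ω => G i e (ξ (t + 1) ω i) :=
  ((hG i e).comp (measurable_pi_apply i)).comp (h.measurable_noise (t + 1) (by omega))

lemma measurable_multiplier (h : M.IsUCPDRun T V α lam ζ f G D c μ 𝓕 X ξ θ)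
    (hG : ∀ i e, Measurable (G i e)) (t : ℕ) (i : ι) :
    Measurable[𝓕 t] fun ω => multiplier (fun t i e => G i e (ξ t ω i)) c (fun t => θ t ω)
      (t + 1) i := by
  induction t generalizing i with
  | zero => exact measurable_const
  | succ t ih =>
    simp only [multiplier_succ (show 1 ≤ t + 1 by omega), pairing]
    have h1 := (ih i).mono (𝓕.mono (Nat.le_succ t)) le_rfl
    have h2 : Measurable[𝓕 (t + 1)] fun ω =>
        ∑ e, G i e (ξ (t + 1) ω i) * θ (t + 1 + 1) ω e :=
      Finset.measurable_sum _ fun e _ => (h.measurable_constraint hG t i e).mul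
        ((measurable_pi_apply e).comp (h.measurable_occ (t + 1)))
    exact (h1.add (h2.sub_const _)).max measurable_const

/-- Sums of past weights times the deviation of the constraint functions from their means form a
martingale. -/
lemma condExp_noise_eq_zero (h : M.IsUCPDRun T V α lam ζ f G D c μ 𝓕 X ξ θ)
    (hG : ∀ i e, Measurable (G i e))
    (hb : ∀ᵐ x ∂(Measure.pi D), ∑ i, ⨆ e, |G i e (x i)| ≤ 1) (t : ℕ)
    {ρ : ι → Ω → ℝ} {z : Ω → S × A × S → ℝ} (hρ : ∀ i, Measurable[𝓕 t] (ρ i))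
    (hz : Measurable[𝓕 t] z) (hρb : ∀ i ω, |ρ i ω| ≤ 1) (hzb : ∀ ω, M.IsFlow (z ω)) :
    μ[fun ω => ∑ i, ρ i ω * (pairing (fun e => G i e (ξ (t + 1) ω i)) (z ω)
        - pairing (meanConstraint G D i) (z ω)) | 𝓕 t] =ᵐ[μ] fun _ => 0 := by
  have hze : ∀ e, Measurable[𝓕 t] fun ω => z ω e := fun e => (measurable_pi_apply e).comp hz
  have hw : ∀ i e, StronglyMeasurable[𝓕 t] fun ω => ρ i ω * z ω e := fun i e =>
    ((hρ i).mul (hze e)).stronglyMeasurable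
  have hwC : ∀ i e, ∀ᵐ ω ∂μ, |ρ i ω * z ω e| ≤ 1 := fun i e =>
    Filter.Eventually.of_forall fun ω => by
      rw [abs_mul, abs_of_nonneg ((hzb ω).nonneg e)]
      exact mul_le_one₀ (hρb i ω) ((hzb ω).nonneg e) ((hzb ω).le_one e)
  have h1 := h.condExp_sum_constraint hG hb t hw hwC
  set W : Ω → ℝ := fun ω => ∑ i, ∑ e, ρ i ω * z ω e * meanConstraint G D i e with hW
  have hWm : StronglyMeasurable[𝓕 t] W :=
    (Finset.measurable_sum _ fun i _ => Finset.measurable_sum _ fun e _ =>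
      ((hρ i).mul (hze e)).mul_const _).stronglyMeasurable
  have hWint : Integrable W μ := integrable_finsetSum _ fun i _ => integrable_finsetSum _ fun e _ =>
    (Integrable.of_bound ((hw i e).mono (𝓕.le t)).aestronglyMeasurable 1 (hwC i e)).mul_const _
  have hUint : Integrable (fun ω => ∑ i, ∑ e, ρ i ω * z ω e * G i e (ξ (t + 1) ω i)) μ := by
    refine integrable_finsetSum _ fun i _ => integrable_finsetSum _ fun e _ => ?_
    refine Integrable.of_bound (((hw i e).mono (𝓕.le t)).mul
      ((hG i e).comp ((measurable_pi_apply i).comp (h.measurable_noise' t))).stronglyMeasurable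
      ).aestronglyMeasurable 1 ?_
    filter_upwards [hwC i e, h.ae_noise hb] with ω e1 e2
    have e3 := abs_le_one_of_sum_iSup_le (g := fun i e => G i e (ξ (t + 1) ω i))
      (e2 (t + 1) (by omega)) i e
    change |ρ i ω * z ω e * G i e (ξ (t + 1) ω i)| ≤ 1
    rw [abs_mul]
    exact mul_le_one₀ e1 (abs_nonneg _) e3
  have e1 : (fun ω => ∑ i, ρ i ω * (pairing (fun e => G i e (ξ (t + 1) ω i)) (z ω)
        - pairing (meanConstraint G D i) (z ω)))
      = (fun ω => ∑ i, ∑ e, ρ i ω * z ω e * G i e (ξ (t + 1) ω i)) - W := by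
    funext ω
    simp only [hW, Pi.sub_apply, pairing, mul_sub, Finset.sum_sub_distrib, Finset.mul_sum]
    congr 1 <;> exact Finset.sum_congr rfl fun i _ => Finset.sum_congr rfl fun e _ => by ring
  rw [e1]
  have h2 := condExp_sub hUint hWint (𝓕 t)
  rw [condExp_of_stronglyMeasurable (𝓕.le t) hWm hWint] at h2
  filter_upwards [h1, h2] with ω e2 e3
  rw [e3, Pi.sub_apply, e2]
  exact sub_self _

lemma abs_noise_le (hG : ∀ i e, Measurable (G i e))
    (hb : ∀ᵐ x ∂(Measure.pi D), ∑ i, ⨆ e, |G i e (x i)| ≤ 1) {g : ι → S × A × S → ℝ}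
    (hg : ∑ i, ⨆ e, |g i e| ≤ 1) {ρ : ι → ℝ} (hρ : ∀ i, |ρ i| ≤ 1) {z : S × A × S → ℝ}
    (hz : M.IsFlow z) :
    |∑ i, ρ i * (pairing (g i) z - pairing (meanConstraint G D i) z)| ≤ 2 * L := by
  have e1 := sum_abs_pairing_le z hg
  have e2 := sum_abs_pairing_mean_le hG hb z
  rw [hz.l1Norm_eq] at e1 e2
  calc _ ≤ ∑ i, (|pairing (g i) z| + |pairing (meanConstraint G D i) z|) := by
        refine (Finset.abs_sum_le_sum_abs _ _).trans (Finset.sum_le_sum fun i _ => ?_)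
        rw [abs_mul]
        exact (mul_le_of_le_one_left (abs_nonneg _) (hρ i)).trans (abs_sub _ _)
    _ ≤ _ := by
        rw [Finset.sum_add_distrib]
        linarith

/-- The event that some window sum of the noise exceeds its allowance is rare. The allowance is
linear in the length of the sum, so a single exponential parameter serves all lengths. -/
lemma measure_noise_le [Nonempty A] (h : M.IsUCPDRun T V α lam ζ f G D c μ 𝓕 X ξ θ)
    (hL : 0 < L) (hG : ∀ i e, Measurable (G i e))
    (hb : ∀ᵐ x ∂(Measure.pi D), ∑ i, ⨆ e, |G i e (x i)| ≤ 1) (hζ : 0 < ζ) {σ : ℝ} (hσ : 0 < σ)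
    {τ : ℕ} (hτ : 0 < τ)
    {sel : ℕ → (ι → ℝ) → S × A × S → ℝ} (hsel : ∀ w, Measurable (sel w))
    (hmem : ∀ w Q, sel w Q ∈ M.occupancySet) :
    μ {ω | ¬ ∀ a k, 1 ≤ a → a + k * τ ≤ T + 1 → ∑ n ∈ Finset.range (k * τ),
      constraintNoise (multiplier (fun t i e => G i e (ξ t ω i)) c (fun t => θ t ω)
          (a + n / τ * τ))
        (fun i e => G i e (ξ (a + n) ω i)) (meanConstraint G D)
        (sel (a + n / τ * τ) (multiplier (fun t i e => G i e (ξ t ω i)) c (fun t => θ t ω)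
          (a + n / τ * τ)))
      ≤ (k * τ : ℕ) * (σ / 2) + 4 * L ^ 2 / σ * Real.log (((T : ℝ) + 1) ^ 2 / ζ)}
      ≤ ENNReal.ofReal ζ := by
  have hL' : (0 : ℝ) < L := by exact_mod_cast hL
  set Q : ℕ → Ω → ι → ℝ := fun w ω =>
    multiplier (fun t i e => G i e (ξ t ω i)) c (fun t => θ t ω) w with hQ
  set y := 4 * L ^ 2 / σ * Real.log (((T : ℝ) + 1) ^ 2 / ζ) with hy
  set N : ℕ → ℕ → Ω → ℝ := fun u n ω => constraintNoise (Q (u + 1 + n / τ * τ) ω)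
    (fun i e => G i e (ξ (u + 1 + n) ω i)) (meanConstraint G D)
    (sel (u + 1 + n / τ * τ) (Q (u + 1 + n / τ * τ) ω)) with hN
  have hQm : ∀ u n, Measurable[𝓕 (u + n)] fun ω => Q (u + 1 + n / τ * τ) ω := by
    intro u n
    have h1 : Measurable[𝓕 (u + n / τ * τ)] fun ω => Q (u + n / τ * τ + 1) ω :=
      @measurable_pi_lambda _ _ _ (𝓕 (u + n / τ * τ)) _ _ fun i => h.measurable_multiplier hG _ i
    rw [show u + 1 + n / τ * τ = u + n / τ * τ + 1 by ring]
    exact h1.mono (𝓕.mono (by have := Nat.div_mul_le_self n τ; omega)) le_rfl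
  have hρm : ∀ u n i, Measurable[𝓕 (u + n)] fun ω =>
      Q (u + 1 + n / τ * τ) ω i / vecNorm (Q (u + 1 + n / τ * τ) ω) := fun u n i =>
    ((measurable_pi_apply i).comp (hQm u n)).div (measurable_vecNorm.comp (hQm u n))
  have hzm : ∀ u n, Measurable[𝓕 (u + n)] fun ω =>
      sel (u + 1 + n / τ * τ) (Q (u + 1 + n / τ * τ) ω) := fun u n => (hsel _).comp (hQm u n)
  have hρb : ∀ (q : ι → ℝ) i, |q i / vecNorm q| ≤ 1 := fun q i => by
    rw [abs_div, abs_of_nonneg (vecNorm_nonneg q)]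
    exact div_le_one_of_le₀ (abs_le_vecNorm q i) (vecNorm_nonneg q)
  have hNm : ∀ u n, StronglyMeasurable[𝓕 (u + n + 1)] (N u n) := by
    intro u n
    have hle := 𝓕.mono (show u + n ≤ u + n + 1 by omega)
    refine Measurable.stronglyMeasurable ?_
    simp only [hN, constraintNoise, pairing]
    refine Finset.measurable_sum _ fun i _ => ((hρm u n i).mono hle le_rfl).mul (Measurable.sub
      (Finset.measurable_sum _ fun e _ => Measurable.mul ?_ ?_)
      (Finset.measurable_sum _ fun e _ => Measurable.const_mul ?_ _))
    · rw [show u + 1 + n = u + n + 1 by ring]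
      exact h.measurable_constraint hG _ i e
    · exact ((measurable_pi_apply e).comp (hzm u n)).mono hle le_rfl
    · exact ((measurable_pi_apply e).comp (hzm u n)).mono hle le_rfl
  have hNb : ∀ u n, ∀ᵐ ω ∂μ, |N u n ω| ≤ 2 * L := by
    intro u n
    filter_upwards [h.ae_noise hb] with ω hω
    exact abs_noise_le hG hb (hω (u + 1 + n) (by omega)) (hρb _) (hmem _ _).1
  have hNc : ∀ u n, μ[N u n | 𝓕 (u + n)] ≤ᵐ[μ] fun _ => 0 := by
    intro u n
    have h1 := h.condExp_noise_eq_zero hG hb (u + n) (hρm u n) (hzm u n) (fun i ω => hρb _ i)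
      (fun ω => (hmem _ _).1)
    rw [show u + n + 1 = u + 1 + n by ring] at h1
    exact h1.le
  have h1 : ∀ u k, μ {ω | (k * τ : ℕ) * (σ / 2) + y ≤ ∑ n ∈ Finset.range (k * τ), N u n ω}
      ≤ ENNReal.ofReal (ζ / ((T : ℝ) + 1) ^ 2) := by
    intro u k
    refine (azuma 𝓕 u (k * τ) (show (0 : ℝ) < 2 * L by positivity)
      (show 0 < σ / (4 * L ^ 2) by positivity) (fun n _ => hNm u n) (fun n _ => hNb u n)
      (fun n _ => hNc u n) _).trans (ENNReal.ofReal_le_ofReal (le_of_eq ?_))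
    have e1 : ((k * τ : ℕ) : ℝ) * ((σ / (4 * L ^ 2) * (2 * L)) ^ 2 / 2)
        - σ / (4 * L ^ 2) * ((k * τ : ℕ) * (σ / 2) + y)
        = -Real.log (((T : ℝ) + 1) ^ 2 / ζ) := by
      rw [hy]
      field_simp
      ring
    rw [e1, Real.exp_neg, Real.exp_log (by positivity), inv_div]
  have h2 : ∀ u, μ (⋃ k ∈ Finset.range (T + 1), _) ≤ _ := fun u =>
    measure_biUnion_le_card μ (Finset.range (T + 1)) _ fun k _ => h1 u k
  have h3 : μ (⋃ u ∈ Finset.range (T + 1), _) ≤ _ :=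
    measure_biUnion_le_card μ (Finset.range (T + 1)) _ fun u _ => h2 u
  refine (measure_mono fun ω hω => ?_).trans (h3.trans (ENNReal.ofReal_le_ofReal (le_of_eq ?_)))
  · by_contra hcon
    refine hω fun a k ha hak => ?_
    obtain ⟨u, rfl⟩ : ∃ u, a = u + 1 := ⟨a - 1, by omega⟩
    have hk : k ≤ k * τ := Nat.le_mul_of_pos_right k hτ
    by_contra hlt
    push Not at hlt
    exact hcon (Set.mem_iUnion₂.2 ⟨u, Finset.mem_range.2 (by omega), Set.mem_iUnion₂.2
      ⟨k, Finset.mem_range.2 (by omega), hlt.le⟩⟩)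
  · rw [Finset.card_range]
    push_cast
    field_simp

/-- The martingale that compares the multipliers with a fixed flow `z`. The multipliers are cut off
at size `ψ`; on the event that they never exceed `ψ`, the cut-off has no effect. -/
lemma measure_truncated_noise_le (h : M.IsUCPDRun T V α lam ζ f G D c μ 𝓕 X ξ θ) (hT : 0 < T)
    (hL : 0 < L) (hG : ∀ i e, Measurable (G i e))
    (hb : ∀ᵐ x ∂(Measure.pi D), ∑ i, ⨆ e, |G i e (x i)| ≤ 1) (hζ : 0 < ζ) (hζ1 : ζ < 1) {ψ : ℝ}
    (hψ : 0 < ψ) {z : S × A × S → ℝ} (hz : M.IsFlow z) :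
    μ {ω | (∀ t, 1 ≤ t → t ≤ T →
        vecNorm (multiplier (fun t i e => G i e (ξ t ω i)) c (fun t => θ t ω) t) ≤ ψ) ∧
      ¬ ∑ j ∈ Finset.range T, ∑ i,
        multiplier (fun t i e => G i e (ξ t ω i)) c (fun t => θ t ω) (1 + j) i *
          (pairing (fun e => G i e (ξ (1 + j) ω i)) z - pairing (meanConstraint G D i) z)
        ≤ ψ * (2 * L * √(2 * T * Real.log (1 / ζ)))} ≤ ENNReal.ofReal ζ := by
  have hL' : (0 : ℝ) < L := by exact_mod_cast hL
  set Q : ℕ → Ω → ι → ℝ := fun w ω =>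
    multiplier (fun t i e => G i e (ξ t ω i)) c (fun t => θ t ω) w with hQ
  set ρ : ℕ → ι → Ω → ℝ := fun j i ω =>
    if vecNorm (Q (j + 1) ω) ≤ ψ then Q (j + 1) ω i / ψ else 0 with hρ
  set N : ℕ → Ω → ℝ := fun j ω => ∑ i, ρ j i ω *
    (pairing (fun e => G i e (ξ (j + 1) ω i)) z - pairing (meanConstraint G D i) z) with hN
  have hQm : ∀ j, Measurable[𝓕 j] fun ω => Q (j + 1) ω := fun j =>
    @measurable_pi_lambda _ _ _ (𝓕 j) _ _ fun i => h.measurable_multiplier hG j i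
  have hρm : ∀ j i, Measurable[𝓕 j] (ρ j i) := fun j i =>
    Measurable.ite (measurableSet_le (measurable_vecNorm.comp (hQm j)) measurable_const)
      (((measurable_pi_apply i).comp (hQm j)).div_const ψ) measurable_const
  have hρb : ∀ j i ω, |ρ j i ω| ≤ 1 := by
    intro j i ω
    simp only [hρ]
    split_ifs with hle
    · rw [abs_div, abs_of_pos hψ]
      exact div_le_one_of_le₀ ((abs_le_vecNorm _ i).trans hle) hψ.le
    · simp
  have hNm : ∀ j < T, StronglyMeasurable[𝓕 (0 + j + 1)] (N j) := by
    intro j _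
    rw [zero_add]
    refine Measurable.stronglyMeasurable ?_
    simp only [hN, pairing]
    refine Finset.measurable_sum _ fun i _ => ((hρm j i).mono (𝓕.mono (Nat.le_succ j)) le_rfl).mul
      (Measurable.sub_const (Finset.measurable_sum _ fun e _ => Measurable.mul_const ?_ _) _)
    exact h.measurable_constraint hG _ i e
  have hNb : ∀ j < T, ∀ᵐ ω ∂μ, |N j ω| ≤ 2 * L := by
    intro j _
    filter_upwards [h.ae_noise hb] with ω hω
    exact abs_noise_le hG hb (hω (j + 1) (by omega)) (fun i => hρb j i ω) hz
  have hNc : ∀ j < T, μ[N j | 𝓕 (0 + j)] ≤ᵐ[μ] fun _ => 0 := by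
    intro j _
    rw [zero_add]
    exact (h.condExp_noise_eq_zero hG hb j (hρm j) measurable_const (hρb j) fun _ => hz).le
  refine (measure_mono fun ω hω => ?_).trans
    (azuma_sqrt (μ := μ) 𝓕 0 hT (show (0 : ℝ) < 2 * L by positivity) hζ hζ1 hNm hNb hNc)
  obtain ⟨h1, h2⟩ := hω
  by_contra hcon
  refine h2 ?_
  have hcon : ∑ j ∈ Finset.range T, N j ω < 2 * L * √(2 * T * Real.log (1 / ζ)) := not_le.1 hcon
  have e1 : ∀ j ∈ Finset.range T, ∑ i, Q (1 + j) ω i *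
      (pairing (fun e => G i e (ξ (1 + j) ω i)) z - pairing (meanConstraint G D i) z)
      = ψ * N j ω := by
    intro j hj
    have hle : vecNorm (Q (j + 1) ω) ≤ ψ := h1 (j + 1) (by omega) (Finset.mem_range.1 hj)
    simp only [hN, hρ, if_pos hle, Finset.mul_sum, add_comm 1 j]
    refine Finset.sum_congr rfl fun i _ => ?_
    rw [← mul_assoc, mul_div_cancel₀ _ hψ.ne']
  rw [Finset.sum_congr rfl e1, ← Finset.mul_sum]
  exact mul_le_mul_of_nonneg_left hcon.le hψ.le

end LoopFreeMDP.IsUCPDRun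

end

/-! ### Regret and violation along a path -/

section

lemma sum_Icc_one_eq_sum_range (F : ℕ → ℝ) (T : ℕ) :
    ∑ t ∈ Finset.Icc 1 T, F t = ∑ j ∈ Finset.range T, F (1 + j) := by
  rw [← Finset.Ico_add_one_right_eq_Icc, Finset.sum_Ico_eq_sum_range]
  simp

namespace GoodPath

variable {S A ι : Type*} [Fintype S] [Fintype A] [Fintype ι] {L : ℕ}
  [DecidableEq S] [DecidableEq A] {M : LoopFreeMDP S A L} {T : ℕ} {ζ : ℝ}
  {f : ℕ → S × A × S → ℝ} {g : ℕ → ι → S × A × S → ℝ} {c : ι → ℝ} {x : ℕ → Path S A L}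
  {θ : ℕ → S × A × S → ℝ} {gm : ι → S × A × S → ℝ}

/-- The algorithm always plays a flow of the current optimistic set. For the first episode this
holds because the confidence radius is at least `1` where nothing has been observed. -/
lemma mem_optimisticSet (h : GoodPath M T ζ f g c x θ) {t : ℕ} (ht : 1 ≤ t) :
    θ t ∈ M.optimisticSet T ζ (Counters.atEpisode x t) := by
  have hNA := h.nonempty_actions
  rcases ht.eq_or_lt with rfl | h2
  · refine ⟨h.isFlow 1 le_rfl, fun s a => ?_⟩
    have hemp : ∀ s', (Counters.atEpisode x 1).empirical s a s' = 0 := fun s' => by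
      simp [Counters.empirical, Counters.atEpisode, Counters.initial]
    have hθ := h.isFlow 1 le_rfl
    have h0 : 0 ≤ ∑ s', θ 1 (s, a, s') := Finset.sum_nonneg fun _ _ => hθ.nonneg _
    have e1 : ∑ s', |θ 1 (s, a, s') - (Counters.atEpisode x 1).empirical s a s'
        * ∑ s'', θ 1 (s, a, s'')| = ∑ s', θ 1 (s, a, s') :=
      Finset.sum_congr rfl fun s' _ => by
        rw [hemp, zero_mul, sub_zero, abs_of_nonneg (hθ.nonneg _)]
    rw [e1]
    rcases (M.layer_le s).lt_or_eq with hs | hs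
    · refine le_mul_of_one_le_left h0 ?_
      have e2 := h.confidence 1 le_rfl (by omega) s a hs
      simp only [hemp, sub_zero, abs_of_nonneg (M.P_nonneg _ _ _)] at e2
      rwa [M.P_sum s a hs] at e2
    · rw [(M.layer_eq_last_iff s).1 hs]
      simp [hθ.eq_zero_of_term]
  · obtain ⟨t, rfl⟩ : ∃ k, t = k + 1 := ⟨t - 1, by omega⟩
    exact h.seq.mem t (by omega)

lemma sum_l1Norm_sub_occupancy_le (h : GoodPath M T ζ f g c x θ) {W : ℝ}
    (hW : ∑ t ∈ Finset.Icc 1 T, M.expectedWidth (policyOf (θ t))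
      (M.radius T ζ (Counters.atEpisode x t)) ≤ W) :
    ∑ t ∈ Finset.Icc 1 T, l1Norm (θ t - M.occupancy (policyOf (θ t))) ≤ 2 * L * W := by
  calc _ ≤ ∑ t ∈ Finset.Icc 1 T, 2 * L * M.expectedWidth (policyOf (θ t))
        (M.radius T ζ (Counters.atEpisode x t)) := by
        refine Finset.sum_le_sum fun t ht => ?_
        obtain ⟨h1, h2⟩ := Finset.mem_Icc.1 ht
        exact LoopFreeMDP.l1Norm_sub_occupancy_le (h.mem_optimisticSet h1)
          (h.confidence t h1 (by omega))
    _ ≤ _ := by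
        rw [← Finset.mul_sum]
        exact mul_le_mul_of_nonneg_left hW (by positivity)

lemma regret_le (h : GoodPath M T ζ f g c x θ) {z : S × A × S → ℝ} (hz : z ∈ M.feasibleSet gm c)
    {W Y : ℝ}
    (hW : ∑ t ∈ Finset.Icc 1 T, l1Norm (θ t - M.occupancy (policyOf (θ t))) ≤ W)
    (hY : ∑ j ∈ Finset.range T, ∑ i, multiplier g c θ (1 + j) i *
      (pairing (g (1 + j) i) z - pairing (gm i) z) ≤ Y) :
    regret T f (fun t => M.occupancy (policyOf (θ t))) z
      ≤ W + Y / (L * √T) + 7 * L * √T + 3 * L * √T * Real.log T := by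
  have hT : (4 : ℝ) ≤ T := by exact_mod_cast h.four_le
  have hL := h.one_le_length
  have hs0 : 0 < √(T : ℝ) := Real.sqrt_pos.2 (by linarith)
  have hs2 : √(T : ℝ) * √T = T := Real.mul_self_sqrt (by linarith)
  have h1 := h.drift_window (w := 1) le_rfl T (by omega) hz.1
  have h2 := h.divergence_le (t := 1) le_rfl hz.1.1
  have h3 : 0 ≤ divergence z (M.mix (1 / T) (θ (1 + T))) :=
    LoopFreeMDP.divergence_nonneg hz.1.1 (h.isFlow_mix (by omega)) (h.mix_pos (by omega))
  have h4 : L * T * (divergence z (M.mix (1 / T) (θ 1))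
      - divergence z (M.mix (1 / T) (θ (1 + T)))) ≤ 3 * L ^ 2 * T * Real.log T := by
    calc _ ≤ L * T * (L * (3 * Real.log T)) :=
          mul_le_mul_of_nonneg_left (by linarith) (by positivity)
      _ = _ := by ring
  have h5 : ∑ j ∈ Finset.range T, ∑ i, multiplier g c θ (1 + j) i * (pairing (g (1 + j) i) z - c i)
      ≤ Y := by
    refine le_trans (Finset.sum_le_sum fun j _ => Finset.sum_le_sum fun i _ => ?_) hY
    exact mul_le_mul_of_nonneg_left (by linarith [hz.2 i]) (multiplier_nonneg _ _)
  rw [vecNorm_multiplier_one] at h1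
  have h6 : L * √T * ∑ j ∈ Finset.range T, pairing (f (1 + j)) (θ (1 + j) - z)
      ≤ L * √T * (Y / (L * √T) + 7 * L * √T + 3 * L * √T * Real.log T) := by
    have e1 : L * √T * (Y / (L * √T) + 7 * L * √T + 3 * L * √T * Real.log T)
        = Y + (√T * √T) * (7 * L ^ 2 + 3 * L ^ 2 * Real.log T) := by
      field_simp
      ring
    rw [e1, hs2]
    nlinarith [sq_nonneg (vecNorm (multiplier g c θ (1 + T)))]
  have h7 := le_of_mul_le_mul_left h6 (by positivity)
  rw [← sum_Icc_one_eq_sum_range (fun t => pairing (f t) (θ t - z))] at h7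
  have h8 : regret T f (fun t => M.occupancy (policyOf (θ t))) z
      ≤ ∑ t ∈ Finset.Icc 1 T, l1Norm (θ t - M.occupancy (policyOf (θ t)))
        + ∑ t ∈ Finset.Icc 1 T, pairing (f t) (θ t - z) := by
    rw [regret, ← Finset.sum_add_distrib]
    refine Finset.sum_le_sum fun t ht => ?_
    obtain ⟨ht1, ht2⟩ := Finset.mem_Icc.1 ht
    have e1 := (abs_le.1 (abs_pairing_le (θ := θ t - M.occupancy (policyOf (θ t)))
      (h.loss t ht1 ht2))).1
    simp only [pairing_sub_right] at e1 ⊢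
    linarith
  linarith

/-- The movement of the occupancy measures: small within an epoch, and there are few epochs. -/
lemma sum_l1Norm_sub_succ_le (h : GoodPath M T ζ f g c x θ) {ψ : ℝ} (hψ0 : 0 ≤ ψ)
    (hψ : ∀ t, 1 ≤ t → t ≤ T → vecNorm (multiplier g c θ t) ≤ ψ) :
    ∑ t ∈ Finset.Icc 1 T, l1Norm (θ (t + 1) - θ t)
      ≤ 15 * L * √T + 8 * ψ + (Fintype.card S * Fintype.card A * Nat.size T : ℕ) * (2 * L) := by
  have hT : (4 : ℝ) ≤ T := by exact_mod_cast h.four_le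
  have hs2 : √(T : ℝ) * √T = T := Real.mul_self_sqrt (by linarith)
  have hs0 : 0 < √(T : ℝ) := Real.sqrt_pos.2 (by linarith)
  have h1 := Counters.sum_le_of_same_epoch x T
    (fun t s a ht _ => LoopFreeMDP.visits_le_one (h.layered t ht) s a)
    (fun t => l1Norm (θ (t + 1) - θ t)) (b := 15 * L / √T + 8 * ψ / T) (D := 2 * L)
    (by positivity) (by positivity)
    (fun t ht _ => (h.isFlow (t + 1) (by omega)).l1Norm_sub_le (h.isFlow t ht))
    (fun t ht htT hN hM => by
      refine (h.l1Norm_sub_le_of_same ht htT ?_).trans ?_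
      · rw [LoopFreeMDP.optimisticSet_congr M T ζ hN hM]
        exact h.mem_optimisticSet ht
      · have := hψ t ht htT
        gcongr)
  have h2 : (T : ℝ) * (15 * L / √T + 8 * ψ / T) = 15 * L * √T + 8 * ψ := by
    have e1 : (T : ℝ) * (15 * L / √T + 8 * ψ / T) = 15 * L * (T / √T) + 8 * ψ * (T / T) := by ring
    rw [e1, Real.div_sqrt, div_self (by linarith)]
    ring
  rwa [h2] at h1

lemma violation_le (h : GoodPath M T ζ f g c x θ) {ψ W : ℝ} (hψ0 : 0 ≤ ψ)
    (hψ : ∀ t, 1 ≤ t → t ≤ T + 1 → vecNorm (multiplier g c θ t) ≤ ψ)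
    (hW : ∑ t ∈ Finset.Icc 1 T, l1Norm (θ t - M.occupancy (policyOf (θ t))) ≤ W) :
    violation T g c (fun t => M.occupancy (policyOf (θ t)))
      ≤ W + 15 * L * √T + 9 * ψ
        + (Fintype.card S * Fintype.card A * Nat.size T : ℕ) * (2 * L) := by
  set θbar : ℕ → S × A × S → ℝ := fun t => M.occupancy (policyOf (θ t)) with hθbar
  have h1 : ∀ i n, ∑ t ∈ Finset.Icc 1 n, (pairing (g t i) (θ (t + 1)) - c i)
      ≤ multiplier g c θ (n + 1) i := by
    intro i n
    induction n with
    | zero => simpa using multiplier_nonneg 1 i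
    | succ n ih =>
      rw [Finset.sum_Icc_succ_top (by omega), multiplier_succ (t := n + 1) (by omega)]
      refine le_trans ?_ (le_max_left _ _)
      linarith
  set E : ι → ℝ := fun i => ∑ t ∈ Finset.Icc 1 T, |pairing (g t i) (θbar t - θ (t + 1))| with hE
  have hE0 : ∀ i, 0 ≤ E i := fun i => Finset.sum_nonneg fun _ _ => abs_nonneg _
  have h2 : violation T g c θbar ≤ vecNorm (fun i => multiplier g c θ (T + 1) i + E i) := by
    refine vecNorm_mono (fun i => le_max_right _ _) fun i => max_le ?_
      (add_nonneg (multiplier_nonneg _ _) (hE0 i))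
    refine le_trans ?_ (add_le_add (h1 i T) le_rfl)
    rw [← Finset.sum_add_distrib]
    refine Finset.sum_le_sum fun t _ => ?_
    have := le_abs_self (pairing (g t i) (θbar t - θ (t + 1)))
    rw [pairing_sub_right] at this ⊢
    linarith
  have h3 : ∑ i, |E i| ≤ ∑ t ∈ Finset.Icc 1 T, (l1Norm (θ t - θbar t)
      + l1Norm (θ (t + 1) - θ t)) := by
    simp only [abs_of_nonneg (hE0 _)]
    rw [Finset.sum_comm]
    refine Finset.sum_le_sum fun t ht => ?_
    refine (sum_abs_pairing_le _ (h.constraint t (Finset.mem_Icc.1 ht).1)).trans ?_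
    refine (l1Norm_sub_le _ (θ t) _).trans (le_of_eq ?_)
    rw [l1Norm_sub_comm (θbar t), l1Norm_sub_comm (θ t) (θ (t + 1))]
  rw [Finset.sum_add_distrib] at h3
  have h4 := vecNorm_add_le (multiplier g c θ (T + 1)) E
  have h5 := vecNorm_le_sum_abs E
  have h6 := h.sum_l1Norm_sub_succ_le hψ0 fun t ht htT => hψ t ht (by omega)
  have h7 := hψ (T + 1) (by omega) le_rfl
  linarith

end GoodPath

end

/-! ### The rates -/

section

/-- The constant in the bound on the multipliers. -/
def multiplierConstant (σ ϑ B : ℝ) : ℝ := B + ϑ + (64 + 2 * B) / σ + 4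

section Rates

variable {L T τ : ℕ} {σ ϑ B ζ : ℝ}

lemma one_le_log_div (hT : 4 ≤ T) (hζ : 0 < ζ) (hζ4 : ζ ≤ 1 / 4) : 1 ≤ Real.log (T / ζ) := by
  have hT' : (4 : ℝ) ≤ T := by exact_mod_cast hT
  rw [Real.le_log_iff_exp_le (by positivity), le_div_iff₀ hζ]
  have := Real.exp_one_lt_d9
  nlinarith

lemma log_le_log_div (hT : 4 ≤ T) (hζ : 0 < ζ) (hζ4 : ζ ≤ 1 / 4) :
    Real.log T ≤ Real.log (T / ζ) := by
  have hT' : (4 : ℝ) ≤ T := by exact_mod_cast hT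
  refine Real.log_le_log (by linarith) ?_
  rw [le_div_iff₀ hζ]
  nlinarith

lemma log_sq_div_le (hT : 4 ≤ T) (hζ : 0 < ζ) (hζ4 : ζ ≤ 1 / 4) :
    Real.log (((T : ℝ) + 1) ^ 2 / ζ) ≤ 4 * Real.log (T / ζ) := by
  have hT' : (4 : ℝ) ≤ T := by exact_mod_cast hT
  have h1 : 4 * Real.log (T / ζ) = Real.log ((T / ζ) ^ 4) := by
    rw [Real.log_pow]
    norm_num
  rw [h1]
  refine Real.log_le_log (by positivity) ?_
  have h2 : (T : ℝ) + 1 ≤ T ^ 2 := by nlinarith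
  have h3 : ζ ^ 4 ≤ ζ := pow_le_of_le_one hζ.le (by linarith) (by norm_num)
  rw [div_pow]
  calc ((T : ℝ) + 1) ^ 2 / ζ ≤ (T ^ 2) ^ 2 / ζ := by gcongr
    _ = T ^ 4 / ζ := by ring
    _ ≤ _ := by gcongr

lemma size_le (hT : 4 ≤ T) (hζ : 0 < ζ) (hζ4 : ζ ≤ 1 / 4) :
    (Nat.size T : ℝ) ≤ 3 * Real.log (T / ζ) := by
  have h1 := one_le_log_div hT hζ hζ4
  have h2 := log_le_log_div hT hζ hζ4
  obtain ⟨m, hm⟩ : ∃ m, Nat.size T = m + 1 :=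
    ⟨Nat.size T - 1, by have := Nat.size_pos.2 (show 0 < T by omega); omega⟩
  have h3 : 2 ^ m ≤ T := Nat.lt_size.1 (by omega)
  have h4 : (2 : ℝ) ^ m ≤ T := by exact_mod_cast h3
  have h5 := Real.log_le_log (by positivity) h4
  rw [Real.log_pow] at h5
  have h6 := Real.log_two_gt_d9
  rw [hm]
  push_cast
  nlinarith [Nat.cast_nonneg (α := ℝ) m]

/-- The period `τ` is of the order of `√T`. -/
lemma period_bounds (hT : 4 ≤ T) (hτ : |(τ : ℝ) - √T| < 1) :
    √(T : ℝ) / 2 ≤ τ ∧ (τ : ℝ) ≤ 2 * √T := by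
  have h1 : 2 ≤ √(T : ℝ) := by
    rw [Real.le_sqrt (by norm_num) (by positivity)]
    exact_mod_cast (by omega : 2 ^ 2 ≤ T)
  obtain ⟨h2, h3⟩ := abs_lt.1 hτ
  constructor <;> linarith

lemma multiplierBound_le (hL : (1 : ℝ) ≤ L) (hT : 4 ≤ T) (hζ : 0 < ζ) (hζ4 : ζ ≤ 1 / 4)
    (hσ : 0 < σ) (hσ1 : σ ≤ 1) (hϑ : 0 < ϑ) (hB : 0 < B) (hτ : |(τ : ℝ) - √T| < 1) :
    driftThreshold L T τ σ ϑ B + 2 * L * τ + 4 * L ^ 2 / σ * Real.log (((T : ℝ) + 1) ^ 2 / ζ)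
      ≤ multiplierConstant σ ϑ B * (L ^ 2 * √T * Real.log (T / ζ)) := by
  have hT' : (4 : ℝ) ≤ T := by exact_mod_cast hT
  obtain ⟨hτ1, hτ2⟩ := period_bounds hT hτ
  have hl := one_le_log_div hT hζ hζ4
  have hlT := log_le_log_div hT hζ hζ4
  have hy := log_sq_div_le hT hζ hζ4
  set l := Real.log (T / ζ) with hl_def
  set s := √(T : ℝ) with hs
  have hs1 : 1 ≤ s := Real.one_le_sqrt.2 (by linarith)
  have hs2 : s * s = T := Real.mul_self_sqrt (by linarith)
  have hτ0 : (0 : ℝ) < τ := by linarith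
  have hLL : (L : ℝ) ≤ L ^ 2 := by nlinarith
  set U := (L : ℝ) ^ 2 * s * l with hU
  have hsl : s ≤ s * l := le_mul_of_one_le_right (by linarith) hl
  have hLs : L ^ 2 * s ≤ U := le_mul_of_one_le_right (by positivity) hl
  have hL1s : L * s ≤ U := (mul_le_mul_of_nonneg_right hLL (by linarith)).trans hLs
  have hL2 : (L : ℝ) ^ 2 ≤ U := (le_mul_of_one_le_right (by positivity) hs1).trans hLs
  have hL2l : (L : ℝ) ^ 2 * l ≤ U := by
    rw [hU, mul_right_comm]
    exact le_mul_of_one_le_right (by positivity) hs1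
  have hU0 : 0 < U := by positivity
  have h1 : windowError L T τ σ B ≤ τ * ((24 + B) * U) := by
    have e1 : L * s * (3 * L + σ * B) ≤ (3 + B) * U := by
      have e2 : 3 * L + σ * B ≤ (3 + B) * L := by nlinarith [mul_le_mul_of_nonneg_right hσ1 hB.le]
      calc L * s * (3 * L + σ * B) ≤ L * s * ((3 + B) * L) :=
            mul_le_mul_of_nonneg_left e2 (by positivity)
        _ = (3 + B) * (L ^ 2 * s) := by ring
        _ ≤ _ := mul_le_mul_of_nonneg_left hLs (by positivity)
    have e3 : 4 * L ^ 2 * (τ : ℝ) ≤ 8 * U := by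
      calc 4 * (L : ℝ) ^ 2 * τ ≤ 4 * L ^ 2 * (2 * s) :=
            mul_le_mul_of_nonneg_left hτ2 (by positivity)
        _ = 8 * (L ^ 2 * s) := by ring
        _ ≤ _ := by linarith
    have e4 : 3 * L ^ 2 * T * Real.log T ≤ τ * (6 * U) := by
      calc 3 * (L : ℝ) ^ 2 * T * Real.log T ≤ 3 * L ^ 2 * T * l :=
            mul_le_mul_of_nonneg_left hlT (by positivity)
        _ = s / 2 * (6 * U) := by rw [hU, ← hs2]; ring
        _ ≤ _ := mul_le_mul_of_nonneg_right hτ1 (by positivity)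
    have e5 := mul_le_mul_of_nonneg_left e1 hτ0.le
    have e6 := mul_le_mul_of_nonneg_left e3 hτ0.le
    have e7 := mul_le_mul_of_nonneg_left hL2 hτ0.le
    rw [windowError]
    nlinarith
  have h2 : 2 * windowError L T τ σ B / (σ * τ) ≤ (48 + 2 * B) / σ * U := by
    rw [div_le_iff₀ (by positivity)]
    calc 2 * windowError L T τ σ B ≤ 2 * (τ * ((24 + B) * U)) := by linarith
      _ = _ := by
        field_simp
        ring
  have h3 : 4 * L ^ 2 / σ * Real.log (((T : ℝ) + 1) ^ 2 / ζ) ≤ 16 / σ * U := by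
    calc _ ≤ 4 * L ^ 2 / σ * (4 * l) := mul_le_mul_of_nonneg_left hy (by positivity)
      _ = 16 / σ * (L ^ 2 * l) := by ring
      _ ≤ _ := mul_le_mul_of_nonneg_left hL2l (by positivity)
  have h4 : L * s * (B + ϑ) ≤ (B + ϑ) * U := by
    rw [mul_comm]
    exact mul_le_mul_of_nonneg_left hL1s (by linarith)
  have h5 : 2 * L * (τ : ℝ) ≤ 4 * U := by
    calc 2 * (L : ℝ) * τ ≤ 2 * L * (2 * s) := mul_le_mul_of_nonneg_left hτ2 (by positivity)
      _ = 4 * (L * s) := by ring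
      _ ≤ _ := by linarith
  have h6 : multiplierConstant σ ϑ B * U
      = (B + ϑ) * U + (48 + 2 * B) / σ * U + 16 / σ * U + 4 * U := by
    rw [multiplierConstant]
    ring
  rw [h6, driftThreshold]
  linarith

end Rates

section Final

variable {S A : Type*} [Fintype S] [Fintype A] {L T : ℕ} {ζ : ℝ}

lemma log_logArg_le (hT : 4 ≤ T) (hS : 1 < Fintype.card S) (hA : 1 < Fintype.card A)
    (hζ : 0 < ζ) (hζ4 : ζ ≤ 1 / 4) : Real.log (LoopFreeMDP.logArg S A T ζ)
      ≤ 2 * Real.log (T * Fintype.card S * Fintype.card A / ζ) := by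
  have hT' : (4 : ℝ) ≤ T := by exact_mod_cast hT
  have hS' : (1 : ℝ) ≤ Fintype.card S := by exact_mod_cast hS.le
  have hA' : (1 : ℝ) ≤ Fintype.card A := by exact_mod_cast hA.le
  have h1 : 2 * Real.log (T * Fintype.card S * Fintype.card A / ζ)
      = Real.log ((T * Fintype.card S * Fintype.card A / ζ) ^ 2) := by
    rw [Real.log_pow]
    norm_num
  rw [h1, LoopFreeMDP.logArg]
  refine Real.log_le_log (by positivity) ?_
  set q : ℝ := Fintype.card S * Fintype.card A with hq
  have hq1 : 1 ≤ q := one_le_mul_of_one_le_of_one_le hS' hA'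
  have h2 : (T : ℝ) + 1 ≤ T ^ 2 := by nlinarith
  have h3 : ζ ^ 2 ≤ ζ := pow_le_of_le_one hζ.le (by linarith) (by norm_num)
  rw [mul_assoc, mul_assoc, ← hq, div_pow]
  calc ((T : ℝ) + 1) * q / ζ ≤ T ^ 2 * q ^ 2 / ζ := by
        gcongr
        nlinarith
    _ = (T * q) ^ 2 / ζ := by ring
    _ ≤ _ := by gcongr

/-- The quantities of the regret and the violation in terms of the common rate. Here `ψ` bounds the
multipliers and `W` the distance between the occupancy measures and their optimistic versions. -/
lemma rates (hL : (1 : ℝ) ≤ L) (hLS : L + 1 ≤ Fintype.card S) (hT : 4 ≤ T)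
    (hS : 1 < Fintype.card S) (hA : 1 < Fintype.card A)
    (hSA : Fintype.card S * Fintype.card A ≤ T) (hζ : 0 < ζ) (hζ4 : ζ ≤ 1 / 4) {K ψ W : ℝ}
    (hK : 0 ≤ K) (hψ : ψ ≤ K * (L ^ 2 * √T * Real.log (T / ζ)))
    (hψ0 : 0 ≤ ψ) (hW : W ≤ 2 * L * (6 * (Fintype.card S * √(T * Fintype.card A))
      * Real.log (LoopFreeMDP.logArg S A T ζ))) :
    W + ψ * (2 * L * √(2 * T * Real.log (1 / ζ))) / (L * √T) + 7 * L * √T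
        + 3 * L * √T * Real.log T
      ≤ (9 * K + 45) * (L * Fintype.card S * √(T * Fintype.card A)) *
        (Real.log (T / ζ) ^ (3 / 2 : ℝ)
          + Real.log (T * Fintype.card S * Fintype.card A / ζ)) ∧
    W + 15 * L * √T + 9 * ψ + (Fintype.card S * Fintype.card A * Nat.size T : ℕ) * (2 * L)
      ≤ (9 * K + 45) * (L * Fintype.card S * √(T * Fintype.card A)) *
        (Real.log (T / ζ) ^ (3 / 2 : ℝ)
          + Real.log (T * Fintype.card S * Fintype.card A / ζ)) := by
  have hT' : (4 : ℝ) ≤ T := by exact_mod_cast hT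
  have hS' : (1 : ℝ) ≤ Fintype.card S := by exact_mod_cast hS.le
  have hA' : (1 : ℝ) ≤ Fintype.card A := by exact_mod_cast hA.le
  have hLS' : (L : ℝ) ≤ Fintype.card S := by exact_mod_cast (by omega : L ≤ Fintype.card S)
  have hSA' : (Fintype.card S : ℝ) * Fintype.card A ≤ T := by exact_mod_cast hSA
  have hAT : (Fintype.card A : ℝ) ≤ T := by nlinarith
  have hl := one_le_log_div hT hζ hζ4
  have hlT := log_le_log_div hT hζ hζ4
  have hsize := size_le hT hζ hζ4
  have hlog := log_logArg_le hT hS hA hζ hζ4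
  have hl' : 0 ≤ Real.log (T * Fintype.card S * Fintype.card A / ζ) := by
    have := LoopFreeMDP.one_le_log_logArg (by omega : 1 ≤ T) hζ (by linarith) hS hA
    linarith
  have hlz : Real.log (1 / ζ) ≤ Real.log (T / ζ) := by
    refine Real.log_le_log (by positivity) ?_
    gcongr
    linarith
  have hrp : Real.log (T / ζ) ^ (3 / 2 : ℝ) = Real.log (T / ζ) * √(Real.log (T / ζ)) := by
    rw [Real.sqrt_eq_rpow, ← Real.rpow_one_add' (by linarith) (by norm_num)]
    norm_num
  rw [hrp]
  set l := Real.log (T / ζ) with hl_def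
  set l' := Real.log (T * Fintype.card S * Fintype.card A / ζ) with hl'_def
  set s := √(T : ℝ) with hs
  have hs0 : 0 < s := Real.sqrt_pos.2 (by linarith)
  have hq1 : 1 ≤ √l := Real.one_le_sqrt.2 hl
  have hlq : l ≤ l * √l := le_mul_of_one_le_right (by linarith) hq1
  have hsA : s ≤ √(T * Fintype.card A) :=
    Real.sqrt_le_sqrt (le_mul_of_one_le_right (by linarith) hA')
  have hAs : (Fintype.card A : ℝ) ≤ √(T * Fintype.card A) :=
    Real.le_sqrt_of_sq_le (by nlinarith)
  have hLpos : (0 : ℝ) ≤ L := by linarith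
  set R := √((T : ℝ) * Fintype.card A) with hR
  have hR0 : 0 ≤ R := Real.sqrt_nonneg _
  set U := L * Fintype.card S * R with hU
  have hU0 : 0 ≤ U := by positivity
  have hL2s : L ^ 2 * s ≤ U := by
    calc (L : ℝ) ^ 2 * s = L * L * s := by ring
      _ ≤ L * Fintype.card S * R := by gcongr
  have hLs : L * s ≤ U := by
    calc (L : ℝ) * s = L * 1 * s := by ring
      _ ≤ L * Fintype.card S * R := by gcongr
  have hUl : U * l ≤ U * (l * √l) := mul_le_mul_of_nonneg_left hlq hU0
  have hUl1 : U ≤ U * l := le_mul_of_one_le_right hU0 hl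
  have hUl' : 0 ≤ U * l' := mul_nonneg hU0 hl'
  have hψU : ψ ≤ K * (U * l) := by
    refine hψ.trans (mul_le_mul_of_nonneg_left ?_ hK)
    exact mul_le_mul_of_nonneg_right hL2s (by linarith)
  have hKU : K * (U * l) ≤ K * (U * (l * √l)) := mul_le_mul_of_nonneg_left hUl hK
  have hKl' : 0 ≤ K * (U * l') := mul_nonneg hK hUl'
  have hKlq : 0 ≤ K * (U * (l * √l)) := by positivity
  have hWU : W ≤ 24 * (U * l') := by
    calc W ≤ _ := hW
      _ = 12 * U * Real.log (LoopFreeMDP.logArg S A T ζ) := by rw [hU]; ring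
      _ ≤ 12 * U * (2 * l') := mul_le_mul_of_nonneg_left hlog (by positivity)
      _ = _ := by ring
  constructor
  · have e1 : √(2 * T * Real.log (1 / ζ)) ≤ 3 / 2 * (s * √l) := by
      rw [hs, ← Real.sqrt_mul (by linarith)]
      refine Real.sqrt_le_iff.2 ⟨by positivity, ?_⟩
      rw [mul_pow, Real.sq_sqrt (by positivity)]
      have := mul_le_mul_of_nonneg_left hlz (show (0 : ℝ) ≤ T by linarith)
      have : 0 ≤ (T : ℝ) * l := by positivity
      linarith
    have e2 : ψ * (2 * L * √(2 * T * Real.log (1 / ζ))) / (L * s) ≤ 3 * (K * (U * (l * √l))) := by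
      rw [div_le_iff₀ (by positivity)]
      calc ψ * (2 * L * √(2 * T * Real.log (1 / ζ)))
          ≤ K * (U * l) * (2 * L * (3 / 2 * (s * √l))) := by gcongr
        _ = _ := by ring
    have e3 : 3 * L * s * Real.log T ≤ 3 * (U * (l * √l)) := by
      calc 3 * (L : ℝ) * s * Real.log T = 3 * (L * s * Real.log T) := by ring
        _ ≤ 3 * (U * l) := by gcongr
        _ ≤ _ := by linarith
    linarith
  · have e1 : ((Fintype.card S * Fintype.card A * Nat.size T : ℕ) : ℝ) * (2 * L)
        ≤ 6 * (U * l) := by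
      push_cast
      calc (Fintype.card S : ℝ) * Fintype.card A * Nat.size T * (2 * L)
          ≤ Fintype.card S * R * (3 * l) * (2 * L) := by gcongr
        _ = _ := by rw [hU]; ring
    linarith

end Final

lemma abs_avgLoss_le {S A : Type*} {f : ℕ → S × A × S → ℝ} {w τ T : ℕ}
    (hf : ∀ t, 1 ≤ t → t ≤ T → ∀ e, |f t e| ≤ 1) (hw : 1 ≤ w) (hwT : w + τ ≤ T + 1)
    (e : S × A × S) : |avgLoss f w τ e| ≤ 1 := by
  rw [avgLoss, abs_mul, abs_of_nonneg (by positivity)]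
  have h1 : |∑ j ∈ Finset.range τ, f (w + j) e| ≤ τ := by
    calc _ ≤ ∑ j ∈ Finset.range τ, |f (w + j) e| := Finset.abs_sum_le_sum_abs _ _
      _ ≤ ∑ j ∈ Finset.range τ, (1 : ℝ) := Finset.sum_le_sum fun j hj =>
          hf _ (by omega) (by have := Finset.mem_range.1 hj; omega) e
      _ = τ := by simp
  calc _ ≤ 1 / (τ : ℝ) * τ := mul_le_mul_of_nonneg_left h1 (by positivity)
    _ ≤ 1 := by
      rw [one_div]
      exact inv_mul_le_one

/-- Four events of probability at most `ζ` leave a set of measure at least `1 - 4 ζ`. -/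
lemma ofReal_le_measure_of_four {Ω : Type*} [MeasurableSpace Ω] {μ : Measure Ω}
    [IsProbabilityMeasure μ] {ζ : ℝ} (hζ : 0 ≤ ζ) {E E₁ E₂ E₃ E₄ : Set Ω}
    (h₁ : μ E₁ ≤ ENNReal.ofReal ζ) (h₂ : μ E₂ ≤ ENNReal.ofReal ζ) (h₃ : μ E₃ ≤ ENNReal.ofReal ζ)
    (h₄ : μ E₄ ≤ ENNReal.ofReal ζ)
    (h : ∀ᵐ ω ∂μ, ω ∉ E₁ → ω ∉ E₂ → ω ∉ E₃ → ω ∉ E₄ → ω ∈ E) :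
    ENNReal.ofReal (1 - 4 * ζ) ≤ μ E := by
  have h5 : μ Set.univ ≤ μ (E ∪ (E₁ ∪ (E₂ ∪ (E₃ ∪ E₄)))) := by
    refine measure_mono_ae ?_
    filter_upwards [h] with ω hω _
    by_contra hcon
    change ¬ (ω ∈ E ∨ ω ∈ E₁ ∨ ω ∈ E₂ ∨ ω ∈ E₃ ∨ ω ∈ E₄) at hcon
    tauto
  have h6 : μ (E ∪ (E₁ ∪ (E₂ ∪ (E₃ ∪ E₄)))) ≤ μ E + ENNReal.ofReal (4 * ζ) := by
    have e1 : ENNReal.ofReal (4 * ζ) = ENNReal.ofReal ζ + (ENNReal.ofReal ζ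
        + (ENNReal.ofReal ζ + ENNReal.ofReal ζ)) := by
      rw [← ENNReal.ofReal_add hζ hζ, ← ENNReal.ofReal_add hζ (by positivity),
        ← ENNReal.ofReal_add hζ (by positivity)]
      congr 1
      ring
    rw [e1]
    refine (measure_union_le _ _).trans (add_le_add le_rfl ?_)
    refine (measure_union_le _ _).trans (add_le_add h₁ ?_)
    refine (measure_union_le _ _).trans (add_le_add h₂ ?_)
    exact (measure_union_le _ _).trans (add_le_add h₃ h₄)
  rw [ENNReal.ofReal_sub _ (by positivity), ENNReal.ofReal_one, tsub_le_iff_right]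
  rw [measure_univ] at h5
  exact h5.trans h6

end

end UCPD

end

theorem theorem1 (σbar ϑbar B : ℝ) (hσbar : 0 < σbar) (hϑbar : 0 < ϑbar) (hB : 0 < B) :
    ∃ C : ℝ, 0 < C ∧
    ∀ {S A ι Ω : Type*} {Ξ : ι → Type*} [Fintype S] [DecidableEq S] [Fintype A] [DecidableEq A]
      [Fintype ι] [∀ i, MeasurableSpace (Ξ i)] [mΩ : MeasurableSpace Ω]
      (μ : Measure Ω) [IsProbabilityMeasure μ] (L T τ : ℕ) (ζ : ℝ)
      (M : UCPD.LoopFreeMDP S A L) (f : ℕ → S × A × S → ℝ)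
      (G : (i : ι) → S × A × S → Ξ i → ℝ) (D : (i : ι) → Measure (Ξ i))
      [∀ i, IsProbabilityMeasure (D i)] (c : ι → ℝ) (𝓕 : Filtration ℕ mΩ)
      (X : ℕ → Ω → UCPD.Path S A L) (ξ : ℕ → Ω → (i : ι) → Ξ i) (θ : ℕ → Ω → S × A × S → ℝ)
      (θstar : S × A × S → ℝ),
      1 < Fintype.card S → 1 < Fintype.card A → Fintype.card S * Fintype.card A ≤ T →
      -- measurability of the constraint functions in the sample
      (∀ i e, Measurable (G i e)) →
      -- feasibility
      (M.feasibleSet (UCPD.meanConstraint G D) c).Nonempty →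
      -- boundedness
      (∀ t, 1 ≤ t → t ≤ T → ∀ e, |f t e| ≤ 1) →
      (∀ᵐ x ∂(Measure.pi D), ∑ i, ⨆ e, |G i e (x i)| ≤ 1) →
      (∑ i, |c i| ≤ L) →
      -- primal solutions and Lagrange multipliers
      (∀ t s : ℕ, 1 ≤ t → 1 ≤ s →
        (M.solutionSet (UCPD.meanConstraint G D) c (UCPD.avgLoss f t s)).Nonempty ∧
        (M.multiplierSet (UCPD.meanConstraint G D) c (UCPD.avgLoss f t s)).Nonempty ∧
        Bornology.IsBounded
          (M.multiplierSet (UCPD.meanConstraint G D) c (UCPD.avgLoss f t s))) →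
      -- the period `τ` is `√T`, rounded up or down
      |(τ : ℝ) - √T| < 1 →
      (∀ t, 1 ≤ t → t ≤ T →
        ∀ η ∈ M.multiplierSet (UCPD.meanConstraint G D) c (UCPD.avgLoss f t τ), ‖η‖ ≤ B) →
      -- uniform error bound
      (∀ t, 1 ≤ t → t ≤ T → ∃ σ ϑ : ℝ, σbar ≤ σ ∧ 0 < ϑ ∧ ϑ ≤ ϑbar ∧
        M.ErrorBound (UCPD.meanConstraint G D) c (UCPD.avgLoss f t τ) σ ϑ) →
      -- the algorithm and its parameters
      0 < ζ → ζ ≤ 1 / (4 + 8 * L / σbar) →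
      M.IsUCPDRun T (L * √T) (L * T) (1 / T) ζ f G D c μ 𝓕 X ξ θ →
      -- the reference point
      θstar ∈ M.solutionSet (UCPD.meanConstraint G D) c (fun e => ∑ t ∈ Finset.Icc 1 T, f t e) →
      ENNReal.ofReal (1 - 4 * ζ) ≤ μ {ω |
        UCPD.regret T f (fun t => M.occupancy (UCPD.policyOf (θ t ω))) θstar
          ≤ C * (L * Fintype.card S * √(T * Fintype.card A)) *
            (Real.log (T / ζ) ^ (3 / 2 : ℝ)
              + Real.log (T * Fintype.card S * Fintype.card A / ζ)) ∧
        UCPD.violation T (fun t i e => G i e (ξ t ω i)) c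
            (fun t => M.occupancy (UCPD.policyOf (θ t ω)))
          ≤ C * (L * Fintype.card S * √(T * Fintype.card A)) *
            (Real.log (T / ζ) ^ (3 / 2 : ℝ)
              + Real.log (T * Fintype.card S * Fintype.card A / ζ))} := by
  set σ := min σbar 1 with hσdef
  have hσ : 0 < σ := lt_min hσbar one_pos
  have hσ1 : σ ≤ 1 := min_le_right _ _
  set K := UCPD.multiplierConstant σ ϑbar B with hK
  have hK0 : 0 < K := by
    rw [hK, UCPD.multiplierConstant]
    positivity
  refine ⟨9 * K + 45, by positivity, ?_⟩
  intro S A ι Ω Ξ _ _ _ _ _ _ mΩ μ _ L T τ ζ M f G D _ c 𝓕 X ξ θ θstar hS hA hSA hG hfeas hf hb hc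
    hLag hτ hmultB herr hζ hζle hrun hstar
  have hNA : Nonempty A := Fintype.card_pos_iff.1 (by omega)
  have hT : 4 ≤ T := by
    have := Nat.mul_le_mul hS hA
    omega
  have hT' : (4 : ℝ) ≤ T := by exact_mod_cast hT
  have hL : 0 < L := M.length_pos hS
  have hL' : (1 : ℝ) ≤ L := by exact_mod_cast hL
  have hζ4 : ζ ≤ 1 / 4 := hζle.trans (one_div_le_one_div_of_le (by norm_num)
    (le_add_of_nonneg_right (by positivity)))
  have hs0 : 0 < √(T : ℝ) := Real.sqrt_pos.2 (by linarith)
  have hτ0 : 0 < τ := by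
    have := (UCPD.period_bounds hT hτ).1
    exact_mod_cast (by linarith : (0 : ℝ) < τ)
  -- the near-minimizers of the Lagrangians of the windows
  have hsel : ∀ w : ℕ, ∃ sel : (ι → ℝ) → S × A × S → ℝ, Measurable sel ∧
      (∀ Q, sel Q ∈ M.occupancySet) ∧ (1 ≤ w → w + τ ≤ T + 1 → ∀ Q, (∀ i, 0 ≤ Q i) →
        UCPD.NearMinimizer T L σ ϑbar B (UCPD.avgLoss f w τ) (UCPD.meanConstraint G D) c Q
          (sel Q)) := by
    intro w
    by_cases hw : 1 ≤ w ∧ w + τ ≤ T + 1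
    · have hwT : w ≤ T := by omega
      obtain ⟨sel, h1, h2, h3⟩ := UCPD.exists_nearMinimizer (M := M)
        (φ := UCPD.avgLoss f w τ) (by omega : 0 < T) hL hσ hϑbar hfeas
        (UCPD.abs_avgLoss_le hf hw.1 hw.2) (hLag w τ hw.1 hτ0).2.1 (hmultB w hw.1 hwT)
        ((herr w hw.1 hwT).imp fun σ' h => h.imp fun ϑ' h =>
          ⟨(min_le_left _ _).trans h.1, h.2⟩)
      exact ⟨sel, h1, h2, fun _ _ => h3⟩
    · obtain ⟨z, hz, _⟩ := hfeas
      exact ⟨fun _ => z, measurable_const, fun _ => hz, fun h1 h2 => absurd ⟨h1, h2⟩ hw⟩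
  choose sel hselm hselmem hselmin using hsel
  set ψ := UCPD.driftThreshold L T τ σ ϑbar B + 2 * L * τ
    + 4 * L ^ 2 / σ * Real.log (((T : ℝ) + 1) ^ 2 / ζ) with hψdef
  have hψ0 : 0 < ψ := by
    have h1 := UCPD.windowError_pos (τ := τ) hL' hT' hσ hB
    have h2 : 0 ≤ Real.log (((T : ℝ) + 1) ^ 2 / ζ) := by
      refine Real.log_nonneg ?_
      rw [one_le_div hζ]
      nlinarith
    rw [hψdef, UCPD.driftThreshold]
    positivity
  have hψle := UCPD.multiplierBound_le hL' hT hζ hζ4 hσ hσ1 hϑbar hB hτ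
  rw [← hψdef, ← hK] at hψle
  refine UCPD.ofReal_le_measure_of_four hζ.le
    (hrun.measure_not_confidence_le (by omega) hS hA hζ (by linarith))
    (hrun.measure_expectedWidth_le (by omega) hS hA hζ (by linarith))
    (hrun.measure_noise_le hL hG hb hζ hσ hτ0 hselm hselmem)
    (hrun.measure_truncated_noise_le (by omega) hL hG hb hζ (by linarith) hψ0 hstar.1.1.1) ?_
  filter_upwards [hrun.algorithm, hrun.ae_layer_path, hrun.ae_isFlow, hrun.ae_noise hb] with ω
    hω1 hω2 hω3 hω4 h1 h2 h3 h4
  simp only [not_not] at h1 h2 h3 h4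
  have good : UCPD.GoodPath M T ζ f (fun t i e => G i e (ξ t ω i)) c (fun t => X t ω)
      (fun t => θ t ω) :=
    { card_states := hS, card_actions := hA, card_le := hSA, loss := hf, constraint := hω4
      level := hc, seq := hω1, layered := hω2, isFlow := hω3, confidence := h1 }
  have hmult : ∀ t, 1 ≤ t → t ≤ T + 1 → UCPD.vecNorm (UCPD.multiplier
      (fun t i e => G i e (ξ t ω i)) c (fun t => θ t ω) t) ≤ ψ := fun t ht htT =>
    good.vecNorm_multiplier_le hτ0 hσ hϑbar hB (fun w => hselmem w _)
      (fun w hw hwT => hselmin w hw hwT _ (UCPD.multiplier_nonneg w)) h3 ht htT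
  have hY : _ ≤ _ := not_not.1 fun hn => h4 ⟨fun t ht htT => hmult t ht (by omega), hn⟩
  have hW := good.sum_l1Norm_sub_occupancy_le h2
  have hrates := UCPD.rates hL' M.succ_length_le_card hT hS hA hSA hζ hζ4 hK0.le hψle hψ0.le
    (le_refl _)
  exact ⟨(good.regret_le hstar.1 hW hY).trans hrates.1,
    (good.violation_le hψ0.le hmult hW).trans hrates.2⟩
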